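/- **Setting.** Let $(V,d)$ be a (finite or infinite) metric space of vertices, let $\mathcal H_x$, $x\in V$, be nonzero finite-dimensional Hilbert spaces with $\dim\mathcal H_x\le N$, and for finite $X\subset V$ let $\mathcal A_X=\mathcal B(\bigotimes_{x\in X}\mathcal H_x)$. Let $\mathcal A$ be the $C^*$-algebra of quasi-local observables, i.e. the norm completion of $\bigcup_X\mathcal A_X$ over the finite $X\subset V$. We write $\mathcal A_x=\mathcal A_{\{x\}}$. An interaction $\Phi$ assigns to each finite $X\subset V$ an element $\Phi(X)=\Phi(X)^*\in\mathcal A_X$. Fix $\lambda>0$ and suppose that $$\|\Phi\|_\lambda=\sup_{x\in V}\sum_{X\ni x}|X|\,\|\Phi(X)\|\,N^{2|X|}e^{\lambda D(X)}<\infty,\qquad D(X)=\max_{x,y\in X}d(x,y).$$ Let $\tau_t(A)=\lim_{\Lambda\uparrow V}e^{itH_\Lambda}Ae^{-itH_\Lambda}$, $H_\Lambda=\sum_{X\subset\Lambda}\Phi(X)$, be the dynamics on $\mathcal A$ (a norm limit along the finite sets $\Lambda\subset V$; for finite $V$ it is $e^{itH_V}Ae^{-itH_V}$). Let $\pi$ be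 a representation of $\mathcal A$ on a Hilbert space $\mathcal H$ and $H\ge0$ a self-adjoint operator on $\mathcal H$ with $\pi(\tau_t(A))=e^{itH}\pi(A)e^{-itH}$ for all $A\in\mathcal A$, $t\in\mathbb R$. Let $\Omega\in\mathcal H$ be a unit vector with $H\Omega=0$, and let $P_0$ be the orthogonal projection onto $\ker H$. Suppose that $H$ has a spectral gap, i.e. $\operatorname{spec}(H)\cap(0,\delta)=\emptyset$ for some $\delta>0$, and that the supremum $\gamma$ of all such $\delta$ is finite. We write $A$ for $\pi(A)$ when it acts on $\mathcal H$. For $B\in\mathcal A_Y$, the function $t\mapsto\langle\Omega,A\tau_t(B)\Omega\rangle$ has a unique continuous extension to $\{\operatorname{Im}z\ge0\}$ that is analytic in $\{\operatorname{Im}z>0\}$, namely $z\mapsto\langle\Omega,Ae^{izH}B\Omega\rangle$. Its values at $z=ib$, $b\ge0$, are written $\langle\Omega,A\tau_{ib}(B)\Omega\rangle$; they are the literal ones whenever $b<r$ and $t\mapsto\tau_t(B)$, $|t|<r$, has an $\mathcal A$-valued analytic continuation to the disk $|z|<r$. **Theorem (Exponential Clustering).** There exists $\mu>0$, namely $$\mu=\frac{\gamma\lambda}{4\|\Phi\|_\lambda+\gamma},$$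 such that for all $x\in V$, all finite nonempty $Y\subset V$ with $x\notin Y$, all $A\in\mathcal A_x$, and all $B\in\mathcal A_Y$ with $P_0B\Omega=P_0B^*\Omega=0$, the bound $$\left|\langle\Omega,A\tau_{ib}(B)\Omega\rangle\right|\le c(A,B)\,\exp\!\left(-\mu\,d(x,Y)\left(1+\frac{\gamma^2b^2}{4\mu^2d(x,Y)^2}\right)\right)$$ holds for all $b$ with $0\le\gamma b\le2\mu\,d(x,Y)$, where $$c(A,B)=\|A\|\,\|B\|\left(1+\frac{2|Y|}{\pi}+\frac1{\sqrt{\pi\mu\,d(x,Y)}}\right)$$ (in this formula $\pi$ is the number). In particular, $\left|\langle\Omega,AB\Omega\rangle-\langle\Omega,A\Omega\rangle\langle\Omega,B\Omega\rangle\right|\le c(A,B)\,e^{-\mu d(x,Y)}$. -/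

import Mathlib

open scoped ENNReal InnerProductSpace

noncomputable section

namespace SpinSystem

/-! ### The algebra of quasi-local observables

`V` is the (finite or infinite) set of vertices and the Hilbert space at `x` is `ℂ ^ (dim x)`. -/

section Observables

open scoped Classical

variable {V : Type*} (dim : V → ℕ)

/-- Configurations: the labels of the product basis. -/
abbrev Config : Type _ := ∀ x : V, Fin (dim x)

/-- Configurations on a finite set `X`: the labels of the product basis of
`H_X = ⨂ x ∈ X, ℂ ^ (dim x)`. -/
abbrev LocalConfig (X : Finset V) : Type _ := ∀ x : X, Fin (dim x.1)

/-- The Hilbert space `ℓ²(Config)`. For finite `V` it is `H_V = ⨂ x, ℂ ^ (dim x)`, written in its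
product basis. For infinite `V` it carries a faithful representation of all local algebras, and
the `C*`-norm of a local observable is its operator norm here. -/
abbrev ConfigSpace : Type _ := lp (fun _ : Config dim => ℂ) 2

variable {dim}

/-- The restriction of a configuration to `X`. -/
def restrict (X : Finset V) (s : Config dim) : LocalConfig dim X := fun x => s x.1

/-- The configuration that is `t` on `X` and `s` off `X`. -/
def glue (X : Finset V) (s : Config dim) (t : LocalConfig dim X) : Config dim :=
  fun x => if h : x ∈ X then t ⟨x, h⟩ else s x

theorem restrict_glue (X : Finset V) (s : Config dim) (t : LocalConfig dim X) :
    restrict X (glue X s t) = t := by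
  funext x
  simp [restrict, glue]

theorem glue_glue (X : Finset V) (s : Config dim) (t u : LocalConfig dim X) :
    glue X (glue X s t) u = glue X s u := by
  funext x
  by_cases h : x ∈ X <;> simp [glue, h]

theorem glue_restrict (X : Finset V) (s : Config dim) : glue X s (restrict X s) = s := by
  funext x
  by_cases h : x ∈ X <;> simp [glue, restrict, h]

/-- `T = M ⊗ 1`, where the matrix `M` acts on `H_X` and `1` acts on the sites off `X`. -/
def IsAmplification (X : Finset V) (M : Matrix (LocalConfig dim X) (LocalConfig dim X) ℂ)
    (T : ConfigSpace dim →L[ℂ] ConfigSpace dim) : Prop :=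
  ∀ (ψ : ConfigSpace dim) (s : Config dim),
    (T ψ) s = ∑ t, M (restrict X s) t * ψ (glue X s t)

theorem IsAmplification.one (X : Finset V) :
    IsAmplification (dim := dim) X 1 1 := by
  intro ψ s
  simp [Matrix.one_apply, glue_restrict]

theorem IsAmplification.smul {X : Finset V} {M : Matrix (LocalConfig dim X) (LocalConfig dim X) ℂ}
    {T : ConfigSpace dim →L[ℂ] ConfigSpace dim} (h : IsAmplification X M T) (c : ℂ) :
    IsAmplification X (c • M) (c • T) := by
  intro ψ s
  have := h ψ s
  simp only [_root_.smul_apply, lp.coeFn_smul, Pi.smul_apply, this, smul_eq_mul,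
    Finset.mul_sum, Matrix.smul_apply, mul_assoc]

theorem IsAmplification.add {X : Finset V}
    {M M' : Matrix (LocalConfig dim X) (LocalConfig dim X) ℂ}
    {T T' : ConfigSpace dim →L[ℂ] ConfigSpace dim}
    (h : IsAmplification X M T) (h' : IsAmplification X M' T') :
    IsAmplification X (M + M') (T + T') := by
  intro ψ s
  simp only [_root_.add_apply, lp.coeFn_add, Pi.add_apply, h ψ s, h' ψ s,
    Matrix.add_apply, add_mul, Finset.sum_add_distrib]

theorem IsAmplification.mul {X : Finset V}
    {M M' : Matrix (LocalConfig dim X) (LocalConfig dim X) ℂ}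
    {T T' : ConfigSpace dim →L[ℂ] ConfigSpace dim}
    (h : IsAmplification X M T) (h' : IsAmplification X M' T') :
    IsAmplification X (M * M') (T * T') := by
  intro ψ s
  have e : ((T * T') ψ) s = (T (T' ψ)) s := rfl
  simp only [e, h _ s, h' ψ, restrict_glue, glue_glue,
    Matrix.mul_apply, Finset.mul_sum, Finset.sum_mul]
  rw [Finset.sum_comm]
  simp only [mul_assoc]

theorem IsAmplification.star {X : Finset V}
    {M : Matrix (LocalConfig dim X) (LocalConfig dim X) ℂ}
    {T : ConfigSpace dim →L[ℂ] ConfigSpace dim} (h : IsAmplification X M T) :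
    IsAmplification X M.conjTranspose (star T) := by
  intro ψ s
  have key : T (lp.single 2 s (1 : ℂ)) =
      ∑ t, M t (restrict X s) • lp.single (E := fun _ : Config dim => ℂ) 2 (glue X s t) 1 := by
    ext u
    rw [h]
    simp only [lp.coeFn_sum, Finset.sum_apply, lp.coeFn_smul, Pi.smul_apply, lp.coeFn_single,
      smul_eq_mul, Pi.single_apply, mul_ite, mul_one, mul_zero]
    by_cases hu : ∃ t, u = glue X s t
    · obtain ⟨t, rfl⟩ := hu
      have h1 : ∀ v, (glue X (glue X s t) v = s) ↔ v = restrict X s := by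
        intro v
        rw [glue_glue]
        constructor
        · intro hv
          rw [← hv, restrict_glue]
        · rintro rfl
          exact glue_restrict X s
      have h2 : ∀ v, (glue X s t = glue X s v) ↔ t = v := by
        intro v
        constructor
        · intro hv
          rw [← restrict_glue X s t, hv, restrict_glue]
        · rintro rfl
          rfl
      simp [h1, h2, restrict_glue]
    · have h1 : ∀ v, ¬ (glue X u v = s) := by
        intro v hv
        refine hu ⟨restrict X u, ?_⟩
        rw [← hv, glue_glue, glue_restrict]
      have h2 : ∀ v, ¬ (u = glue X s v) := fun v hv => hu ⟨v, hv⟩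
      simp [h1, h2]
  have e1 : (Star.star T ψ) s = ⟪lp.single (E := fun _ : Config dim => ℂ) 2 s (1 : ℂ), Star.star T ψ⟫_ℂ := by
    rw [lp.inner_single_left]
    simp
  rw [e1, ContinuousLinearMap.star_eq_adjoint, ContinuousLinearMap.adjoint_inner_right, key,
    sum_inner]
  refine Finset.sum_congr rfl fun t _ => ?_
  rw [inner_smul_left, lp.inner_single_left]
  simp [Matrix.conjTranspose_apply]

variable (dim)

/-- The algebra `𝒜_X = B(H_X)` of the observables in the finite set `X`, as operators `M ⊗ 1`. -/
def localAlgebra (X : Finset V) :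
    StarSubalgebra ℂ (ConfigSpace dim →L[ℂ] ConfigSpace dim) where
  carrier := {T | ∃ M, IsAmplification X M T}
  mul_mem' := by
    rintro _ _ ⟨M, h⟩ ⟨M', h'⟩
    exact ⟨_, h.mul h'⟩
  add_mem' := by
    rintro _ _ ⟨M, h⟩ ⟨M', h'⟩
    exact ⟨_, h.add h'⟩
  algebraMap_mem' := by
    intro c
    rw [Algebra.algebraMap_eq_smul_one]
    exact ⟨_, (IsAmplification.one X).smul c⟩
  star_mem' := by
    rintro _ ⟨M, h⟩
    exact ⟨_, h.star⟩

/-- The `C*`-algebra `𝒜` of observables: the norm closure of the union of the local algebras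
(a directed union, so that the supremum below is the union). It is all of `𝒜_V` for finite `V`. -/
def observables : StarSubalgebra ℂ (ConfigSpace dim →L[ℂ] ConfigSpace dim) :=
  (⨆ X : Finset V, localAlgebra dim X).topologicalClosure

variable {dim}

/-- The observable `A` is in `𝒜_X`. -/
def IsLocalIn (X : Finset V) (A : observables dim) : Prop :=
  (A : ConfigSpace dim →L[ℂ] ConfigSpace dim) ∈ localAlgebra dim X

variable (dim) in
/-- An interaction: a map `X ↦ Φ X = (Φ X)* ∈ 𝒜_X` on the finite sets of vertices. -/
structure Interaction where
  /-- the interaction term of a finite set -/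
  term : Finset V → observables dim
  isLocalIn : ∀ X, IsLocalIn X (term X)
  star_eq : ∀ X, star (term X) = term X

/-- The norm `‖Φ‖_λ = sup_x ∑_{X ∋ x} |X| ‖Φ(X)‖ N^(2|X|) e^(λ D(X))`, with `∞` allowed. -/
def Interaction.enorm [MetricSpace V] (Φ : Interaction dim) (N : ℕ) (lam : ℝ) : ℝ≥0∞ :=
  ⨆ x : V, ∑' X : {X : Finset V // x ∈ X},
    (X.1.card : ℝ≥0∞) * ‖Φ.term X.1‖ₑ * (N : ℝ≥0∞) ^ (2 * X.1.card) *
      ENNReal.ofReal (Real.exp (lam * Metric.diam (X.1 : Set V)))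

/-- The Hamiltonian `H_Λ = ∑_{X ⊆ Λ} Φ(X)` of the finite volume `Λ`. -/
def Interaction.hamiltonian (Φ : Interaction dim) (Λ : Finset V) : observables dim :=
  ∑ X ∈ Λ.powerset, Φ.term X

/-- The dynamics of the finite volume `Λ`: `τ^Λ_t(A) = e^{itH_Λ} A e^{-itH_Λ}`. -/
def Interaction.localDynamics (Φ : Interaction dim) (Λ : Finset V) (t : ℝ) (A : observables dim) :
    observables dim :=
  NormedSpace.exp ((Complex.I * t) • Φ.hamiltonian Λ) * A *
    NormedSpace.exp (-((Complex.I * t) • Φ.hamiltonian Λ))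

/-- The dynamics `τ_t(A) = lim_Λ τ^Λ_t(A)`, a norm limit along the finite sets `Λ ⊆ V` ordered by
inclusion. For finite `V` it is `e^{itH} A e^{-itH}` with `H = ∑_{X ⊆ V} Φ(X)`. -/
def Interaction.dynamics (Φ : Interaction dim) (t : ℝ) (A : observables dim) : observables dim :=
  Filter.limUnder Filter.atTop fun Λ : Finset V => Φ.localDynamics Λ t A

end Observables

/-! ### Unbounded self-adjoint operators -/

section Operators

variable {𝓗 : Type*} [NormedAddCommGroup 𝓗] [InnerProductSpace ℂ 𝓗]

/-- `R = (H - z)⁻¹`, as an everywhere defined bounded operator. -/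
def IsResolventAt (H : 𝓗 →ₗ.[ℂ] 𝓗) (z : ℂ) (R : 𝓗 →L[ℂ] 𝓗) : Prop :=
  (∀ ψ : 𝓗, ∃ h : R ψ ∈ H.domain, H ⟨R ψ, h⟩ - z • R ψ = ψ) ∧
    ∀ ψ : H.domain, R (H ψ - z • (ψ : 𝓗)) = ψ

/-- The spectrum of an unbounded operator: all `z` for which `H - z` has no bounded inverse. -/
def spec (H : 𝓗 →ₗ.[ℂ] 𝓗) : Set ℂ := {z | ¬ ∃ R, IsResolventAt H z R}

open Classical in
/-- The resolvent `(H - z)⁻¹` (and `0` for `z` in the spectrum). -/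
def resolventAt (H : 𝓗 →ₗ.[ℂ] 𝓗) (z : ℂ) : 𝓗 →L[ℂ] 𝓗 :=
  if h : ∃ R, IsResolventAt H z R then h.choose else 0

open Classical in
/-- The bounded operator `f(H)`, for `H` self-adjoint and `f` continuous and bounded on `spec H`.
The operator `R = (H + i)⁻¹` is bounded and normal, its range, the domain of `H`, is dense, and
`H = R⁻¹ - i`. Therefore `f(H)` is the one bounded operator with `f(H) R = g(R)`, where
`g(w) = w f(w⁻¹ - i)` and `g(0) = 0`, and `g(R)` is the continuous functional calculus of the
bounded normal operator `R`. -/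
def funCalc [CompleteSpace 𝓗] (H : 𝓗 →ₗ.[ℂ] 𝓗) (f : ℂ → ℂ) : 𝓗 →L[ℂ] 𝓗 :=
  let R := resolventAt H (-Complex.I)
  if h : ∃ T : 𝓗 →L[ℂ] 𝓗, T * R = cfc (fun w : ℂ => w * f (w⁻¹ - Complex.I)) R
  then h.choose else 0

/-- The operator `e^{izH}`: unitary for real `z`, and a contraction for `Im z ≥ 0` if `H ≥ 0`. -/
def expI [CompleteSpace 𝓗] (H : 𝓗 →ₗ.[ℂ] 𝓗) (z : ℂ) : 𝓗 →L[ℂ] 𝓗 :=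
  funCalc H fun x => Complex.exp (Complex.I * z * x)

/-- `H ≥ 0`. -/
def IsNonneg (H : 𝓗 →ₗ.[ℂ] 𝓗) : Prop :=
  ∀ ψ : H.domain, 0 ≤ (⟪(ψ : 𝓗), H ψ⟫_ℂ).re

/-- The subspace `ker H`. -/
def kernel (H : 𝓗 →ₗ.[ℂ] 𝓗) : Submodule ℂ 𝓗 := (LinearMap.ker H.toFun).map H.domain.subtype

/-- The orthogonal projection `P₀` onto `ker H`, which is closed for self-adjoint `H`. -/
def kernelProj [CompleteSpace 𝓗] (H : 𝓗 →ₗ.[ℂ] 𝓗) : 𝓗 →L[ℂ] 𝓗 :=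
  (kernel H).topologicalClosure.starProjection

/-- `H` has a spectral gap, and it is `γ = sup {δ > 0 | spec H ∩ (0, δ) = ∅} < ∞`. -/
def IsSpectralGap (H : 𝓗 →ₗ.[ℂ] 𝓗) (γ : ℝ) : Prop :=
  let S := {δ : ℝ | 0 < δ ∧ ∀ E ∈ Set.Ioo 0 δ, (E : ℂ) ∉ spec H}
  S.Nonempty ∧ IsLUB S γ

end Operators

section Representation

variable {V : Type*} {dim : V → ℕ}
variable {𝓗 : Type*} [NormedAddCommGroup 𝓗] [InnerProductSpace ℂ 𝓗] [CompleteSpace 𝓗]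

/-- The representation `π` of the observables and the self-adjoint operator `H` represent the
system: `π(τ_t(A)) = e^{itH} π(A) e^{-itH}`. -/
structure Represents (Φ : Interaction dim) (π : observables dim →⋆ₙₐ[ℂ] (𝓗 →L[ℂ] 𝓗))
    (H : 𝓗 →ₗ.[ℂ] 𝓗) : Prop where
  isSelfAdjoint : IsSelfAdjoint H
  covariant : ∀ (t : ℝ) (A : observables dim),
    π (Φ.dynamics t A) = expI H t * π A * expI H (-t)

/-- The function `z ↦ ⟨Ω, A τ_z(B) Ω⟩` on `Im z ≥ 0`, for a vector with `H Ω = 0`. It is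
`⟨Ω, A e^{izH} B e^{-izH} Ω⟩ = ⟨Ω, A e^{izH} B Ω⟩`; at `z = ib` this is `⟨Ω, A e^{-bH} B Ω⟩`. -/
def correlation (π : observables dim →⋆ₙₐ[ℂ] (𝓗 →L[ℂ] 𝓗)) (H : 𝓗 →ₗ.[ℂ] 𝓗) (Ω : 𝓗)
    (A B : observables dim) (z : ℂ) : ℂ :=
  ⟪Ω, π A (expI H z (π B Ω))⟫_ℂ

end Representation

end SpinSystem

end

/-! Since `H Ω = 0`, the expectation of `[A, τ_t(B)]` in `Ω` is `F(t) - G(t)` with `F(t) = ⟨A*Ω,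
e^{itH} BΩ⟩` and `G(t) = ⟨B*Ω, e^{-itH} AΩ⟩`. As `BΩ` and `B*Ω` are orthogonal to `ker H`, the
function `F` has frequencies in `[γ, ∞)` only and `G` has frequencies in `(-∞, -γ]` only. A filter
that multiplies a frequency `E ≥ γ` by nearly `e^{-bE}` and nearly annihilates `E ≤ -γ` therefore
recovers `⟨Ω, A e^{-bH} BΩ⟩` from the commutator alone.

The filter is `k(t) = e^{-α(t² + b²)} / (2πi (t - ib))`. With `α = 0` its Fourier transform would be
exactly `e^{-bE}` for `E > 0` and `0` for `E < 0`. The Gaussian smooths this, with an error of at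
most `e^{-αb² - E²/(4α)} / 2` on both sides if `2αb ≤ γ` (`norm_exp_sub_integral_gaussKernel_le`,
`norm_integral_gaussKernel_neg_le`).

The commutator is small for short times by the Lieb-Robinson bound `2‖A‖‖B‖ e^{-λd} (e^{2K|t|} -
1)`, where `K = ‖Φ‖_λ` and `d = d(x, Y)`. It is used for `|t| ≤ s`; for `|t| > s` the Gaussian in
`k` beats the trivial bound. With `α = γ²/(4μd)` and `s = 2μd/γ` one has `γ²/(4α) = αs² = μd`, and
`-λd + 2Ks = -μd` is the equation that determines `μ`. The common factor `e^{-αb²}` yields the term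
quadratic in `b`.

The Lieb-Robinson bound is a Picard iteration: only interaction terms that touch `x` make `[A,
τ_t(B)]` grow, and expansion in matrix units, at the cost `N^(2|X|)`, reduces their commutators to
single sites. The iteration closes on any vertex weight `v` that the interaction maps below `κ v`.
The weight `e^{-λ d(x, Y)}` gives the decay; a summable weight shows that the infinite-volume limit
exists.

On the Hilbert space side, functions of `H` are built from the continuous functional calculus of `(H
+ i)⁻¹`. The gap isolates `0` in the spectrum, so the indicator of `{0}` is an admissible function,
and on the complement of `ker H` only `[γ, ∞)` matters. -/

noncomputable section

namespace SpinSystem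

set_option linter.unusedSectionVars false

/-! ### Resolvents and spectrum of a gapped self-adjoint operator. -/

section Resolvent

variable {𝓗 : Type*} [NormedAddCommGroup 𝓗] [InnerProductSpace ℂ 𝓗]

theorem IsResolventAt.unique {H : 𝓗 →ₗ.[ℂ] 𝓗} {z : ℂ} {R R' : 𝓗 →L[ℂ] 𝓗}
    (h : IsResolventAt H z R) (h' : IsResolventAt H z R') : R = R' := by
  ext ψ
  obtain ⟨hd, e⟩ := h'.1 ψ
  have := h.2 ⟨R' ψ, hd⟩
  rw [e] at this
  exact this

theorem IsResolventAt.resolventAt_eq {H : 𝓗 →ₗ.[ℂ] 𝓗} {z : ℂ} {R : 𝓗 →L[ℂ] 𝓗}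
    (h : IsResolventAt H z R) : resolventAt H z = R := by
  have hex : ∃ R, IsResolventAt H z R := ⟨R, h⟩
  rw [resolventAt, dif_pos hex]
  exact hex.choose_spec.unique h

/-- The first resolvent identity. -/
theorem IsResolventAt.sub_eq {H : 𝓗 →ₗ.[ℂ] 𝓗} {z w : ℂ} {R S : 𝓗 →L[ℂ] 𝓗}
    (hR : IsResolventAt H z R) (hS : IsResolventAt H w S) : R - S = (z - w) • (S * R) := by
  ext ψ
  obtain ⟨hd, e⟩ := hR.1 ψ
  have h2 := hS.2 ⟨R ψ, hd⟩
  have e2 : H ⟨R ψ, hd⟩ - w • R ψ = ψ + (z - w) • R ψ := by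
    rw [sub_eq_iff_eq_add.mp e]
    module
  simp only at h2
  rw [e2, map_add, map_smul] at h2
  simp only [sub_apply, smul_apply, mul_apply_eq_comp]
  rw [sub_eq_iff_eq_add, add_comm]
  exact h2.symm

variable [CompleteSpace 𝓗]

theorem symmetric_of_isSelfAdjoint {H : 𝓗 →ₗ.[ℂ] 𝓗} (hH : IsSelfAdjoint H) (x y : H.domain) :
    ⟪H x, (y : 𝓗)⟫_ℂ = ⟪(x : 𝓗), H y⟫_ℂ := by
  have h := LinearPMap.adjoint_isFormalAdjoint (T := H) hH.dense_domain
  rw [LinearPMap.isSelfAdjoint_def.mp hH] at h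
  exact h x y

/-- This is the half of self-adjointness that symmetry lacks: the domain of the adjoint is contained
in that of `H`. -/
theorem mem_domain_of_isSelfAdjoint {H : 𝓗 →ₗ.[ℂ] 𝓗} (hH : IsSelfAdjoint H) {y w : 𝓗}
    (h : ∀ x : H.domain, ⟪w, (x : 𝓗)⟫_ℂ = ⟪y, H x⟫_ℂ) :
    ∃ hy : y ∈ H.domain, H ⟨y, hy⟩ = w := by
  have key : ∃ hy : y ∈ H.adjoint.domain, H.adjoint ⟨y, hy⟩ = w :=
    ⟨LinearPMap.mem_adjoint_domain_of_exists y ⟨w, h⟩,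
      LinearPMap.adjoint_apply_eq hH.dense_domain _ h⟩
  rwa [LinearPMap.isSelfAdjoint_def.mp hH] at key

/-- A self-adjoint operator such that `H - z` and its adjoint are bounded below has a resolvent
at `z`. -/
theorem exists_isResolventAt {H : 𝓗 →ₗ.[ℂ] 𝓗} (hH : IsSelfAdjoint H) {z : ℂ} {c : ℝ} (hc : 0 < c)
    (h1 : ∀ φ : H.domain, c * ‖(φ : 𝓗)‖ ≤ ‖H φ - z • (φ : 𝓗)‖)
    (h2 : ∀ φ : H.domain, c * ‖(φ : 𝓗)‖ ≤ ‖H φ - (starRingEnd ℂ z) • (φ : 𝓗)‖) :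
    ∃ R, IsResolventAt H z R := by
  set e : H.domain →ₗ[ℂ] 𝓗 := H.toFun - z • H.domain.subtype with he
  have he' : ∀ φ, e φ = H φ - z • (φ : 𝓗) := fun φ => rfl
  -- A vector `u` orthogonal to the range of `H - z` satisfies `H u = conj z • u`, so it vanishes by
  -- `h2`.
  have hdense : DenseRange e := by
    have : (LinearMap.range e).topologicalClosure = ⊤ := by
      rw [Submodule.topologicalClosure_eq_top_iff, Submodule.eq_bot_iff]
      intro u hu
      rw [Submodule.mem_orthogonal'] at hu
      obtain ⟨hd, hHu⟩ := mem_domain_of_isSelfAdjoint hH (y := u) (w := (starRingEnd ℂ z) • u) (by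
        intro x
        have := hu (e x) ⟨x, rfl⟩
        rw [he', inner_sub_right, inner_smul_right, sub_eq_zero] at this
        rw [inner_smul_left, this]
        simp)
      have := h2 ⟨u, hd⟩
      rw [hHu, sub_self, norm_zero] at this
      have : ‖u‖ ≤ 0 := by
        by_contra hcon
        push Not at hcon
        exact absurd this (not_le.mpr (mul_pos hc hcon))
      simpa using this
    have h3 := (Submodule.dense_iff_topologicalClosure_eq_top).mpr this
    exact h3
  have hnorm : ∀ φ, ‖H.domain.subtype φ‖ ≤ c⁻¹ * ‖e φ‖ := by
    intro φ
    rw [he', ← div_eq_inv_mul, le_div_iff₀' hc]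
    exact h1 φ
  set R : 𝓗 →L[ℂ] 𝓗 := H.domain.subtype.extendOfNorm e with hRdef
  have hR : ∀ φ : H.domain, R (e φ) = φ := fun φ =>
    LinearMap.extendOfNorm_eq hdense ⟨c⁻¹, hnorm⟩ φ
  refine ⟨R, ?_, hR⟩
  intro ψ
  -- Both sides of the weak form of `H R ψ = ψ + z R ψ` are continuous in `ψ`, so it extends from
  -- the dense range of `H - z`.
  obtain ⟨hd, hv⟩ := mem_domain_of_isSelfAdjoint hH (y := R ψ) (w := ψ + z • R ψ) (by
    intro χ
    have hcl : IsClosed {ψ : 𝓗 | ⟪ψ + z • R ψ, (χ : 𝓗)⟫_ℂ = ⟪R ψ, H χ⟫_ℂ} :=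
      isClosed_eq (by fun_prop) (by fun_prop)
    refine hdense.induction_on (p := fun ψ => ⟪ψ + z • R ψ, (χ : 𝓗)⟫_ℂ = ⟪R ψ, H χ⟫_ℂ) ψ hcl ?_
    intro φ
    rw [hR, he', sub_add_cancel]
    exact symmetric_of_isSelfAdjoint hH φ χ)
  exact ⟨hd, by rw [hv]; abel⟩

theorem exists_isResolventAt_of_inner {H : 𝓗 →ₗ.[ℂ] 𝓗} (hH : IsSelfAdjoint H) {z : ℂ} {c : ℝ}
    (hc : 0 < c)
    (h1 : ∀ φ : H.domain, c * ‖(φ : 𝓗)‖ ^ 2 ≤ ‖⟪(φ : 𝓗), H φ - z • (φ : 𝓗)⟫_ℂ‖)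
    (h2 : ∀ φ : H.domain,
      c * ‖(φ : 𝓗)‖ ^ 2 ≤ ‖⟪(φ : 𝓗), H φ - (starRingEnd ℂ z) • (φ : 𝓗)⟫_ℂ‖) :
    ∃ R, IsResolventAt H z R := by
  have key : ∀ (φ v : 𝓗), c * ‖φ‖ ^ 2 ≤ ‖⟪φ, v⟫_ℂ‖ → c * ‖φ‖ ≤ ‖v‖ := by
    intro φ v h
    rcases eq_or_ne φ 0 with rfl | hφ
    · simp
    · have hp : 0 < ‖φ‖ := norm_pos_iff.mpr hφ
      have := h.trans (norm_inner_le_norm φ v)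
      nlinarith
  exact exists_isResolventAt hH hc (fun φ => key _ _ (h1 φ)) (fun φ => key _ _ (h2 φ))

theorem inner_self_im_eq_zero {H : 𝓗 →ₗ.[ℂ] 𝓗} (hH : IsSelfAdjoint H) (φ : H.domain) :
    (⟪(φ : 𝓗), H φ⟫_ℂ).im = 0 := by
  have h := symmetric_of_isSelfAdjoint hH φ φ
  rw [← inner_conj_symm] at h
  exact Complex.conj_eq_iff_im.mp h

theorem inner_sub_smul {H : 𝓗 →ₗ.[ℂ] 𝓗} (φ : H.domain) (z : ℂ) :
    ⟪(φ : 𝓗), H φ - z • (φ : 𝓗)⟫_ℂ = ⟪(φ : 𝓗), H φ⟫_ℂ - z * ((‖(φ : 𝓗)‖ ^ 2 : ℝ) : ℂ) := by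
  rw [inner_sub_right, inner_smul_right, inner_self_eq_norm_sq_to_K]
  push_cast
  rfl

/-- `⟪φ, H φ⟫` is real, so the imaginary part of `⟪φ, (H - z) φ⟫` is `-Im z ‖φ‖²`. -/
theorem exists_isResolventAt_of_im_ne_zero {H : 𝓗 →ₗ.[ℂ] 𝓗} (hH : IsSelfAdjoint H) {z : ℂ}
    (hz : z.im ≠ 0) : ∃ R, IsResolventAt H z R := by
  have key : ∀ (w : ℂ), |w.im| = |z.im| → ∀ φ : H.domain,
      |z.im| * ‖(φ : 𝓗)‖ ^ 2 ≤ ‖⟪(φ : 𝓗), H φ - w • (φ : 𝓗)⟫_ℂ‖ := by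
    intro w hw φ
    refine le_trans ?_ (Complex.abs_im_le_norm _)
    rw [inner_sub_smul, Complex.sub_im, inner_self_im_eq_zero hH, Complex.im_mul_ofReal, zero_sub,
      abs_neg, abs_mul, hw, abs_of_nonneg (sq_nonneg ‖(φ : 𝓗)‖)]
  exact exists_isResolventAt_of_inner hH (abs_pos.mpr hz) (key z rfl) (key _ (by simp))

theorem exists_isResolventAt_of_neg {H : 𝓗 →ₗ.[ℂ] 𝓗} (hH : IsSelfAdjoint H) (hn : IsNonneg H)
    {x : ℝ} (hx : x < 0) : ∃ R, IsResolventAt H (x : ℂ) R := by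
  have key : ∀ φ : H.domain,
      (-x) * ‖(φ : 𝓗)‖ ^ 2 ≤ ‖⟪(φ : 𝓗), H φ - (x : ℂ) • (φ : 𝓗)⟫_ℂ‖ := by
    intro φ
    refine le_trans ?_ (Complex.re_le_norm _)
    rw [inner_sub_smul, Complex.sub_re, ← Complex.ofReal_mul, Complex.ofReal_re]
    have := hn φ
    linarith
  exact exists_isResolventAt_of_inner hH (neg_pos.mpr hx) key (by simpa using key)

/-- The closed set `{0} ∪ [γ, ∞)`. -/
def gapSet (γ : ℝ) : Set ℂ := {z | z = 0 ∨ (z.im = 0 ∧ γ ≤ z.re)}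

/-- `H` is self-adjoint and nonnegative with spectral gap `γ`. -/
structure IsGapped (H : 𝓗 →ₗ.[ℂ] 𝓗) (γ : ℝ) : Prop where
  isSelfAdjoint : IsSelfAdjoint H
  isNonneg : IsNonneg H
  isSpectralGap : IsSpectralGap H γ

theorem IsGapped.pos {H : 𝓗 →ₗ.[ℂ] 𝓗} {γ : ℝ} (h : IsGapped H γ) : 0 < γ := by
  obtain ⟨⟨δ, hδ⟩, hlub⟩ := h.isSpectralGap
  exact hδ.1.trans_le (hlub.1 hδ)

/-- Off the real axis self-adjointness suffices, on the negative axis positivity. A point of `(0,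
γ)` lies below some admissible `δ`, because `γ` is their supremum. -/
theorem IsGapped.exists_isResolventAt {H : 𝓗 →ₗ.[ℂ] 𝓗} {γ : ℝ} (h : IsGapped H γ) {z : ℂ}
    (hz : z ∉ gapSet γ) : ∃ R, IsResolventAt H z R := by
  by_cases him : z.im = 0
  · have hzr : z = (z.re : ℂ) := by
      apply Complex.ext <;> simp [him]
    simp only [gapSet, Set.mem_ofPred_eq, not_or, not_and, not_le] at hz
    have hlt := hz.2 him
    rcases lt_trichotomy z.re 0 with h0 | h0 | h0
    · rw [hzr]
      exact exists_isResolventAt_of_neg h.isSelfAdjoint h.isNonneg h0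
    · exact absurd (by rw [hzr, h0]; simp) hz.1
    · obtain ⟨δ, hδ, hlt'⟩ := (lt_isLUB_iff h.isSpectralGap.2).mp hlt
      have := hδ.2 z.re ⟨h0, hlt'⟩
      rw [spec, Set.mem_ofPred_eq, not_not, ← hzr] at this
      exact this
  · exact exists_isResolventAt_of_im_ne_zero h.isSelfAdjoint him

section R

variable {H : 𝓗 →ₗ.[ℂ] 𝓗} {γ : ℝ}

theorem IsGapped.resolvent (h : IsGapped H γ) :
    IsResolventAt H (-Complex.I) (resolventAt H (-Complex.I)) := by
  obtain ⟨R, hR⟩ := exists_isResolventAt_of_im_ne_zero h.isSelfAdjoint (z := -Complex.I) (by simp)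
  rw [hR.resolventAt_eq]
  exact hR

theorem adjoint_isResolventAt (hH : IsSelfAdjoint H) {z : ℂ} {R S : 𝓗 →L[ℂ] 𝓗}
    (hR : IsResolventAt H z R) (hS : IsResolventAt H (starRingEnd ℂ z) S) : star R = S := by
  rw [ContinuousLinearMap.star_eq_adjoint, eq_comm, ContinuousLinearMap.eq_adjoint_iff]
  intro x y
  obtain ⟨hx, ex⟩ := hS.1 x
  obtain ⟨hy, ey⟩ := hR.1 y
  conv_lhs => rw [← ey]
  conv_rhs => rw [← ex]
  rw [inner_sub_right, inner_sub_left, inner_smul_left, inner_smul_right,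
    symmetric_of_isSelfAdjoint hH ⟨S x, hx⟩ ⟨R y, hy⟩]
  simp

/-- The adjoint of `(H + i)⁻¹` is `(H - i)⁻¹`, and the resolvent identity written in both orders
makes them commute. -/
theorem IsGapped.isStarNormal (h : IsGapped H γ) :
    IsStarNormal (resolventAt H (-Complex.I)) := by
  obtain ⟨S, hS⟩ := exists_isResolventAt_of_im_ne_zero h.isSelfAdjoint (z := Complex.I) (by simp)
  have hR := h.resolvent
  have e := adjoint_isResolventAt h.isSelfAdjoint hR (S := S) (by simpa using hS)
  constructor
  rw [e]
  have h1 := hR.sub_eq hS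
  have h2 := hS.sub_eq hR
  have h3 : (-Complex.I - Complex.I) • (S * resolventAt H (-Complex.I)) =
      (-Complex.I - Complex.I) • (resolventAt H (-Complex.I) * S) := by
    rw [← h1, ← neg_sub, h2, ← neg_smul]
    congr 1
    ring
  have hne : (-Complex.I - Complex.I) ≠ 0 := by
    intro hc
    have := congrArg Complex.im hc
    norm_num at this
  exact smul_right_injective _ hne h3

theorem IsResolventAt.injective {z : ℂ} {R : 𝓗 →L[ℂ] 𝓗} (hR : IsResolventAt H z R) :
    Function.Injective R := by
  intro x y hxy
  obtain ⟨hx, ex⟩ := hR.1 x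
  obtain ⟨hy, ey⟩ := hR.1 y
  rw [← ex, ← ey]
  simp only [hxy]

theorem IsResolventAt.denseRange {z : ℂ} {R : 𝓗 →L[ℂ] 𝓗} (hH : IsSelfAdjoint H)
    (hR : IsResolventAt H z R) : DenseRange R := by
  refine hH.dense_domain.mono ?_
  intro x hx
  exact ⟨_, hR.2 ⟨x, hx⟩⟩

/-- Spectral mapping for `w = 1/(E + i)`: if `S` is the resolvent of `H` at `w⁻¹ - i`, then `w⁻¹(1 +
w⁻¹ S)` inverts `w - (H + i)⁻¹`. -/
theorem IsGapped.spectrum_resolvent (h : IsGapped H γ) {w : ℂ}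
    (hw : w ∈ spectrum ℂ (resolventAt H (-Complex.I))) (hw0 : w ≠ 0) :
    w⁻¹ - Complex.I ∈ gapSet γ := by
  by_contra hcon
  obtain ⟨S, hS⟩ := h.exists_isResolventAt hcon
  set R := resolventAt H (-Complex.I) with hRdef
  have hR : IsResolventAt H (-Complex.I) R := h.resolvent
  have h1 := hS.sub_eq hR
  have h2 := hR.sub_eq hS
  have e1 : w⁻¹ - Complex.I - -Complex.I = w⁻¹ := by ring
  have e2 : -Complex.I - (w⁻¹ - Complex.I) = -w⁻¹ := by ring
  rw [e1] at h1
  rw [e2] at h2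
  have k1 : R * S = w • (S - R) := by
    rw [h1, smul_smul, mul_inv_cancel₀ hw0, one_smul]
  have k2 : S * R = w • (S - R) := by
    rw [← neg_sub, h2, neg_smul, neg_neg, smul_smul, mul_inv_cancel₀ hw0, one_smul]
  refine hw (isUnit_iff_exists.mpr ⟨w⁻¹ • (1 + w⁻¹ • S), ?_, ?_⟩)
  · simp only [Algebra.algebraMap_eq_smul_one, sub_mul, mul_add, mul_smul_comm, smul_mul_assoc,
      one_mul, mul_one, k1]
    match_scalars <;> field_simp <;> ring
  · simp only [Algebra.algebraMap_eq_smul_one, mul_sub, add_mul, mul_smul_comm, smul_mul_assoc,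
      one_mul, mul_one, k2]
    match_scalars <;> field_simp <;> ring

end R

end Resolvent

/-! ### Bounded functional calculus of `H` through `(H + i)⁻¹`. -/

section Calculus

open Function

variable {𝓗 : Type*} [NormedAddCommGroup 𝓗] [InnerProductSpace ℂ 𝓗] [CompleteSpace 𝓗]
variable {H : 𝓗 →ₗ.[ℂ] 𝓗} {γ : ℝ}

/-- The bounded normal operator `(H + i)⁻¹`. -/
abbrev baseResolvent (H : 𝓗 →ₗ.[ℂ] 𝓗) : 𝓗 →L[ℂ] 𝓗 := resolventAt H (-Complex.I)

/-- `h` is continuous on `{0} ∪ [γ, ∞)` and bounded there by `C`. -/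
structure Admissible (γ C : ℝ) (h : ℂ → ℂ) : Prop where
  continuousOn : ContinuousOn h (gapSet γ)
  norm_le : ∀ E ∈ gapSet γ, ‖h E‖ ≤ C

theorem zero_mem_gapSet : (0 : ℂ) ∈ gapSet γ := Or.inl rfl

theorem Admissible.nonneg {C : ℝ} {h : ℂ → ℂ} (hh : Admissible γ C h) : 0 ≤ C :=
  (norm_nonneg _).trans (hh.norm_le 0 zero_mem_gapSet)

/-- The point `w = 0` corresponds to `E = ∞`, where `f x` need not have a limit; boundedness of `f`
and the zero of `p` restore continuity. The parameter `x` serves for integrals over time. -/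
theorem IsGapped.continuousOn_family (hg : IsGapped H γ) {X : Type*} [TopologicalSpace X]
    {f : X → ℂ → ℂ} {C : ℝ} (hf : ContinuousOn (uncurry f) (Set.univ ×ˢ gapSet γ))
    (hC : ∀ x, ∀ E ∈ gapSet γ, ‖f x E‖ ≤ C) {p : ℂ → ℂ} (hp : Continuous p) (hp0 : p 0 = 0) :
    ContinuousOn (uncurry fun x w => p w * f x (w⁻¹ - Complex.I))
      (Set.univ ×ˢ spectrum ℂ (baseResolvent H)) := by
  rintro ⟨x, w⟩ ⟨-, hw⟩
  by_cases hw0 : w = 0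
  · subst hw0
    simp only [ContinuousWithinAt, uncurry, hp0, zero_mul]
    refine squeeze_zero_norm' (a := fun q : X × ℂ => ‖p q.2‖ * C) ?_ ?_
    · refine Filter.eventually_of_mem self_mem_nhdsWithin ?_
      rintro ⟨y, v⟩ ⟨-, hv⟩
      by_cases hv0 : v = 0
      · simp [hv0, hp0]
      · change ‖p v * f y (v⁻¹ - Complex.I)‖ ≤ ‖p v‖ * C
        rw [norm_mul]
        exact mul_le_mul_of_nonneg_left (hC _ _ (hg.spectrum_resolvent hv hv0)) (norm_nonneg _)
    · have : Continuous fun q : X × ℂ => ‖p q.2‖ * C := by fun_prop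
      have h2 := (this.tendsto (x, (0 : ℂ))).mono_left (nhdsWithin_le_nhds
        (s := Set.univ ×ˢ spectrum ℂ (baseResolvent H)))
      simpa [hp0] using h2
  · have hopen : IsOpen {q : X × ℂ | q.2 ≠ 0} := isOpen_ne_fun continuous_snd continuous_const
    refine ContinuousWithinAt.mono_of_mem_nhdsWithin
      (t := (Set.univ ×ˢ spectrum ℂ (baseResolvent H)) ∩ {q : X × ℂ | q.2 ≠ 0}) ?_
      (Filter.inter_mem self_mem_nhdsWithin (mem_nhdsWithin_of_mem_nhds (hopen.mem_nhds hw0)))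
    have hmap : Set.MapsTo (fun q : X × ℂ => (q.1, q.2⁻¹ - Complex.I))
        ((Set.univ ×ˢ spectrum ℂ (baseResolvent H)) ∩ {q : X × ℂ | q.2 ≠ 0})
        (Set.univ ×ˢ gapSet γ) := by
      rintro ⟨y, v⟩ ⟨⟨-, hv⟩, hv0⟩
      exact ⟨trivial, hg.spectrum_resolvent hv hv0⟩
    have h1 : ContinuousWithinAt (fun q : X × ℂ => (q.1, q.2⁻¹ - Complex.I))
        ((Set.univ ×ˢ spectrum ℂ (baseResolvent H)) ∩ {q : X × ℂ | q.2 ≠ 0}) (x, w) := by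
      refine ContinuousAt.continuousWithinAt ?_
      exact continuousAt_fst.prodMk ((continuousAt_snd.inv₀ hw0).sub continuousAt_const)
    have h2 := ContinuousWithinAt.comp (x := (x, w)) (hf _ (hmap ⟨⟨trivial, hw⟩, hw0⟩)) h1 hmap
    exact ContinuousWithinAt.mul (hp.comp continuous_snd).continuousWithinAt h2

theorem IsGapped.continuousOn_mul (hg : IsGapped H γ) {h : ℂ → ℂ} {C : ℝ}
    (hh : Admissible γ C h) {p : ℂ → ℂ} (hp : Continuous p) (hp0 : p 0 = 0) :
    ContinuousOn (fun w => p w * h (w⁻¹ - Complex.I)) (spectrum ℂ (baseResolvent H)) := by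
  have h1 := hg.continuousOn_family (X := Unit) (f := fun _ => h) (C := C)
    (hh.continuousOn.comp continuous_snd.continuousOn fun q hq => hq.2) (fun _ => hh.norm_le) hp hp0
  exact h1.comp (f := fun w : ℂ => ((), w)) (Continuous.prodMk_right ()).continuousOn
    fun w hw => ⟨trivial, hw⟩

/-- The function whose continuous functional calculus at `(H + i)⁻¹` is `f(H) (H + i)⁻¹`. -/
abbrev resFun (h : ℂ → ℂ) (w : ℂ) : ℂ := w * h (w⁻¹ - Complex.I)

theorem IsGapped.cfc_mul_baseResolvent (hg : IsGapped H γ) {p : ℂ → ℂ}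
    (hp : ContinuousOn p (spectrum ℂ (baseResolvent H))) :
    cfc p (baseResolvent H) * baseResolvent H = cfc (fun w => p w * w) (baseResolvent H) := by
  have hN := hg.isStarNormal
  rw [cfc_mul p (fun w => w) _ hp continuousOn_id, cfc_id' ℂ (baseResolvent H)]

theorem IsGapped.continuousOn_resFun (hg : IsGapped H γ) {h : ℂ → ℂ} {C : ℝ}
    (hh : Admissible γ C h) : ContinuousOn (resFun h) (spectrum ℂ (baseResolvent H)) :=
  hg.continuousOn_mul hh continuous_id rfl

/-- A bound by `‖R ψ‖`, not merely by `‖ψ‖`, is what lets `h(H)` extend from the range of `R = (H +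
i)⁻¹`. The cutoff `p(w) = |w|/(|w| + ε)` makes `p h` continuous on the spectrum with norm at most
`C`, and `p h w` differs from `h w` by at most `Cε`. -/
theorem IsGapped.norm_cfc_resFun_apply_le (hg : IsGapped H γ) {h : ℂ → ℂ} {C : ℝ}
    (hh : Admissible γ C h) (ψ : 𝓗) :
    ‖cfc (resFun h) (baseResolvent H) ψ‖ ≤ C * ‖baseResolvent H ψ‖ := by
  have hN := hg.isStarNormal
  set R := baseResolvent H with hR
  have hC := hh.nonneg
  refine le_of_forall_pos_le_add fun δ hδ => ?_
  -- Chosen so that `C ε ‖ψ‖ ≤ δ`; the `1` keeps the denominator positive.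
  set ε : ℝ := δ / (C * ‖ψ‖ + 1) with hε
  have hCψ : 0 ≤ C * ‖ψ‖ := by positivity
  have hεpos : 0 < ε := by positivity
  set p : ℂ → ℂ := fun w => ((‖w‖ / (‖w‖ + ε) : ℝ) : ℂ) with hp
  have hpos : ∀ w : ℂ, 0 < ‖w‖ + ε := fun w => by positivity
  have hpc : Continuous p :=
    Complex.continuous_ofReal.comp (continuous_norm.div (by fun_prop) fun w => (hpos w).ne')
  have hp0 : p 0 = 0 := by simp [hp]
  have c1 := hg.continuousOn_mul hh hpc hp0
  have c2 := hg.continuousOn_resFun hh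
  have c3 : ContinuousOn (fun w : ℂ => w) (spectrum ℂ R) := continuousOn_id
  have e1 : cfc (fun w => p w * h (w⁻¹ - Complex.I)) R * R =
      cfc (fun w => p w * h (w⁻¹ - Complex.I) * w) R := by
    rw [cfc_mul _ _ R c1 c3, cfc_id' ℂ R]
  have n1 : ‖cfc (fun w => p w * h (w⁻¹ - Complex.I)) R‖ ≤ C := by
    refine norm_cfc_le hC fun w hw => ?_
    by_cases hw0 : w = 0
    · simp [hw0, hp0, hC]
    rw [norm_mul]
    have : ‖p w‖ ≤ 1 := by
      simp only [hp, Complex.norm_real, Real.norm_eq_abs]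
      rw [abs_of_nonneg (by positivity), div_le_one (hpos w)]
      linarith
    calc ‖p w‖ * ‖h (w⁻¹ - Complex.I)‖ ≤ 1 * C :=
          mul_le_mul this (hh.norm_le _ (hg.spectrum_resolvent hw hw0)) (norm_nonneg _) zero_le_one
      _ = C := one_mul C
  have n2 : ‖cfc (resFun h) R - cfc (fun w => p w * h (w⁻¹ - Complex.I) * w) R‖ ≤ C * ε := by
    have c4 : ContinuousOn (fun w => p w * h (w⁻¹ - Complex.I) * w) (spectrum ℂ R) := c1.mul c3
    rw [← cfc_sub _ _ R c2 c4]
    refine norm_cfc_le (by positivity) fun w hw => ?_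
    by_cases hw0 : w = 0
    · simp only [hw0, resFun, zero_mul, mul_zero, sub_self, norm_zero]
      positivity
    have e : resFun h w - p w * h (w⁻¹ - Complex.I) * w =
        h (w⁻¹ - Complex.I) * ((‖w‖ : ℂ)⁻¹ * w) * (((‖w‖ * ε / (‖w‖ + ε)) : ℝ) : ℂ) := by
      have h1 : (‖w‖ : ℂ) ≠ 0 := by simpa using hw0
      have h2 : ((‖w‖ : ℂ) + ε) ≠ 0 := by exact_mod_cast (hpos w).ne'
      simp only [resFun, hp]
      push_cast
      field_simp
      ring
    rw [e, norm_mul, norm_mul, norm_mul, Complex.norm_real, Real.norm_eq_abs, norm_inv,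
      Complex.norm_real, norm_norm, inv_mul_cancel₀ (norm_ne_zero_iff.mpr hw0), mul_one,
      abs_of_nonneg (by positivity)]
    refine mul_le_mul (hh.norm_le _ (hg.spectrum_resolvent hw hw0)) ?_ (by positivity) hC
    rw [div_le_iff₀ (hpos w)]
    nlinarith
  calc ‖cfc (resFun h) R ψ‖
      = ‖(cfc (fun w => p w * h (w⁻¹ - Complex.I)) R) (R ψ) +
          (cfc (resFun h) R - cfc (fun w => p w * h (w⁻¹ - Complex.I) * w) R) ψ‖ := by
        rw [← e1]
        simp
    _ ≤ ‖(cfc (fun w => p w * h (w⁻¹ - Complex.I)) R) (R ψ)‖ +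
        ‖(cfc (resFun h) R - cfc (fun w => p w * h (w⁻¹ - Complex.I) * w) R) ψ‖ := norm_add_le _ _
    _ ≤ C * ‖R ψ‖ + C * ε * ‖ψ‖ :=
        add_le_add (ContinuousLinearMap.le_of_opNorm_le _ n1 _)
          (ContinuousLinearMap.le_of_opNorm_le _ n2 _)
    _ ≤ C * ‖R ψ‖ + δ := by
        gcongr
        rw [hε, mul_right_comm, mul_div_assoc', div_le_iff₀ (by positivity)]
        nlinarith

/-- The range of `(H + i)⁻¹` is dense. Identities between functions of `H` are proved by cancelling
this factor. -/
theorem IsGapped.eq_of_mul_baseResolvent (hg : IsGapped H γ) {S T : 𝓗 →L[ℂ] 𝓗}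
    (h : S * baseResolvent H = T * baseResolvent H) : S = T := by
  have hd := hg.resolvent.denseRange hg.isSelfAdjoint
  ext ψ
  exact congrFun (hd.equalizer S.continuous T.continuous
    (funext fun φ => congrArg (fun X : 𝓗 →L[ℂ] 𝓗 => X φ) h)) ψ

theorem IsGapped.exists_op (hg : IsGapped H γ) {h : ℂ → ℂ} {C : ℝ} (hh : Admissible γ C h) :
    ∃ T : 𝓗 →L[ℂ] 𝓗, T * baseResolvent H = cfc (resFun h) (baseResolvent H) ∧ ‖T‖ ≤ C := by
  have hd := hg.resolvent.denseRange hg.isSelfAdjoint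
  have hb := hg.norm_cfc_resFun_apply_le hh
  set g : 𝓗 →ₗ[ℂ] 𝓗 := (cfc (resFun h) (baseResolvent H)).toLinearMap
  set e : 𝓗 →ₗ[ℂ] 𝓗 := (baseResolvent H).toLinearMap
  refine ⟨g.extendOfNorm e, ?_, ?_⟩
  · ext ψ
    exact LinearMap.extendOfNorm_eq (f := g) (e := e) hd ⟨C, hb⟩ ψ
  · exact ContinuousLinearMap.opNorm_le_bound _ hh.nonneg
      fun ψ => LinearMap.norm_extendOfNorm_apply_le (f := g) (e := e) hd C hb ψ

theorem IsGapped.funCalc_mul_baseResolvent (hg : IsGapped H γ) {h : ℂ → ℂ} {C : ℝ}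
    (hh : Admissible γ C h) :
    funCalc H h * baseResolvent H = cfc (resFun h) (baseResolvent H) := by
  have hex : ∃ T : 𝓗 →L[ℂ] 𝓗, T * baseResolvent H = cfc (resFun h) (baseResolvent H) := by
    obtain ⟨T, hT, -⟩ := hg.exists_op hh
    exact ⟨T, hT⟩
  have : funCalc H h = hex.choose := dif_pos hex
  rw [this]
  exact hex.choose_spec

theorem IsGapped.norm_funCalc_le (hg : IsGapped H γ) {h : ℂ → ℂ} {C : ℝ}
    (hh : Admissible γ C h) : ‖funCalc H h‖ ≤ C := by
  obtain ⟨T, hT, hn⟩ := hg.exists_op hh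
  rwa [hg.eq_of_mul_baseResolvent ((hg.funCalc_mul_baseResolvent hh).trans hT.symm)]

theorem IsGapped.baseResolvent_mul_funCalc (hg : IsGapped H γ) {h : ℂ → ℂ} {C : ℝ}
    (hh : Admissible γ C h) :
    baseResolvent H * funCalc H h = cfc (resFun h) (baseResolvent H) := by
  have hN := hg.isStarNormal
  rw [← hg.funCalc_mul_baseResolvent hh]
  apply hg.eq_of_mul_baseResolvent
  rw [mul_assoc, hg.funCalc_mul_baseResolvent hh]
  have : Commute (cfc (resFun h) (baseResolvent H)) (baseResolvent H) := by
    have := cfc_commute_cfc (resFun h) (fun w : ℂ => w) (baseResolvent H)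
    rwa [cfc_id' ℂ (baseResolvent H)] at this
  exact this.eq.symm

theorem IsGapped.cfc_congr (hg : IsGapped H γ) {p q : ℂ → ℂ} (h0 : p 0 = q 0)
    (h : ∀ E ∈ gapSet γ, E + Complex.I ≠ 0 → p (E + Complex.I)⁻¹ = q (E + Complex.I)⁻¹) :
    cfc p (baseResolvent H) = cfc q (baseResolvent H) := by
  refine _root_.cfc_congr fun w hw => ?_
  by_cases hw0 : w = 0
  · rw [hw0, h0]
  · have := h _ (hg.spectrum_resolvent hw hw0) (by simpa using hw0)
    simpa using this

theorem IsGapped.funCalc_congr (hg : IsGapped H γ) {h h' : ℂ → ℂ}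
    (e : ∀ E ∈ gapSet γ, h E = h' E) : funCalc H h = funCalc H h' := by
  have : cfc (resFun h) (baseResolvent H) = cfc (resFun h') (baseResolvent H) := by
    refine hg.cfc_congr (by simp) fun E hE _ => ?_
    simp [resFun, e E hE]
  have key : ∀ a b : 𝓗 →L[ℂ] 𝓗, a = b →
      (open Classical in if h : ∃ T : 𝓗 →L[ℂ] 𝓗, T * baseResolvent H = a then h.choose else 0) =
      (open Classical in if h : ∃ T : 𝓗 →L[ℂ] 𝓗, T * baseResolvent H = b then h.choose else 0) := by
    rintro a _ rfl
    rfl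
  exact key _ _ this

theorem IsGapped.funCalc_mul (hg : IsGapped H γ) {h h' : ℂ → ℂ} {C C' : ℝ}
    (hh : Admissible γ C h) (hh' : Admissible γ C' h') :
    funCalc H (fun E => h E * h' E) = funCalc H h * funCalc H h' := by
  have hN := hg.isStarNormal
  have ad : Admissible γ (C * C') (fun E => h E * h' E) :=
    ⟨hh.continuousOn.mul hh'.continuousOn, fun E hE => by
      rw [norm_mul]
      exact mul_le_mul (hh.norm_le E hE) (hh'.norm_le E hE) (norm_nonneg _) hh.nonneg⟩
  -- Two factors `(H + i)⁻¹` are needed, one for each function, because only `w h(w⁻¹ - i)` is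
  -- continuous on the spectrum.
  apply hg.eq_of_mul_baseResolvent
  apply hg.eq_of_mul_baseResolvent
  have c1 := hg.continuousOn_resFun hh
  have c2 := hg.continuousOn_resFun hh'
  have e1 : funCalc H h * funCalc H h' * baseResolvent H * baseResolvent H =
      cfc (resFun h) (baseResolvent H) * cfc (resFun h') (baseResolvent H) := by
    rw [mul_assoc (funCalc H h), hg.funCalc_mul_baseResolvent hh',
      ← hg.baseResolvent_mul_funCalc hh', ← mul_assoc, hg.funCalc_mul_baseResolvent hh, mul_assoc,
      hg.funCalc_mul_baseResolvent hh', ← hg.baseResolvent_mul_funCalc hh']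
  rw [e1, hg.funCalc_mul_baseResolvent ad, ← cfc_mul _ _ _ c1 c2,
    hg.cfc_mul_baseResolvent (hg.continuousOn_resFun ad)]
  congr 1
  ext w
  simp only [resFun]
  ring

theorem IsGapped.funCalc_sub (hg : IsGapped H γ) {h h' : ℂ → ℂ} {C C' : ℝ}
    (hh : Admissible γ C h) (hh' : Admissible γ C' h') :
    funCalc H (fun E => h E - h' E) = funCalc H h - funCalc H h' := by
  have hN := hg.isStarNormal
  have ad : Admissible γ (C + C') (fun E => h E - h' E) :=
    ⟨hh.continuousOn.sub hh'.continuousOn, fun E hE =>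
      (norm_sub_le _ _).trans (add_le_add (hh.norm_le E hE) (hh'.norm_le E hE))⟩
  apply hg.eq_of_mul_baseResolvent
  rw [sub_mul, hg.funCalc_mul_baseResolvent ad, hg.funCalc_mul_baseResolvent hh,
    hg.funCalc_mul_baseResolvent hh', ← cfc_sub _ _ _ (hg.continuousOn_resFun hh)
    (hg.continuousOn_resFun hh')]
  congr 1
  ext w
  simp only [resFun]
  ring

theorem Admissible.const (c : ℂ) : Admissible γ ‖c‖ (fun _ => c) :=
  ⟨continuousOn_const, fun _ _ => le_rfl⟩

theorem IsGapped.funCalc_const (hg : IsGapped H γ) (c : ℂ) :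
    funCalc H (fun _ => c) = c • 1 := by
  have hN := hg.isStarNormal
  apply hg.eq_of_mul_baseResolvent
  rw [hg.funCalc_mul_baseResolvent (Admissible.const c), smul_mul_assoc, one_mul]
  nth_rw 2 [← cfc_id' ℂ (baseResolvent H)]
  rw [← cfc_smul c (fun w : ℂ => w) (baseResolvent H)]
  congr 1
  ext w
  simp [resFun, mul_comm]

theorem Admissible.conj {C : ℝ} {h : ℂ → ℂ} (hh : Admissible γ C h) :
    Admissible γ C (fun E => starRingEnd ℂ (h E)) :=
  ⟨Complex.continuous_conj.comp_continuousOn hh.continuousOn, fun E hE => by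
    rw [RCLike.norm_conj]
    exact hh.norm_le E hE⟩

theorem IsGapped.star_funCalc (hg : IsGapped H γ) {h : ℂ → ℂ} {C : ℝ} (hh : Admissible γ C h) :
    star (funCalc H h) = funCalc H (fun E => starRingEnd ℂ (h E)) := by
  have hN := hg.isStarNormal
  apply hg.eq_of_mul_baseResolvent
  have hinj := hg.resolvent.injective
  -- cancel `R*` on the left, an injective operator by normality
  have hinj' : ∀ S T : 𝓗 →L[ℂ] 𝓗,
      star (baseResolvent H) * S = star (baseResolvent H) * T → S = T := by
    intro S T hST
    ext ψ
    have h1 : star (baseResolvent H) (S ψ - T ψ) = 0 := by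
      rw [map_sub, sub_eq_zero]
      exact congrArg (fun X : 𝓗 →L[ℂ] 𝓗 => X ψ) hST
    have h2 : baseResolvent H (S ψ - T ψ) = 0 := by
      set φ := S ψ - T ψ
      have h3 : (star (baseResolvent H) * baseResolvent H) φ = 0 := by
        rw [hN.star_comm_self.eq]
        simp [h1]
      have h4 : ⟪φ, star (baseResolvent H) (baseResolvent H φ)⟫_ℂ = 0 := by
        have : star (baseResolvent H) (baseResolvent H φ) = 0 := h3
        rw [this, inner_zero_right]
      rw [ContinuousLinearMap.star_eq_adjoint, ContinuousLinearMap.adjoint_inner_right] at h4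
      exact inner_self_eq_zero.mp h4
    exact sub_eq_zero.mp (hinj (h2.trans (map_zero _).symm))
  apply hinj'
  have e1 : star (baseResolvent H) * star (funCalc H h) =
      star (cfc (resFun h) (baseResolvent H)) := by
    rw [← star_mul, hg.funCalc_mul_baseResolvent hh]
  rw [← mul_assoc, e1, hg.funCalc_mul_baseResolvent hh.conj, ← cfc_star,
    hg.cfc_mul_baseResolvent (hg.continuousOn_resFun hh).star,
    ← cfc_star_id (R := ℂ) (baseResolvent H),
    ← cfc_mul _ _ _ continuous_star.continuousOn (hg.continuousOn_resFun hh.conj)]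
  congr 1
  ext w
  simp only [resFun, star_mul']
  simp only [RCLike.star_def]
  ring

/-! ### The kernel -/

theorem IsGapped.mem_kernel_iff (hg : IsGapped H γ) {u : 𝓗} :
    u ∈ kernel H ↔ baseResolvent H u = -Complex.I • u := by
  have hR := hg.resolvent
  constructor
  · rintro ⟨φ, hφ, rfl⟩
    have h0 : H φ = 0 := hφ
    have := hR.2 φ
    rw [h0, zero_sub, neg_smul, neg_neg, map_smul] at this
    change baseResolvent H (φ : 𝓗) = -Complex.I • (φ : 𝓗)
    have h2 := congrArg (fun v => -Complex.I • v) this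
    simpa [smul_smul] using h2
  · intro hu
    obtain ⟨hd, e⟩ := hR.1 u
    have hu' : u = Complex.I • baseResolvent H u := by
      rw [hu, smul_smul]
      simp
    have hmem : u ∈ H.domain := by
      rw [hu']
      exact H.domain.smul_mem _ hd
    have hr : (⟨baseResolvent H u, hd⟩ : H.domain) = -Complex.I • ⟨u, hmem⟩ := Subtype.ext hu
    rw [hr, LinearPMap.map_smul] at e
    refine ⟨⟨u, hmem⟩, ?_, rfl⟩
    change H ⟨u, hmem⟩ = 0
    change -Complex.I • H ⟨u, hmem⟩ - -Complex.I • baseResolvent H u = u at e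
    rw [hu, smul_smul] at e
    have e' : -Complex.I • H ⟨u, hmem⟩ = 0 := by
      have : (-Complex.I * -Complex.I) • u = -u := by simp
      rw [this, sub_neg_eq_add] at e
      simpa using e
    simpa using e'

/-- Since `γ > 0`, the point `0` is isolated in `gapSet γ`, so the value there is free. -/
theorem continuousOn_update (hγ : 0 < γ) {h : ℂ → ℂ} (hh : ContinuousOn h (gapSet γ)) (c : ℂ) :
    ContinuousOn (update h 0 c) (gapSet γ) := by
  intro E hE
  by_cases hE0 : E = 0
  · subst hE0
    have : nhdsWithin (0 : ℂ) (gapSet γ) ≤ pure 0 := by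
      rw [Filter.le_pure_iff]
      have hb : Metric.ball (0 : ℂ) γ ∈ nhds (0 : ℂ) := Metric.ball_mem_nhds _ hγ
      filter_upwards [self_mem_nhdsWithin, mem_nhdsWithin_of_mem_nhds hb] with z hz hzb
      rcases hz with hz | ⟨-, hz⟩
      · exact hz
      · rw [mem_ball_zero_iff] at hzb
        linarith [Complex.re_le_norm z]
    rw [ContinuousWithinAt, update_self]
    refine Filter.Tendsto.mono_left ?_ this
    rw [Filter.tendsto_pure_left]
    intro s hs
    rw [update_self]
    exact mem_of_mem_nhds hs
  · refine (hh E hE).congr_of_eventuallyEq ?_ (update_of_ne hE0 _ _)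
    filter_upwards [mem_nhdsWithin_of_mem_nhds (isOpen_ne.mem_nhds hE0)] with z hz
    exact update_of_ne hz _ _

theorem Admissible.update {C : ℝ} {h : ℂ → ℂ} (hγ : 0 < γ) (hh : ContinuousOn h (gapSet γ))
    {c : ℂ} (hc : ‖c‖ ≤ C) (hle : ∀ E ∈ gapSet γ, E ≠ 0 → ‖h E‖ ≤ C) :
    Admissible γ C (update h 0 c) :=
  ⟨continuousOn_update hγ hh c, fun E hE => by
    by_cases h0 : E = 0
    · rw [h0, update_self]
      exact hc
    · rw [update_of_ne h0]
      exact hle E hE h0⟩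

/-- The operator `1 - i(H + i)⁻¹ = H(H + i)⁻¹` kills `ker H`, and `h(H) - h(0)` factors through it:
the gap keeps the quotient `q` bounded and continuous. The value `q 0` plays no role. -/
theorem IsGapped.funCalc_apply_of_mem_kernel (hg : IsGapped H γ) {h : ℂ → ℂ} {C : ℝ}
    (hh : Admissible γ C h) {Ω : 𝓗} (hΩ : Ω ∈ kernel H) : funCalc H h Ω = h 0 • Ω := by
  have hN := hg.isStarNormal
  have hγ := hg.pos
  -- `h E - h 0 = q E * (E / (E + i))`
  have hne : ∀ E ∈ gapSet γ, E + Complex.I ≠ 0 := by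
    rintro E (rfl | ⟨h1, h2⟩) h0
    · simp at h0
    · have := congrArg Complex.re h0
      simp at this
      linarith
  set q : ℂ → ℂ := Function.update (fun E => (h E - h 0) * (1 + Complex.I * E⁻¹)) 0 0 with hq
  have hqc : ContinuousOn q (gapSet γ) := by
    intro E hE
    by_cases hE0 : E = 0
    · subst hE0
      have := continuousOn_update hγ (h := fun _ => 0) continuousOn_const 0 0 hE
      refine (this.congr_of_eventuallyEq ?_ (by simp [hq]))
      have hb : Metric.ball (0 : ℂ) γ ∈ nhds (0 : ℂ) := Metric.ball_mem_nhds _ hγ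
      filter_upwards [self_mem_nhdsWithin, mem_nhdsWithin_of_mem_nhds hb] with z hz hzb
      rcases hz with rfl | ⟨-, hz⟩
      · simp [hq]
      · rw [mem_ball_zero_iff] at hzb
        linarith [Complex.re_le_norm z]
    · have h1 : ContinuousWithinAt (fun E => (h E - h 0) * (1 + Complex.I * E⁻¹)) (gapSet γ) E := by
        refine ((hh.continuousOn E hE).sub continuousWithinAt_const).mul ?_
        exact (continuousAt_const.add
          (continuousAt_const.mul (continuousAt_id.inv₀ hE0))).continuousWithinAt
      refine h1.congr_of_eventuallyEq ?_ (update_of_ne hE0 _ _)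
      filter_upwards [mem_nhdsWithin_of_mem_nhds (isOpen_ne.mem_nhds hE0)] with z hz
      exact update_of_ne hz _ _
  have hC := hh.nonneg
  have hqa : Admissible γ (2 * C * (1 + γ⁻¹)) q := by
    refine ⟨hqc, fun E hE => ?_⟩
    by_cases hE0 : E = 0
    · rw [hE0, hq, update_self, norm_zero]
      positivity
    rw [hq, update_of_ne hE0, norm_mul]
    have hEγ : γ ≤ ‖E‖ := by
      rcases hE with hE | ⟨-, hE⟩
      · exact absurd hE hE0
      · exact hE.trans (Complex.re_le_norm E)
    refine mul_le_mul ?_ ?_ (norm_nonneg _) (by positivity)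
    · refine (norm_sub_le _ _).trans ?_
      linarith [hh.norm_le E hE, hh.norm_le 0 zero_mem_gapSet]
    · refine (norm_add_le _ _).trans ?_
      rw [norm_one, norm_mul, Complex.norm_I, one_mul, norm_inv]
      gcongr
  have key : funCalc H h - h 0 • 1 = funCalc H q * (1 - Complex.I • baseResolvent H) := by
    rw [← hg.funCalc_const, ← hg.funCalc_sub hh (Admissible.const (h 0))]
    have ad : Admissible γ (C + ‖h 0‖) (fun E => h E - h 0) :=
      ⟨hh.continuousOn.sub continuousOn_const, fun E hE =>
        (norm_sub_le _ _).trans (add_le_add (hh.norm_le E hE) le_rfl)⟩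
    apply hg.eq_of_mul_baseResolvent
    rw [hg.funCalc_mul_baseResolvent ad, mul_sub, mul_one, sub_mul, mul_smul_comm,
      hg.funCalc_mul_baseResolvent hqa, smul_mul_assoc]
    have c1 := hg.continuousOn_resFun hqa
    have c2 : ContinuousOn (fun w => resFun q w * w) (spectrum ℂ (baseResolvent H)) :=
      c1.mul continuousOn_id
    have c3 : ContinuousOn (fun w => Complex.I • (resFun q w * w))
      (spectrum ℂ (baseResolvent H)) := c2.const_smul Complex.I
    rw [hg.cfc_mul_baseResolvent c1, ← cfc_smul _ _ _ c2, ← cfc_sub _ _ _ c1 c3]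
    refine hg.cfc_congr (by simp [resFun]) fun E hE hEI => ?_
    simp only [resFun, inv_inv, add_sub_cancel_right, smul_eq_mul]
    by_cases hE0 : E = 0
    · subst hE0
      simp [hq]
    · rw [hq, update_of_ne hE0]
      field_simp
      ring
  have h1 := congrArg (fun X : 𝓗 →L[ℂ] 𝓗 => X Ω) key
  have h2 := hg.mem_kernel_iff.mp hΩ
  simp only [sub_apply, smul_apply, one_apply_eq_self, mul_apply_eq_comp, h2, smul_smul] at h1
  simpa [sub_eq_zero] using h1

/-- Orthogonality to `ker H` makes the value `h 0` irrelevant. The indicator `χ` of `0` is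
continuous on `gapSet γ`, and `χ(H)` is self-adjoint with range in `ker H`; hence `χ(H) v = 0` and
`h 0` may be replaced by `0`. -/
theorem IsGapped.norm_funCalc_apply_le (hg : IsGapped H γ) {h : ℂ → ℂ} {C C' : ℝ}
    (hh : Admissible γ C h) (hC' : 0 ≤ C') (hle : ∀ E ∈ gapSet γ, E ≠ 0 → ‖h E‖ ≤ C') {v : 𝓗}
    (hv : kernelProj H v = 0) : ‖funCalc H h v‖ ≤ C' * ‖v‖ := by
  have hN := hg.isStarNormal
  have hγ := hg.pos
  have horth : ∀ u ∈ kernel H, ⟪u, v⟫_ℂ = 0 := by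
    intro u hu
    have h1 : v ∈ (kernel H).topologicalClosureᗮ := by
      rwa [kernelProj, Submodule.starProjection_apply_eq_zero_iff] at hv
    exact h1 u ((kernel H).le_topologicalClosure hu)
  set χ : ℂ → ℂ := Function.update (fun _ => 0) 0 1 with hχ
  have hχa : Admissible γ 1 χ :=
    Admissible.update hγ continuousOn_const (by simp) (by simp)
  have hker : ∀ u, funCalc H χ u ∈ kernel H := by
    intro u
    rw [hg.mem_kernel_iff]
    -- In terms of functions: `χ(E)/(E + i) = -i χ(E)`, as `χ` lives at `E = 0`.
    have : baseResolvent H * funCalc H χ = -Complex.I • funCalc H χ := by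
      rw [hg.baseResolvent_mul_funCalc hχa, ← hg.funCalc_mul_baseResolvent hχa]
      apply hg.eq_of_mul_baseResolvent
      rw [smul_mul_assoc, hg.funCalc_mul_baseResolvent hχa]
      have c1 := hg.continuousOn_resFun hχa
      rw [← cfc_smul _ _ _ c1]
      rw [hg.cfc_mul_baseResolvent c1]
      refine hg.cfc_congr (by simp [resFun]) fun E hE hEI => ?_
      simp only [resFun, inv_inv, add_sub_cancel_right, smul_eq_mul]
      by_cases hE0 : E = 0
      · subst hE0
        simp [hχ]
      · simp [hχ, update_of_ne hE0]
    exact congrArg (fun X : 𝓗 →L[ℂ] 𝓗 => X u) this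
  have hχv : funCalc H χ v = 0 := by
    have h1 : star (funCalc H χ) = funCalc H χ := by
      rw [hg.star_funCalc hχa]
      refine hg.funCalc_congr fun E _ => ?_
      by_cases hE0 : E = 0
      · simp [hE0, hχ]
      · simp [hχ, update_of_ne hE0]
    rw [← inner_self_eq_zero (𝕜 := ℂ), ← ContinuousLinearMap.adjoint_inner_left,
      ← ContinuousLinearMap.star_eq_adjoint, h1]
    exact horth _ (hker _)
  have hla : Admissible γ C' (Function.update h 0 0) :=
    Admissible.update hγ hh.continuousOn (by simpa using hC') hle
  have hmul : Admissible γ (‖h 0‖ * 1) (fun E => h 0 * χ E) :=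
    ⟨continuousOn_const.mul hχa.continuousOn, fun E hE => by
      rw [norm_mul]
      exact mul_le_mul_of_nonneg_left (hχa.norm_le E hE) (norm_nonneg _)⟩
  have e : funCalc H (Function.update h 0 0) = funCalc H h - h 0 • funCalc H χ := by
    have e1 : funCalc H (fun E => h 0 * χ E) = h 0 • funCalc H χ := by
      rw [hg.funCalc_mul (Admissible.const (h 0)) hχa, hg.funCalc_const, smul_mul_assoc, one_mul]
    rw [← e1, ← hg.funCalc_sub hh hmul]
    refine hg.funCalc_congr fun E _ => ?_
    by_cases hE0 : E = 0
    · simp [hE0, hχ]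
    · simp [hχ, update_of_ne hE0]
  have h2 : funCalc H h v = funCalc H (Function.update h 0 0) v := by
    rw [e, sub_apply, smul_apply, hχv, smul_zero, sub_zero]
  rw [h2]
  exact ContinuousLinearMap.le_of_opNorm_le _ (hg.norm_funCalc_le hla) _

end Calculus

/-! ### The operators `e^{izH}`: continuity, analyticity, time integrals. -/

section Exponential

open Function MeasureTheory

theorem convex_im_nonneg : Convex ℝ {z : ℂ | 0 ≤ z.im} := convex_halfSpace_im_ge 0

theorem norm_exp_I_mul_le_one {a : ℂ} (ha : 0 ≤ a.im) : ‖Complex.exp (Complex.I * a)‖ ≤ 1 := by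
  rw [Complex.norm_exp, Real.exp_le_one_iff]
  simpa using ha

theorem hasDerivAt_exp_I_mul (a : ℂ) :
    HasDerivAt (fun a => Complex.exp (Complex.I * a)) (Complex.I * Complex.exp (Complex.I * a)) a := by
  have := ((hasDerivAt_id a).const_mul Complex.I).cexp
  simpa [mul_comm] using this

theorem norm_exp_sub_exp_le {a b : ℂ} (ha : 0 ≤ a.im) (hb : 0 ≤ b.im) :
    ‖Complex.exp (Complex.I * a) - Complex.exp (Complex.I * b)‖ ≤ ‖a - b‖ := by
  have := convex_im_nonneg.norm_image_sub_le_of_norm_hasDerivWithin_le (C := 1)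
    (f := fun a => Complex.exp (Complex.I * a))
    (f' := fun a => Complex.I * Complex.exp (Complex.I * a))
    (fun x _ => (hasDerivAt_exp_I_mul x).hasDerivWithinAt)
    (fun x hx => by
      rw [norm_mul, Complex.norm_I, one_mul]
      exact norm_exp_I_mul_le_one hx) hb ha
  simpa using this

/-- The mean value inequality on the segment, for `e^{ix}` minus its linear part at `b`; the
derivative of the difference is at most `‖a - b‖` by `norm_exp_sub_exp_le`. -/
theorem norm_exp_sub_exp_sub_le {a b : ℂ} (ha : 0 ≤ a.im) (hb : 0 ≤ b.im) :
    ‖Complex.exp (Complex.I * a) - Complex.exp (Complex.I * b) -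
      (a - b) * (Complex.I * Complex.exp (Complex.I * b))‖ ≤ ‖a - b‖ ^ 2 := by
  have hseg : segment ℝ b a ⊆ {z : ℂ | 0 ≤ z.im} := convex_im_nonneg.segment_subset hb ha
  have := (convex_segment b a).norm_image_sub_le_of_norm_hasDerivWithin_le (C := ‖a - b‖)
    (f := fun x => Complex.exp (Complex.I * x) - x * (Complex.I * Complex.exp (Complex.I * b)))
    (f' := fun x => Complex.I * Complex.exp (Complex.I * x) -
      1 * (Complex.I * Complex.exp (Complex.I * b)))
    (fun x _ => ((hasDerivAt_exp_I_mul x).sub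
      ((hasDerivAt_id x).mul_const _)).hasDerivWithinAt)
    (fun x hx => by
      rw [one_mul, ← mul_sub, norm_mul, Complex.norm_I, one_mul]
      refine (norm_exp_sub_exp_le (hseg hx) hb).trans ?_
      rw [segment_eq_image_lineMap] at hx
      obtain ⟨θ, ⟨h0, h1⟩, rfl⟩ := hx
      rw [AffineMap.lineMap_apply]
      simp only [vsub_eq_sub, vadd_eq_add, add_sub_cancel_right, norm_smul, Real.norm_eq_abs,
        abs_of_nonneg h0]
      exact mul_le_of_le_one_left (norm_nonneg _) h1) (left_mem_segment ℝ b a)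
      (right_mem_segment ℝ b a)
  calc _ = ‖Complex.exp (Complex.I * a) - a * (Complex.I * Complex.exp (Complex.I * b)) -
      (Complex.exp (Complex.I * b) - b * (Complex.I * Complex.exp (Complex.I * b)))‖ := by
        congr 1
        ring
    _ ≤ _ := by
        rw [sq]
        exact this

variable {𝓗 : Type*} [NormedAddCommGroup 𝓗] [InnerProductSpace ℂ 𝓗] [CompleteSpace 𝓗]
variable {H : 𝓗 →ₗ.[ℂ] 𝓗} {γ : ℝ}

theorem im_eq_zero_of_mem_gapSet {E : ℂ} (hE : E ∈ gapSet γ) : E.im = 0 := by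
  rcases hE with rfl | ⟨h, -⟩
  · rfl
  · exact h

theorem re_nonneg_of_mem_gapSet (hγ : 0 < γ) {E : ℂ} (hE : E ∈ gapSet γ) : 0 ≤ E.re := by
  rcases hE with rfl | ⟨-, h⟩
  · simp
  · exact hγ.le.trans h

theorem im_mul_nonneg (hγ : 0 < γ) {E : ℂ} (hE : E ∈ gapSet γ) {z : ℂ} (hz : 0 ≤ z.im) :
    0 ≤ (z * E).im := by
  rw [Complex.mul_im, im_eq_zero_of_mem_gapSet hE, mul_zero, zero_add]
  exact mul_nonneg hz (re_nonneg_of_mem_gapSet hγ hE)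

theorem admissible_exp (hγ : 0 < γ) {z : ℂ} (hz : 0 ≤ z.im) :
    Admissible γ 1 (fun E => Complex.exp (Complex.I * z * E)) :=
  ⟨by fun_prop, fun E hE => by
    rw [mul_assoc]
    exact norm_exp_I_mul_le_one (im_mul_nonneg hγ hE hz)⟩

theorem IsGapped.norm_expI_le (hg : IsGapped H γ) {z : ℂ} (hz : 0 ≤ z.im) : ‖expI H z‖ ≤ 1 :=
  hg.norm_funCalc_le (admissible_exp hg.pos hz)

theorem IsGapped.norm_expI_apply_le (hg : IsGapped H γ) {z : ℂ} (hz : 0 ≤ z.im) (v : 𝓗) :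
    ‖expI H z v‖ ≤ ‖v‖ := by
  simpa using ContinuousLinearMap.le_of_opNorm_le _ (hg.norm_expI_le hz) v

theorem IsGapped.expI_zero (hg : IsGapped H γ) : expI H 0 = 1 := by
  have : expI H 0 = funCalc H (fun _ => 1) := by
    simp [expI]
  rw [this, hg.funCalc_const, one_smul]

theorem IsGapped.expI_apply_of_mem_kernel (hg : IsGapped H γ) {z : ℂ} (hz : 0 ≤ z.im) {Ω : 𝓗}
    (hΩ : Ω ∈ kernel H) : expI H z Ω = Ω := by
  rw [expI, hg.funCalc_apply_of_mem_kernel (admissible_exp hg.pos hz) hΩ]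
  simp

theorem IsGapped.star_expI (hg : IsGapped H γ) (t : ℝ) : star (expI H t) = expI H (-t) := by
  rw [expI, hg.star_funCalc (admissible_exp hg.pos (by simp))]
  refine hg.funCalc_congr fun E hE => ?_
  rw [← Complex.exp_conj]
  congr 1
  have : starRingEnd ℂ E = E := Complex.conj_eq_iff_im.mpr (im_eq_zero_of_mem_gapSet hE)
  simp [this]

/-! ### Continuity and analyticity in `z` -/

/-- With `w = 1/(E + i)` and `E` real, these are `1 ≤ |E + i|` and `|E| ≤ |E + i|`. -/
theorem IsGapped.norm_le_one_of_mem_spectrum (hg : IsGapped H γ) {w : ℂ}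
    (hw : w ∈ spectrum ℂ (baseResolvent H)) :
    ‖w‖ ≤ 1 ∧ ‖w * (w⁻¹ - Complex.I)‖ ≤ 1 := by
  by_cases hw0 : w = 0
  · simp [hw0]
  have hE := hg.spectrum_resolvent hw hw0
  set E := w⁻¹ - Complex.I with hEdef
  have him : E.im = 0 := im_eq_zero_of_mem_gapSet hE
  have hEI : w⁻¹ = E + Complex.I := by rw [hEdef]; ring
  have h1 : 1 ≤ ‖w⁻¹‖ := by
    rw [hEI]
    have := Complex.abs_im_le_norm (E + Complex.I)
    simpa [him] using this
  have h2 : ‖E‖ ≤ ‖w⁻¹‖ := by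
    rw [hEI]
    have hre : ‖E‖ = |E.re| := by
      rw [← Complex.abs_re_eq_norm] at him
      exact him.symm
    rw [hre]
    simpa using Complex.abs_re_le_norm (E + Complex.I)
  rw [norm_inv] at h1 h2
  have hp : 0 < ‖w‖ := norm_pos_iff.mpr hw0
  constructor
  · have := mul_le_mul_of_nonneg_left h1 hp.le
    rwa [mul_one, mul_inv_cancel₀ hp.ne'] at this
  · rw [norm_mul]
    have := mul_le_mul_of_nonneg_left h2 hp.le
    rwa [mul_inv_cancel₀ hp.ne'] at this

theorem IsGapped.denseRange_sq (hg : IsGapped H γ) :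
    DenseRange fun v => baseResolvent H (baseResolvent H v) := by
  have hd := hg.resolvent.denseRange hg.isSelfAdjoint
  exact hd.comp hd (baseResolvent H).continuous

theorem IsGapped.expI_mul_sq (hg : IsGapped H γ) {z : ℂ} (hz : 0 ≤ z.im) :
    expI H z * baseResolvent H * baseResolvent H =
      cfc (fun w => resFun (fun E => Complex.exp (Complex.I * z * E)) w * w) (baseResolvent H) := by
  rw [expI, hg.funCalc_mul_baseResolvent (admissible_exp hg.pos hz),
    hg.cfc_mul_baseResolvent (hg.continuousOn_resFun (admissible_exp hg.pos hz))]

theorem IsGapped.continuousOn_expI_sq (hg : IsGapped H γ) {z : ℂ} (hz : 0 ≤ z.im) :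
    ContinuousOn (fun w => resFun (fun E => Complex.exp (Complex.I * z * E)) w * w)
      (spectrum ℂ (baseResolvent H)) :=
  (hg.continuousOn_resFun (admissible_exp hg.pos hz)).mul continuousOn_id

/-- For unbounded `H` the map `z ↦ e^{izH}` need not be norm continuous; the resolvents absorb the
factor `E` in `|e^{izE} - e^{iz'E}| ≤ |z - z'| E`. -/
theorem IsGapped.norm_expI_sub_sq_le (hg : IsGapped H γ) {z z' : ℂ} (hz : 0 ≤ z.im)
    (hz' : 0 ≤ z'.im) :
    ‖expI H z * baseResolvent H * baseResolvent H - expI H z' * baseResolvent H * baseResolvent H‖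
      ≤ ‖z - z'‖ := by
  have hN := hg.isStarNormal
  rw [hg.expI_mul_sq hz, hg.expI_mul_sq hz',
    ← cfc_sub _ _ _ (hg.continuousOn_expI_sq hz) (hg.continuousOn_expI_sq hz')]
  refine norm_cfc_le (norm_nonneg _) fun w hw => ?_
  obtain ⟨h1, h2⟩ := hg.norm_le_one_of_mem_spectrum hw
  by_cases hw0 : w = 0
  · simp [hw0]
  have hE := hg.spectrum_resolvent hw hw0
  have key := norm_exp_sub_exp_le (im_mul_nonneg hg.pos hE hz) (im_mul_nonneg hg.pos hE hz')
  simp only [resFun]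
  rw [← sub_mul, ← mul_sub, mul_assoc Complex.I, mul_assoc Complex.I, norm_mul, norm_mul]
  rw [← sub_mul, norm_mul] at key
  calc _ ≤ ‖w‖ * (‖z - z'‖ * ‖w⁻¹ - Complex.I‖) * 1 := by gcongr
    _ = ‖z - z'‖ * ‖w * (w⁻¹ - Complex.I)‖ := by rw [norm_mul]; ring
    _ ≤ ‖z - z'‖ := mul_le_of_le_one_right (norm_nonneg _) h2

/-- The derivative of `e^{izH} (H + i)⁻²` in `z`. -/
def expDeriv (H : 𝓗 →ₗ.[ℂ] 𝓗) (z : ℂ) : 𝓗 →L[ℂ] 𝓗 :=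
  cfc (fun w => Complex.I * (w - Complex.I * w ^ 2) *
    Complex.exp (Complex.I * z * (w⁻¹ - Complex.I))) (baseResolvent H)

/-- The second-order remainder grows like `|z - z'|² E²`, which is why two resolvents are inserted.
-/
theorem IsGapped.norm_expI_sub_sub_sq_le (hg : IsGapped H γ) {z z' : ℂ} (hz : 0 ≤ z.im)
    (hz' : 0 ≤ z'.im) :
    ‖expI H z * baseResolvent H * baseResolvent H - expI H z' * baseResolvent H * baseResolvent H
      - (z - z') • expDeriv H z'‖ ≤ ‖z - z'‖ ^ 2 := by
  have hN := hg.isStarNormal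
  have c1 := hg.continuousOn_mul (admissible_exp hg.pos hz')
    (p := fun w => Complex.I * (w - Complex.I * w ^ 2)) (by fun_prop) (by simp)
  have c2 : ContinuousOn (fun w => resFun (fun E => Complex.exp (Complex.I * z * E)) w * w -
      resFun (fun E => Complex.exp (Complex.I * z' * E)) w * w)
      (spectrum ℂ (baseResolvent H)) :=
    (hg.continuousOn_expI_sq hz).sub (hg.continuousOn_expI_sq hz')
  have c3 : ContinuousOn (fun w => (z - z') • (Complex.I * (w - Complex.I * w ^ 2) *
      Complex.exp (Complex.I * z' * (w⁻¹ - Complex.I)))) (spectrum ℂ (baseResolvent H)) :=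
    c1.const_smul (z - z')
  rw [hg.expI_mul_sq hz, hg.expI_mul_sq hz', expDeriv,
    ← cfc_sub _ _ _ (hg.continuousOn_expI_sq hz) (hg.continuousOn_expI_sq hz'),
    ← cfc_smul _ _ _ c1, ← cfc_sub _ _ _ c2 c3]
  refine norm_cfc_le (by positivity) fun w hw => ?_
  obtain ⟨h1, h2⟩ := hg.norm_le_one_of_mem_spectrum hw
  by_cases hw0 : w = 0
  · simp [hw0]
  have hE := hg.spectrum_resolvent hw hw0
  have key := norm_exp_sub_exp_sub_le (im_mul_nonneg hg.pos hE hz) (im_mul_nonneg hg.pos hE hz')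
  set E := w⁻¹ - Complex.I with hEdef
  -- The polynomial in `expDeriv` is `E/(E + i)²`, written so that it is continuous at `w = 0`.
  have hwE : w - Complex.I * w ^ 2 = w ^ 2 * E := by
    rw [hEdef]
    field_simp
  have e : resFun (fun E => Complex.exp (Complex.I * z * E)) w * w -
      resFun (fun E => Complex.exp (Complex.I * z' * E)) w * w -
      (z - z') • (Complex.I * (w - Complex.I * w ^ 2) * Complex.exp (Complex.I * z' * E)) =
      w ^ 2 * (Complex.exp (Complex.I * (z * E)) - Complex.exp (Complex.I * (z' * E)) -
        (z * E - z' * E) * (Complex.I * Complex.exp (Complex.I * (z' * E)))) := by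
    rw [hwE]
    simp only [resFun, ← hEdef, smul_eq_mul, mul_assoc]
    ring
  rw [e, norm_mul, norm_pow]
  rw [← sub_mul, norm_mul, mul_pow] at key
  rw [← sub_mul]
  calc _ ≤ ‖w‖ ^ 2 * (‖z - z'‖ ^ 2 * ‖E‖ ^ 2) := by gcongr
    _ = ‖z - z'‖ ^ 2 * ‖w * E‖ ^ 2 := by rw [norm_mul]; ring
    _ ≤ ‖z - z'‖ ^ 2 := mul_le_of_le_one_right (by positivity)
        (pow_le_one₀ (norm_nonneg _) h2)

/-- The range of `(H + i)⁻²` is dense and `e^{izH}` is a contraction uniformly in `z`, so continuity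
and analyticity pass from that range to all vectors. -/
theorem IsGapped.exists_tendstoUniformlyOn (hg : IsGapped H γ) (u v : 𝓗) :
    ∃ ψ : ℕ → 𝓗, TendstoUniformlyOn
      (fun n z => ⟪u, expI H z (baseResolvent H (baseResolvent H (ψ n)))⟫_ℂ)
      (fun z => ⟪u, expI H z v⟫_ℂ) Filter.atTop {z | 0 ≤ z.im} := by
  obtain ⟨φ, hφ, hlim⟩ := mem_closure_iff_seq_limit.mp (hg.denseRange_sq v)
  choose ψ hψ using hφ
  refine ⟨ψ, ?_⟩
  rw [Metric.tendstoUniformlyOn_iff]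
  intro ε hε
  have h1 : Filter.Tendsto (fun n => ‖u‖ * ‖v - φ n‖) Filter.atTop (nhds 0) := by
    have : Filter.Tendsto (fun n => ‖u‖ * ‖v - φ n‖) Filter.atTop (nhds (‖u‖ * ‖v - v‖)) :=
      ((tendsto_const_nhds.sub hlim).norm).const_mul _
    simpa using this
  filter_upwards [h1.eventually (gt_mem_nhds hε)] with n hn z hz
  simp only at hψ
  rw [hψ, dist_eq_norm, ← inner_sub_right, ← map_sub]
  refine lt_of_le_of_lt ((norm_inner_le_norm _ _).trans ?_) hn
  exact mul_le_mul_of_nonneg_left (hg.norm_expI_apply_le hz _) (norm_nonneg _)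

theorem IsGapped.continuousOn_inner_expI (hg : IsGapped H γ) (u v : 𝓗) :
    ContinuousOn (fun z => ⟪u, expI H z v⟫_ℂ) {z | 0 ≤ z.im} := by
  obtain ⟨ψ, hψ⟩ := hg.exists_tendstoUniformlyOn u v
  refine hψ.continuousOn (Filter.Frequently.of_forall fun n => ?_)
  have hop : ContinuousOn (fun z => expI H z * baseResolvent H * baseResolvent H)
      {z | 0 ≤ z.im} := by
    refine (LipschitzOnWith.of_dist_le_mul (K := 1) fun z hz z' hz' => ?_).continuousOn
    rw [dist_eq_norm, dist_eq_norm, NNReal.coe_one, one_mul]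
    exact hg.norm_expI_sub_sq_le hz hz'
  exact continuousOn_const.inner ((hop.clm_apply (continuousOn_const (c := ψ n))))

theorem IsGapped.differentiableOn_inner_expI (hg : IsGapped H γ) (u v : 𝓗) :
    DifferentiableOn ℂ (fun z => ⟪u, expI H z v⟫_ℂ) {z | 0 < z.im} := by
  obtain ⟨ψ, hψ⟩ := hg.exists_tendstoUniformlyOn u v
  have hopen : IsOpen {z : ℂ | 0 < z.im} := isOpen_lt continuous_const Complex.continuous_im
  have h1 := (hψ.mono (s' := {z : ℂ | 0 < z.im}) fun z hz => (show 0 < z.im from hz).le).tendstoLocallyUniformlyOn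
  refine h1.differentiableOn (Filter.Eventually.of_forall fun n => ?_) hopen
  have hop : DifferentiableOn ℂ (fun z => expI H z * baseResolvent H * baseResolvent H)
      {z | 0 < z.im} := by
    intro z' hz'
    refine DifferentiableAt.differentiableWithinAt ?_
    have : HasDerivAt (fun z => expI H z * baseResolvent H * baseResolvent H)
        (expDeriv H z') z' := by
      rw [hasDerivAt_iff_tendsto]
      refine squeeze_zero_norm' (a := fun z => ‖z - z'‖) ?_ ?_
      · filter_upwards [hopen.mem_nhds hz'] with z hz
        have hb := hg.norm_expI_sub_sub_sq_le (le_of_lt hz) (le_of_lt hz')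
        rw [norm_mul, norm_inv, norm_norm, norm_norm]
        rcases eq_or_ne z z' with rfl | hne
        · simp
        · rw [inv_mul_le_iff₀ (norm_pos_iff.mpr (sub_ne_zero.mpr hne)), ← sq]
          exact hb
      · have : Continuous fun z : ℂ => ‖z - z'‖ := by fun_prop
        simpa using this.tendsto z'
    exact this.differentiableAt
  have h2 : DifferentiableOn ℂ
      (fun z => (expI H z * baseResolvent H * baseResolvent H) (ψ n)) {z | 0 < z.im} :=
    hop.clm_apply (differentiableOn_const (c := ψ n))
  exact ((innerSL ℂ u).differentiable.comp_differentiableOn h2)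

/-! ### Integrals of `e^{itH}` -/

theorem IsGapped.continuous_inner_expI (hg : IsGapped H γ) (u v : 𝓗) :
    Continuous fun t : ℝ => ⟪u, expI H t v⟫_ℂ :=
  (hg.continuousOn_inner_expI u v).comp_continuous Complex.continuous_ofReal (by simp)

theorem continuousOn_integral_exp (hγ : 0 < γ) {k : ℝ → ℂ} (hkc : Continuous k)
    (hk : Integrable k) :
    Admissible γ (∫ t, ‖k t‖) (fun E => ∫ t : ℝ, k t * Complex.exp (Complex.I * t * E)) := by
  have hb : ∀ E ∈ gapSet γ, ∀ t : ℝ, ‖k t * Complex.exp (Complex.I * t * E)‖ ≤ ‖k t‖ := by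
    intro E hE t
    rw [norm_mul]
    exact mul_le_of_le_one_right (norm_nonneg _) ((admissible_exp hγ (z := t) (by simp)).norm_le E hE)
  constructor
  · refine continuousOn_of_dominated (bound := fun t => ‖k t‖) ?_ ?_ hk.norm ?_
    · intro E _
      exact (hkc.mul (by fun_prop)).aestronglyMeasurable
    · exact fun E hE => Filter.Eventually.of_forall (hb E hE)
    · exact Filter.Eventually.of_forall fun t => by fun_prop
  · intro E hE
    exact norm_integral_le_of_norm_le hk.norm (Filter.Eventually.of_forall (hb E hE))

/-- On the range of `(H + i)⁻¹` this is the exchange of the integral with the continuous functional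
calculus. Both sides are continuous in `v`, by dominated convergence on the right. -/
theorem IsGapped.inner_funCalc_integral (hg : IsGapped H γ) {k : ℝ → ℂ} (hkc : Continuous k)
    (hk : Integrable k) (u v : 𝓗) :
    ⟪u, funCalc H (fun E => ∫ t : ℝ, k t * Complex.exp (Complex.I * t * E)) v⟫_ℂ =
      ∫ t : ℝ, k t * ⟪u, expI H t v⟫_ℂ := by
  have hN := hg.isStarNormal
  have had := continuousOn_integral_exp hg.pos hkc hk
  have hd := hg.resolvent.denseRange hg.isSelfAdjoint
  have hcont : Continuous fun v : 𝓗 => ∫ t : ℝ, k t * ⟪u, expI H t v⟫_ℂ := by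
    rw [continuous_iff_continuousAt]
    intro v₀
    refine continuousAt_of_dominated (bound := fun t => ‖k t‖ * (‖u‖ * (‖v₀‖ + 1))) ?_ ?_ ?_ ?_
    · exact Filter.Eventually.of_forall fun v =>
        (hkc.mul (hg.continuous_inner_expI u v)).aestronglyMeasurable
    · filter_upwards [Metric.ball_mem_nhds v₀ one_pos] with v hv
      refine Filter.Eventually.of_forall fun t => ?_
      rw [norm_mul]
      refine mul_le_mul_of_nonneg_left ?_ (norm_nonneg _)
      refine (norm_inner_le_norm _ _).trans (mul_le_mul_of_nonneg_left ?_ (norm_nonneg _))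
      refine (hg.norm_expI_apply_le (by simp) v).trans ?_
      rw [mem_ball_iff_norm] at hv
      have := norm_sub_norm_le v v₀
      linarith
    · exact hk.norm.mul_const _
    · refine Filter.Eventually.of_forall fun t => ?_
      exact (by fun_prop : Continuous fun v : 𝓗 => k t * ⟪u, expI H t v⟫_ℂ).continuousAt
  refine congrFun (hd.equalizer (g := fun v => ⟪u, funCalc H (fun E => ∫ t : ℝ, k t * Complex.exp (Complex.I * t * E)) v⟫_ℂ) (by fun_prop) hcont ?_) v
  funext ψ
  simp only [comp_apply]
  set F : ℝ → ℂ → ℂ := fun t w => w * (k t * Complex.exp (Complex.I * t * (w⁻¹ - Complex.I))) with hF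
  set L : (𝓗 →L[ℂ] 𝓗) →L[ℂ] ℂ :=
    (innerSL ℂ u).comp (ContinuousLinearMap.apply ℂ 𝓗 ψ) with hL
  have hLa : ∀ T, L T = ⟪u, T ψ⟫_ℂ := fun T => rfl
  have hFt : ∀ t, cfc (F t) (baseResolvent H) = k t • (expI H t * baseResolvent H) := by
    intro t
    have ha := admissible_exp hg.pos (z := (t : ℂ)) (by simp)
    rw [expI, hg.funCalc_mul_baseResolvent ha, ← cfc_smul _ _ _ (hg.continuousOn_resFun ha)]
    congr 1
    ext w
    simp only [hF, resFun, smul_eq_mul]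
    ring
  have hjoint : ContinuousOn (uncurry F) (Set.univ ×ˢ spectrum ℂ (baseResolvent H)) := by
    have hmul : ContinuousOn (uncurry fun (t : ℝ) (w : ℂ) =>
        w * Complex.exp (Complex.I * t * (w⁻¹ - Complex.I)))
        (Set.univ ×ˢ spectrum ℂ (baseResolvent H)) := by
      refine hg.continuousOn_family (f := fun (t : ℝ) E => Complex.exp (Complex.I * t * E)) (C := 1)
        ?_ (fun t => (admissible_exp hg.pos (by simp)).norm_le) continuous_id rfl
      exact Continuous.continuousOn (by simp only [uncurry_def]; fun_prop)
    have h2 : ContinuousOn (fun q : ℝ × ℂ => k q.1)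
        (Set.univ ×ˢ spectrum ℂ (baseResolvent H)) := (hkc.comp continuous_fst).continuousOn
    refine (h2.mul hmul).congr ?_
    rintro ⟨t, w⟩ _
    change w * (k t * Complex.exp _) = k t * (w * Complex.exp _)
    ring
  have hbound : ∀ t, ∀ w ∈ spectrum ℂ (baseResolvent H), ‖F t w‖ ≤ ‖k t‖ := by
    intro t w hw
    by_cases hw0 : w = 0
    · simp [hF, hw0]
    have h1 := (hg.norm_le_one_of_mem_spectrum hw).1
    have h2 := (admissible_exp hg.pos (z := t) (by simp)).norm_le _ (hg.spectrum_resolvent hw hw0)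
    simp only [hF, norm_mul]
    calc _ ≤ 1 * (‖k t‖ * 1) := by gcongr
      _ = ‖k t‖ := by ring
  have hfin : HasFiniteIntegral (fun t => ‖k t‖) := hk.norm.hasFiniteIntegral
  have hint := integrable_cfc F (fun t => ‖k t‖) (baseResolvent H) hjoint
    (Filter.Eventually.of_forall hbound) hfin
  have e1 := cfc_integral F (fun t => ‖k t‖) (baseResolvent H) hjoint
    (Filter.Eventually.of_forall hbound) hfin
  have e2 : (fun w => ∫ t, F t w) =
      resFun fun E => ∫ t : ℝ, k t * Complex.exp (Complex.I * t * E) := by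
    funext w
    simp only [hF, resFun, integral_const_mul]
  rw [e2, ← hg.funCalc_mul_baseResolvent had] at e1
  have e3 := congrArg L e1
  rw [← L.integral_comp_comm hint] at e3
  rw [hLa] at e3
  refine e3.trans (integral_congr_ae (Filter.Eventually.of_forall fun t => ?_))
  simp only [hFt, hLa, smul_apply, inner_smul_right, mul_apply_eq_comp]

end Exponential

/-! ### The Gaussian filter and its Fourier transform. -/

section Gaussian

open MeasureTheory

/-- The kernel `e^{-α(t² + b²)} / (2πi (t - ib))`. -/
def gaussKernel (α b t : ℝ) : ℂ :=
  (2 * Real.pi * Complex.I)⁻¹ * (Real.exp (-α * (t ^ 2 + b ^ 2)) : ℂ) * (t - Complex.I * b)⁻¹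

theorem sub_I_mul_ne_zero {b : ℝ} (hb : 0 < b) (t : ℝ) : (t : ℂ) - Complex.I * b ≠ 0 := by
  intro h
  have := congrArg Complex.im h
  simp at this
  exact hb.ne' this

theorem continuous_gaussKernel (α : ℝ) {b : ℝ} (hb : 0 < b) : Continuous (gaussKernel α b) := by
  unfold gaussKernel
  refine (by fun_prop : Continuous fun t : ℝ => (2 * Real.pi * Complex.I)⁻¹ *
    (Real.exp (-α * (t ^ 2 + b ^ 2)) : ℂ)).mul ?_
  exact Continuous.inv₀ (by fun_prop) (sub_I_mul_ne_zero hb)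

theorem norm_gaussKernel (α b t : ℝ) : ‖gaussKernel α b t‖ =
    (2 * Real.pi)⁻¹ * Real.exp (-α * b ^ 2) * (Real.exp (-α * t ^ 2) * ‖(t : ℂ) - Complex.I * b‖⁻¹) := by
  unfold gaussKernel
  rw [norm_mul, norm_mul, norm_inv, norm_inv, norm_mul, norm_mul, Complex.norm_I, mul_one,
    Complex.norm_real, Complex.norm_real, Real.norm_of_nonneg Real.pi_pos.le,
    Real.norm_of_nonneg (Real.exp_pos _).le, mul_add, Real.exp_add]
  simp
  ring

theorem integrable_gaussKernel {α b : ℝ} (hα : 0 < α) (hb : 0 < b) :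
    Integrable (gaussKernel α b) := by
  have h1 : Integrable fun t : ℝ =>
      (2 * Real.pi)⁻¹ * Real.exp (-α * b ^ 2) * (Real.exp (-α * t ^ 2) * b⁻¹) :=
    ((integrable_exp_neg_mul_sq hα).mul_const _).const_mul _
  refine h1.mono' (continuous_gaussKernel α hb).aestronglyMeasurable
    (Filter.Eventually.of_forall fun t => ?_)
  rw [norm_gaussKernel]
  gcongr
  have := Complex.abs_im_le_norm ((t : ℂ) - Complex.I * b)
  simpa [abs_of_pos hb] using this

/-- The Fourier transform of the kernel. -/
theorem integral_gaussKernel_mul_exp {α b : ℝ} (hα : 0 < α) (hb : 0 < b) (E : ℝ) :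
    ∫ t : ℝ, gaussKernel α b t * Complex.exp (Complex.I * t * E) =
      ((Real.exp (-α * b ^ 2) * (2 * √(Real.pi * α))⁻¹ *
        ∫ w in Set.Ioi (0 : ℝ), Real.exp (-(w * b) - (E - w) ^ 2 / (4 * α)) : ℝ) : ℂ) := by
  -- The singular factor is `1/(t - ib) = i ∫_{w>0} e^{-(b+it)w} dw`. By Fubini the `t`-integral is
  -- done first and is Gaussian.
  set F : ℝ → ℝ → ℂ := fun t w =>
    Complex.exp (-α * t ^ 2 + Complex.I * E * t) * Complex.exp (-(b + Complex.I * t) * w) with hF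
  have hFc : Continuous (Function.uncurry F) := by
    simp only [hF, Function.uncurry_def]
    fun_prop
  have hFint : Integrable (Function.uncurry F)
      ((volume : Measure ℝ).prod (volume.restrict (Set.Ioi (0 : ℝ)))) := by
    have h1 : Integrable (fun w : ℝ => Real.exp (-b * w)) (volume.restrict (Set.Ioi (0 : ℝ))) :=
      exp_neg_integrableOn_Ioi 0 hb
    have h2 := (integrable_exp_neg_mul_sq hα).mul_prod h1
    refine h2.mono' hFc.aestronglyMeasurable (Filter.Eventually.of_forall ?_)
    rintro ⟨t, w⟩
    simp only [hF, Function.uncurry, norm_mul, Complex.norm_exp]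
    apply le_of_eq
    congr 2 <;> simp [← Complex.ofReal_pow]
  have e1 : ∀ t : ℝ, gaussKernel α b t * Complex.exp (Complex.I * t * E) =
      ((2 * Real.pi)⁻¹ * Real.exp (-α * b ^ 2) : ℝ) * ∫ w in Set.Ioi (0 : ℝ), F t w := by
    intro t
    simp only [hF, integral_const_mul]
    have hre : (-((b : ℂ) + Complex.I * t)).re < 0 := by simpa using hb
    rw [integral_exp_mul_complex_Ioi hre]
    have h0 := sub_I_mul_ne_zero hb t
    have h0' : -((b : ℂ) + Complex.I * t) ≠ 0 := fun h => by
      rw [h] at hre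
      simp at hre
    have e2 : -((b : ℂ) + Complex.I * t) = -Complex.I * (t - Complex.I * b) := by
      ring_nf
      simp
    rw [e2]
    unfold gaussKernel
    have e3 : (Real.exp (-α * (t ^ 2 + b ^ 2)) : ℂ) =
        (Real.exp (-α * b ^ 2) : ℂ) * Complex.exp (-α * t ^ 2) := by
      push_cast
      rw [← Complex.exp_add]
      ring_nf
    rw [e3, Complex.exp_add, mul_right_comm Complex.I (E : ℂ)]
    push_cast
    have hpi : (Real.pi : ℂ) ≠ 0 := by exact_mod_cast Real.pi_ne_zero
    simp only [mul_zero, Complex.exp_zero]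
    field_simp
  have e4 : ∀ w : ℝ, ∫ t : ℝ, F t w =
      ((√(Real.pi / α) * Real.exp (-(w * b) - (E - w) ^ 2 / (4 * α)) : ℝ) : ℂ) := by
    intro w
    have := integral_cexp_quadratic (b := (-α : ℂ)) (by simpa using hα) (Complex.I * (E - w))
      (-(b * w))
    have e5 : ∀ t : ℝ, F t w =
        Complex.exp (-α * t ^ 2 + Complex.I * (E - w) * t + -(b * w)) := by
      intro t
      simp only [hF, ← Complex.exp_add]
      ring_nf
    simp only [e5]
    rw [this, neg_neg]
    have e6 : ((Real.pi : ℂ) / α) ^ (1 / 2 : ℂ) = (√(Real.pi / α) : ℝ) := by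
      rw [Real.sqrt_eq_rpow, Complex.ofReal_cpow (by positivity)]
      push_cast
      rfl
    rw [e6]
    push_cast
    congr 2
    have hα0 : (α : ℂ) ≠ 0 := by exact_mod_cast hα.ne'
    rw [mul_pow, Complex.I_sq]
    field_simp
  simp only [e1, integral_const_mul]
  rw [integral_integral_swap hFint]
  simp only [e4]
  rw [integral_complex_ofReal, integral_const_mul]
  norm_cast
  have hs : √(Real.pi / α) = 2 * Real.pi * (2 * √(Real.pi * α))⁻¹ := by
    rw [Real.sqrt_div Real.pi_pos.le, Real.sqrt_mul Real.pi_pos.le]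
    have h1 : √Real.pi * √Real.pi = Real.pi := Real.mul_self_sqrt Real.pi_pos.le
    have h2 : √Real.pi ≠ 0 := (Real.sqrt_pos.mpr Real.pi_pos).ne'
    have h3 : √α ≠ 0 := (Real.sqrt_pos.mpr hα).ne'
    field_simp
    rw [sq, h1]
  rw [hs]
  have := Real.pi_ne_zero
  generalize ∫ w in Set.Ioi (0 : ℝ), Real.exp (-(w * b) - (E - w) ^ 2 / (4 * α)) = J
  field_simp

theorem integrableOn_gaussian_shift {α : ℝ} (hα : 0 < α) (m : ℝ) :
    Integrable fun w : ℝ => Real.exp (-(w + m) ^ 2 / (4 * α)) := by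
  have h := (integrable_exp_neg_mul_sq (b := (4 * α)⁻¹) (by positivity)).comp_add_right m
  refine h.congr (Filter.Eventually.of_forall fun w => ?_)
  simp only
  congr 1
  ring

theorem integral_gaussian_shift (α m : ℝ) :
    ∫ w : ℝ, Real.exp (-(w + m) ^ 2 / (4 * α)) = 2 * √(Real.pi * α) := by
  have h1 := integral_add_right_eq_self (fun w : ℝ => Real.exp (-(4 * α)⁻¹ * w ^ 2)) m (μ := volume)
  rw [integral_gaussian] at h1
  calc _ = ∫ w : ℝ, Real.exp (-(4 * α)⁻¹ * (w + m) ^ 2) := by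
        congr 1
        ext w
        congr 1
        ring
    _ = √(Real.pi / (4 * α)⁻¹) := h1
    _ = 2 * √(Real.pi * α) := by
        rw [div_inv_eq_mul, show Real.pi * (4 * α) = 2 ^ 2 * (Real.pi * α) by ring,
          Real.sqrt_mul (by norm_num), Real.sqrt_sq (by norm_num)]

/-- `(w + m)² ≥ w² + m²` for `w, m ≥ 0`. -/
theorem integral_gaussian_tail_le {α : ℝ} (hα : 0 < α) {m : ℝ} (hm : 0 ≤ m) :
    ∫ w in Set.Ioi (0 : ℝ), Real.exp (-(w + m) ^ 2 / (4 * α)) ≤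
      Real.exp (-m ^ 2 / (4 * α)) * √(Real.pi * α) := by
  have h1 : ∫ w in Set.Ioi (0 : ℝ), Real.exp (-(4 * α)⁻¹ * w ^ 2) = √(Real.pi * α) := by
    rw [integral_gaussian_Ioi, div_inv_eq_mul,
      show Real.pi * (4 * α) = 2 ^ 2 * (Real.pi * α) by ring, Real.sqrt_mul (by norm_num),
      Real.sqrt_sq (by norm_num)]
    ring
  rw [← h1, ← integral_const_mul]
  refine setIntegral_mono_on (integrableOn_gaussian_shift hα m).integrableOn
    ((integrable_exp_neg_mul_sq (by positivity)).const_mul _).integrableOn measurableSet_Ioi ?_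
  intro w hw
  rw [← Real.exp_add, Real.exp_le_exp]
  have hw' : 0 < w := hw
  have : -m ^ 2 / (4 * α) + -(4 * α)⁻¹ * w ^ 2 = -(w ^ 2 + m ^ 2) / (4 * α) := by
    field_simp
    ring
  rw [this]
  gcongr
  nlinarith

/-- At the frequency `-E` the Gaussian in `w` is centred at `-E`, outside the half-line of
integration, so only its tail contributes; `e^{-wb} ≤ 1` is discarded. -/
theorem norm_integral_gaussKernel_neg_le {α b : ℝ} (hα : 0 < α) (hb : 0 < b) {E : ℝ} (hE : 0 ≤ E) :
    ‖∫ t : ℝ, gaussKernel α b t * Complex.exp (Complex.I * t * (-E : ℝ))‖ ≤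
      2⁻¹ * Real.exp (-α * b ^ 2 - E ^ 2 / (4 * α)) := by
  rw [integral_gaussKernel_mul_exp hα hb, Complex.norm_real, Real.norm_of_nonneg (by
    refine mul_nonneg (by positivity) (integral_nonneg fun w => by positivity))]
  have hle : ∫ w in Set.Ioi (0 : ℝ), Real.exp (-(w * b) - (-E - w) ^ 2 / (4 * α)) ≤
      ∫ w in Set.Ioi (0 : ℝ), Real.exp (-(w + E) ^ 2 / (4 * α)) := by
    refine integral_mono_of_nonneg (Filter.Eventually.of_forall fun w => (Real.exp_pos _).le)
      (integrableOn_gaussian_shift hα E).integrableOn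
      ((ae_restrict_iff' measurableSet_Ioi).mpr (Filter.Eventually.of_forall fun w hw => ?_))
    have hw' : 0 < w := hw
    simp only
    rw [Real.exp_le_exp]
    have : -(w + E) ^ 2 / (4 * α) = - ((-E - w) ^ 2 / (4 * α)) := by ring
    rw [this]
    nlinarith [mul_pos hw' hb]
  have hs : 0 < √(Real.pi * α) := Real.sqrt_pos.mpr (by positivity)
  calc _ ≤ Real.exp (-α * b ^ 2) * (2 * √(Real.pi * α))⁻¹ *
        (Real.exp (-E ^ 2 / (4 * α)) * √(Real.pi * α)) := by
        gcongr
        exact hle.trans (integral_gaussian_tail_le hα hE)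
    _ = 2⁻¹ * (Real.exp (-α * b ^ 2) * Real.exp (-E ^ 2 / (4 * α))) := by
        field_simp
    _ = _ := by
        rw [← Real.exp_add]
        congr 2
        ring

/-- After completing the square the Gaussian in `w` is centred at `m = E - 2αb ≥ 0`. Over the whole
line it would give exactly `e^{-bE}`; the error is the tail on `w ≤ 0`, and `bE + m²/(4α) = αb² +
E²/(4α)`. -/
theorem norm_exp_sub_integral_gaussKernel_le {α b : ℝ} (hα : 0 < α) (hb : 0 < b) {E : ℝ}
    (hE : 2 * α * b ≤ E) :
    ‖Complex.exp (-(b * E : ℝ)) -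
        ∫ t : ℝ, gaussKernel α b t * Complex.exp (Complex.I * t * (E : ℝ))‖ ≤
      2⁻¹ * Real.exp (-α * b ^ 2 - E ^ 2 / (4 * α)) := by
  set m := E - 2 * α * b with hm
  have hm0 : 0 ≤ m := sub_nonneg.mpr hE
  have hs : 0 < √(Real.pi * α) := Real.sqrt_pos.mpr (by positivity)
  have e1 : ∀ w : ℝ, Real.exp (-(w * b) - (E - w) ^ 2 / (4 * α)) =
      Real.exp (-(b * E) + α * b ^ 2) * Real.exp (-(w + -m) ^ 2 / (4 * α)) := by
    intro w
    rw [← Real.exp_add]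
    congr 1
    rw [hm]
    field_simp
    ring
  have e2 : ∫ w in Set.Ioi (0 : ℝ), Real.exp (-(w + -m) ^ 2 / (4 * α)) =
      2 * √(Real.pi * α) - ∫ w in Set.Ioi (0 : ℝ), Real.exp (-(w + m) ^ 2 / (4 * α)) := by
    have hint := integrableOn_gaussian_shift hα (-m)
    have h1 := integral_add_compl (μ := volume) (s := Set.Ioi (0 : ℝ)) measurableSet_Ioi hint
    rw [integral_gaussian_shift, Set.compl_Ioi] at h1
    have h2 := integral_comp_neg_Ioi (0 : ℝ) (fun w => Real.exp (-(w + -m) ^ 2 / (4 * α)))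
    rw [neg_zero] at h2
    rw [← h1, ← h2, eq_sub_iff_add_eq]
    congr 2
    ext w
    congr 2
    ring
  rw [integral_gaussKernel_mul_exp hα hb]
  simp only [e1, integral_const_mul, e2]
  have e3 : Real.exp (-α * b ^ 2) * Real.exp (-(b * E) + α * b ^ 2) = Real.exp (-(b * E)) := by
    rw [← Real.exp_add]
    congr 1
    ring
  set T := ∫ w in Set.Ioi (0 : ℝ), Real.exp (-(w + m) ^ 2 / (4 * α)) with hT
  have hT0 : 0 ≤ T := integral_nonneg fun w => by positivity
  have e4 : Real.exp (-(b * E)) - Real.exp (-α * b ^ 2) * (2 * √(Real.pi * α))⁻¹ *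
      (Real.exp (-(b * E) + α * b ^ 2) * (2 * √(Real.pi * α) - T)) =
      Real.exp (-(b * E)) * ((2 * √(Real.pi * α))⁻¹ * T) := by
    rw [← e3]
    field_simp
    ring
  rw [← Complex.ofReal_neg, ← Complex.ofReal_exp, ← Complex.ofReal_sub, Complex.norm_real, e4,
    Real.norm_of_nonneg (by positivity)]
  calc _ ≤ Real.exp (-(b * E)) * ((2 * √(Real.pi * α))⁻¹ *
        (Real.exp (-m ^ 2 / (4 * α)) * √(Real.pi * α))) := by
        gcongr
        exact integral_gaussian_tail_le hα hm0
    _ = 2⁻¹ * (Real.exp (-(b * E)) * Real.exp (-m ^ 2 / (4 * α))) := by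
        field_simp
    _ = _ := by
        rw [← Real.exp_add]
        congr 2
        rw [hm]
        field_simp
        ring

end Gaussian

/-! ### Commutators of local observables by matrix units. -/

section Local

open scoped Classical

variable {V : Type*} {dim : V → ℕ}

theorem restrict_glue_of_disjoint {X Y : Finset V} (h : Disjoint X Y) (s : Config dim)
    (t : LocalConfig dim X) : restrict Y (glue X s t) = restrict Y s := by
  funext y
  simp [restrict, glue, Finset.disjoint_right.mp h y.2]

theorem glue_comm_of_disjoint {X Y : Finset V} (h : Disjoint X Y) (s : Config dim)
    (t : LocalConfig dim X) (u : LocalConfig dim Y) :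
    glue Y (glue X s t) u = glue X (glue Y s u) t := by
  funext z
  by_cases hX : z ∈ X
  · simp [glue, hX, Finset.disjoint_left.mp h hX]
  · simp [glue, hX]

theorem localAlgebra_commute {X Y : Finset V} (h : Disjoint X Y)
    {T T' : ConfigSpace dim →L[ℂ] ConfigSpace dim} (hT : T ∈ localAlgebra dim X)
    (hT' : T' ∈ localAlgebra dim Y) : T * T' = T' * T := by
  obtain ⟨M, hM⟩ := hT
  obtain ⟨M', hM'⟩ := hT'
  ext ψ s
  have e1 : ((T * T') ψ) s = (T (T' ψ)) s := rfl
  have e2 : ((T' * T) ψ) s = (T' (T ψ)) s := rfl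
  rw [e1, e2, hM, hM']
  simp only [hM' ψ, hM ψ, restrict_glue_of_disjoint h, restrict_glue_of_disjoint h.symm,
    Finset.mul_sum]
  rw [Finset.sum_comm]
  refine Finset.sum_congr rfl fun u _ => Finset.sum_congr rfl fun t _ => ?_
  rw [glue_comm_of_disjoint h]
  ring

/-! ### Matrix units -/

/-- The function `s ↦ ψ (s with b on X)` if `s = a` on `X`, and `0` otherwise. -/
def unitFun (X : Finset V) (a b : Config dim) (ψ : Config dim → ℂ) (s : Config dim) : ℂ :=
  if restrict X s = restrict X a then ψ (glue X s (restrict X b)) else 0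

theorem glue_injOn (X : Finset V) (a : Config dim) (u : LocalConfig dim X) :
    Function.Injective fun s : {s : Config dim // restrict X s = restrict X a} =>
      glue X s.1 u := by
  rintro ⟨s, hs⟩ ⟨s', hs'⟩ h
  simp only at h
  apply Subtype.ext
  simp only
  rw [← glue_restrict X s, ← glue_restrict X s', hs, hs', ← glue_glue X s u, h, glue_glue]

/-- Gluing a fixed pattern on `X` is injective on the configurations that equal `a` on `X`, so each
value of `ψ` is used at most once. -/
theorem unitFun_summable (X : Finset V) (a b : Config dim) (ψ : ConfigSpace dim) :
    Summable (fun s => ‖unitFun X a b ψ s‖ ^ 2) ∧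
      ∑' s, ‖unitFun X a b ψ s‖ ^ 2 ≤ ∑' s, ‖ψ s‖ ^ 2 := by
  have hψ : Summable fun s => ‖ψ s‖ ^ 2 := by
    have := (lp.memℓp ψ).summable (by norm_num)
    simpa using this
  have hind : (fun s => ‖unitFun X a b ψ s‖ ^ 2) =
      Set.indicator {s | restrict X s = restrict X a}
        (fun s => ‖ψ (glue X s (restrict X b))‖ ^ 2) := by
    funext s
    by_cases h : restrict X s = restrict X a
    · simp [unitFun, h, Set.indicator]
    · simp [unitFun, h, Set.indicator]
  have hinj := glue_injOn X a (restrict X b)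
  have h1 : Summable fun s : {s : Config dim // restrict X s = restrict X a} =>
      ‖ψ (glue X s.1 (restrict X b))‖ ^ 2 := hψ.comp_injective hinj
  rw [hind]
  constructor
  · exact summable_subtype_iff_indicator.mp h1
  · rw [← tsum_subtype]
    exact tsum_comp_le_tsum_of_inj hψ (fun s => by positivity) hinj

/-- The matrix unit `|a⟩⟨b|` on the sites of `X`. -/
def unitOp (X : Finset V) (a b : Config dim) : ConfigSpace dim →L[ℂ] ConfigSpace dim :=
  LinearMap.mkContinuous
    { toFun := fun ψ => ⟨unitFun X a b ψ, memℓp_gen (by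
        simpa using (unitFun_summable X a b ψ).1)⟩
      map_add' := fun ψ φ => by
        ext s
        simp only [unitFun, lp.coeFn_add, Pi.add_apply]
        split_ifs <;> simp
      map_smul' := fun c ψ => by
        ext s
        simp only [unitFun, lp.coeFn_smul, Pi.smul_apply, RingHom.id_apply]
        split_ifs <;> simp } 1 fun ψ => by
    rw [one_mul]
    refine le_of_sq_le_sq ?_ (norm_nonneg _)
    have e := fun φ : ConfigSpace dim => lp.norm_rpow_eq_tsum (p := 2) (by norm_num) φ
    simp only [ENNReal.toReal_ofNat, Real.rpow_ofNat] at e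
    rw [e, e]
    exact (unitFun_summable X a b ψ).2

theorem unitOp_apply (X : Finset V) (a b : Config dim) (ψ : ConfigSpace dim) (s : Config dim) :
    (unitOp X a b ψ) s = unitFun X a b ψ s := rfl

theorem norm_unitOp_le (X : Finset V) (a b : Config dim) : ‖unitOp X a b‖ ≤ 1 :=
  LinearMap.mkContinuous_norm_le _ zero_le_one _

theorem unitOp_mem (X : Finset V) (a b : Config dim) : unitOp X a b ∈ localAlgebra dim X := by
  refine ⟨Matrix.single (restrict X a) (restrict X b) 1, fun ψ s => ?_⟩
  rw [unitOp_apply, unitFun]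
  by_cases h : restrict X s = restrict X a
  · rw [if_pos h, Finset.sum_eq_single (restrict X b)]
    · simp [h]
    · intro t _ ht
      simp [ht.symm]
    · simp
  · rw [if_neg h]
    refine (Finset.sum_eq_zero fun t _ => ?_).symm
    have h' : ¬ restrict X a = restrict X s := fun h' => h h'.symm
    simp [h']

theorem unitOp_empty (a b : Config dim) : unitOp ∅ a b = 1 := by
  ext ψ s
  rw [unitOp_apply, unitFun, if_pos (funext fun x => absurd x.2 (Finset.notMem_empty _))]
  have : glue ∅ s (restrict ∅ b) = s := by
    funext x
    simp [glue]
  rw [this]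
  rfl

theorem unitOp_insert {X : Finset V} {x : V} (hx : x ∉ X) (a b : Config dim) :
    unitOp (insert x X) a b = unitOp {x} a b * unitOp X a b := by
  ext ψ s
  have e : ((unitOp {x} a b * unitOp X a b) ψ) s = (unitOp {x} a b (unitOp X a b ψ)) s := rfl
  rw [e, unitOp_apply, unitOp_apply]
  have hd : Disjoint {x} X := by simpa using hx
  simp only [unitFun, unitOp_apply, restrict_glue_of_disjoint hd]
  have h1 : glue (insert x X) s (restrict (insert x X) b) =
      glue X (glue {x} s (restrict {x} b)) (restrict X b) := by
    funext z
    by_cases hX : z ∈ X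
    · simp [glue, restrict, hX]
    · by_cases hz : z = x
      · subst hz
        simp [glue, restrict, hX]
      · simp [glue, hX, hz]
  have h2 : restrict (insert x X) s = restrict (insert x X) a ↔
      restrict {x} s = restrict {x} a ∧ restrict X s = restrict X a := by
    simp only [restrict, funext_iff, Subtype.forall, Finset.mem_insert, Finset.mem_singleton,
      forall_eq_or_imp, forall_eq]
  rw [h1, if_congr h2 rfl rfl, ite_and]

/-- A matrix unit on `X` is a product of single-site ones of norm at most `1`, and `[PQ, B] = [P, B]
Q + P [Q, B]`. -/
theorem norm_commutator_unitOp_le (X : Finset V) (a b : Config dim)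
    (B : ConfigSpace dim →L[ℂ] ConfigSpace dim) (c : V → ℝ) (hc : ∀ y ∈ X, 0 ≤ c y)
    (h : ∀ y ∈ X, ∀ C ∈ localAlgebra dim {y}, ‖C * B - B * C‖ ≤ ‖C‖ * c y) :
    ‖unitOp X a b * B - B * unitOp X a b‖ ≤ ∑ y ∈ X, c y := by
  induction X using Finset.induction_on with
  | empty => simp [unitOp_empty]
  | insert x X hx ih =>
    have ih' := ih (fun y hy => hc y (Finset.mem_insert_of_mem hy))
      (fun y hy => h y (Finset.mem_insert_of_mem hy))
    have hx' := h x (Finset.mem_insert_self x X) _ (unitOp_mem {x} a b)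
    have hcx := hc x (Finset.mem_insert_self x X)
    rw [unitOp_insert hx, Finset.sum_insert hx]
    set P := unitOp {x} a b with hP
    set Q := unitOp X a b with hQ
    have e : P * Q * B - B * (P * Q) = (P * B - B * P) * Q + P * (Q * B - B * Q) := by
      noncomm_ring
    have nP : ‖P‖ ≤ 1 := norm_unitOp_le _ _ _
    have nQ : ‖Q‖ ≤ 1 := norm_unitOp_le _ _ _
    rw [e]
    calc _ ≤ ‖(P * B - B * P) * Q‖ + ‖P * (Q * B - B * Q)‖ := norm_add_le _ _
      _ ≤ ‖P * B - B * P‖ * ‖Q‖ + ‖P‖ * ‖Q * B - B * Q‖ :=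
          add_le_add (norm_mul_le _ _) (norm_mul_le _ _)
      _ ≤ (1 * c x) * 1 + 1 * ∑ y ∈ X, c y := by
          gcongr
          exact hx'.trans (mul_le_mul_of_nonneg_right nP hcx)
      _ = _ := by ring

/-- A matrix entry is one coordinate of the image of a basis vector; `c₀` fills the sites off `X`.
-/
theorem IsAmplification.norm_entry_le (c₀ : Config dim) {X : Finset V}
    {M : Matrix (LocalConfig dim X) (LocalConfig dim X) ℂ}
    {T : ConfigSpace dim →L[ℂ] ConfigSpace dim} (h : IsAmplification X M T)
    (s t : LocalConfig dim X) : ‖M s t‖ ≤ ‖T‖ := by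
  set ψ : ConfigSpace dim := lp.single (E := fun _ : Config dim => ℂ) 2 (glue X c₀ t) 1 with hψ
  have h1 : (T ψ) (glue X c₀ s) = M s t := by
    rw [h, Finset.sum_eq_single t]
    · simp [hψ, restrict_glue, glue_glue]
    · intro u _ hu
      have : glue X c₀ u ≠ glue X c₀ t := fun h' => hu (by
        rw [← restrict_glue X c₀ u, h', restrict_glue])
      rw [glue_glue, hψ, lp.coeFn_single, Pi.single_eq_of_ne this, mul_zero]
    · simp
  have h2 : ‖ψ‖ = 1 := by
    rw [hψ, lp.norm_single (by norm_num)]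
    simp
  rw [← h1]
  refine (lp.norm_apply_le_norm (by norm_num) _ _).trans ?_
  simpa [h2] using T.le_opNorm ψ

theorem IsAmplification.eq_sum (c₀ : Config dim) {X : Finset V}
    {M : Matrix (LocalConfig dim X) (LocalConfig dim X) ℂ}
    {T : ConfigSpace dim →L[ℂ] ConfigSpace dim} (h : IsAmplification X M T) :
    T = ∑ s, ∑ t, M s t • unitOp X (glue X c₀ s) (glue X c₀ t) := by
  ext ψ u
  have e : ((∑ s, ∑ t, M s t • unitOp X (glue X c₀ s) (glue X c₀ t)) ψ) u =
      ∑ s, ∑ t, M s t * unitFun X (glue X c₀ s) (glue X c₀ t) ψ u := by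
    simp only [_root_.sum_apply, lp.coeFn_sum, Finset.sum_apply, smul_apply,
      lp.coeFn_smul, Pi.smul_apply, unitOp_apply, smul_eq_mul]
  rw [e, h]
  symm
  rw [Finset.sum_eq_single (restrict X u)]
  · refine Finset.sum_congr rfl fun t _ => ?_
    rw [unitFun, if_pos (by rw [restrict_glue]), restrict_glue]
  · intro s _ hs
    refine Finset.sum_eq_zero fun t _ => ?_
    rw [unitFun, if_neg (by rw [restrict_glue]; exact hs.symm), mul_zero]
  · simp

theorem card_localConfig_le {N : ℕ} (hdim : ∀ x, dim x ≤ N) (X : Finset V) :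
    Fintype.card (LocalConfig dim X) ≤ N ^ X.card := by
  rw [Fintype.card_pi]
  refine (Finset.prod_le_pow_card _ _ N fun x _ => ?_).trans (by simp)
  simpa using hdim x.1

/-- A commutator with an observable in `X` is controlled by the commutators with single-site
observables. -/
theorem norm_commutator_le {N : ℕ} (hpos : ∀ x, 0 < dim x) (hdim : ∀ x, dim x ≤ N) {X : Finset V}
    {T : ConfigSpace dim →L[ℂ] ConfigSpace dim} (hT : T ∈ localAlgebra dim X)
    (B : ConfigSpace dim →L[ℂ] ConfigSpace dim) (c : V → ℝ) (hc : ∀ y ∈ X, 0 ≤ c y)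
    (h : ∀ y ∈ X, ∀ C ∈ localAlgebra dim {y}, ‖C * B - B * C‖ ≤ ‖C‖ * c y) :
    ‖T * B - B * T‖ ≤ ‖T‖ * (N : ℝ) ^ (2 * X.card) * ∑ y ∈ X, c y := by
  obtain ⟨M, hM⟩ := hT
  -- Any configuration would do: it is overwritten on `X`, and the matrix units on `X` do not see it
  -- elsewhere.
  set c₀ : Config dim := fun x => ⟨0, hpos x⟩
  have hsum : 0 ≤ ∑ y ∈ X, c y := Finset.sum_nonneg hc
  have e : T * B - B * T = ∑ s, ∑ t, M s t • (unitOp X (glue X c₀ s) (glue X c₀ t) * B -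
      B * unitOp X (glue X c₀ s) (glue X c₀ t)) := by
    conv_lhs => rw [hM.eq_sum c₀]
    simp only [Finset.sum_mul, Finset.mul_sum, smul_sub, Finset.sum_sub_distrib, smul_mul_assoc,
      mul_smul_comm]
  have hterm : ∀ s t, ‖M s t • (unitOp X (glue X c₀ s) (glue X c₀ t) * B -
      B * unitOp X (glue X c₀ s) (glue X c₀ t))‖ ≤ ‖T‖ * ∑ y ∈ X, c y := by
    intro s t
    rw [norm_smul]
    exact mul_le_mul (hM.norm_entry_le c₀ s t) (norm_commutator_unitOp_le X _ _ B c hc h)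
      (norm_nonneg _) (norm_nonneg _)
  rw [e]
  -- There are at most `N^|X| · N^|X|` matrix units, whence the factor `N^(2|X|)` in the norm of
  -- `Φ`.
  calc _ ≤ ∑ s : LocalConfig dim X, ∑ t : LocalConfig dim X, ‖T‖ * ∑ y ∈ X, c y :=
        (norm_sum_le _ _).trans (Finset.sum_le_sum fun s _ =>
          (norm_sum_le _ _).trans (Finset.sum_le_sum fun t _ => hterm s t))
    _ = ((Fintype.card (LocalConfig dim X) : ℝ) * Fintype.card (LocalConfig dim X)) *
        (‖T‖ * ∑ y ∈ X, c y) := by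
        simp only [Finset.sum_const, Finset.card_univ, nsmul_eq_mul]
        ring
    _ ≤ ((N : ℝ) ^ X.card * (N : ℝ) ^ X.card) * (‖T‖ * ∑ y ∈ X, c y) := by
        have : (Fintype.card (LocalConfig dim X) : ℝ) ≤ (N : ℝ) ^ X.card := by
          exact_mod_cast card_localConfig_le hdim X
        gcongr
    _ = _ := by
        rw [two_mul, pow_add]
        ring

end Local

/-! ### Heisenberg evolution and Duhamel's estimate. -/

section Evolution

open Finset

variable {𝔅 : Type*} [CStarAlgebra 𝔅]

/-- The evolution `e^{ith} A e^{-ith}` generated by `h`. -/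
def evol (h : 𝔅) (t : ℝ) (A : 𝔅) : 𝔅 :=
  NormedSpace.exp ((Complex.I * t) • h) * A * NormedSpace.exp (-((Complex.I * t) • h))

@[simp]
theorem evol_zero (h A : 𝔅) : evol h 0 A = A := by simp [evol]

theorem evol_neg (h : 𝔅) (t : ℝ) (A : 𝔅) : evol (-h) (-t) A = evol h t A := by
  simp [evol]

theorem norm_evol {h : 𝔅} (hh : IsSelfAdjoint h) (t : ℝ) (A : 𝔅) : ‖evol h t A‖ = ‖A‖ := by
  have hs : IsSelfAdjoint (t • h) := (IsSelfAdjoint.all t).smul hh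
  have e : (Complex.I * t) • h = Complex.I • (t • h) := by
    rw [mul_smul]
    rfl
  set U := selfAdjoint.expUnitary ⟨t • h, hs⟩ with hU
  have h1 : NormedSpace.exp ((Complex.I * t) • h) = (U : 𝔅) := by
    rw [e, hU, selfAdjoint.expUnitary_coe]
  have h2 : NormedSpace.exp (-((Complex.I * t) • h)) = (star U : unitary 𝔅) := by
    rw [Unitary.coe_star, ← h1, NormedSpace.star_exp, star_smul, hh.star_eq, ← neg_smul]
    simp
  rw [evol, h1, h2, CStarRing.norm_mul_coe_unitary, CStarRing.norm_coe_unitary_mul]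

theorem hasDerivAt_exp_I_smul (h : 𝔅) (t : ℝ) :
    HasDerivAt (fun t : ℝ => NormedSpace.exp ((Complex.I * t) • h))
      (NormedSpace.exp ((Complex.I * t) • h) * (Complex.I • h)) t := by
  have h1 := HasDerivAt.scomp t (hasDerivAt_exp_smul_const (𝕂 := ℂ) (Complex.I • h) (t : ℂ))
    Complex.ofRealCLM.hasDerivAt
  have e : ∀ s : ℝ, (Complex.I * s) • h = (s : ℂ) • (Complex.I • h) := fun s => by
    rw [smul_smul, mul_comm]
  simp only [e]
  exact h1.congr_deriv (by simp)

theorem hasDerivAt_exp_I_smul' (h : 𝔅) (t : ℝ) :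
    HasDerivAt (fun t : ℝ => NormedSpace.exp ((Complex.I * t) • h))
      ((Complex.I • h) * NormedSpace.exp ((Complex.I * t) • h)) t := by
  have h1 := HasDerivAt.scomp t (hasDerivAt_exp_smul_const' (𝕂 := ℂ) (Complex.I • h) (t : ℂ))
    Complex.ofRealCLM.hasDerivAt
  have e : ∀ s : ℝ, (Complex.I * s) • h = (s : ℂ) • (Complex.I • h) := fun s => by
    rw [smul_smul, mul_comm]
  simp only [e]
  exact h1.congr_deriv (by simp)

theorem hasDerivAt_evol (h A : 𝔅) (t : ℝ) :
    HasDerivAt (fun t => evol h t A) (Complex.I • (h * evol h t A - evol h t A * h)) t := by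
  have h1 := hasDerivAt_exp_I_smul' h t
  have h2 := hasDerivAt_exp_I_smul (-h) t
  simp only [smul_neg] at h2
  refine ((h1.mul_const A).mul h2).congr_deriv ?_
  simp only [evol, mul_assoc, smul_mul_assoc, mul_smul_comm, mul_neg, smul_add, smul_neg,
    sub_eq_add_neg]

/-- Duhamel's bound: the generator `i[h, ·]` does not contribute to the growth of the norm. -/
theorem norm_le_of_hasDerivAt_commutator {h : 𝔅} (hh : IsSelfAdjoint h) {f r : ℝ → 𝔅}
    {ρ ρ' : ℝ → ℝ} {t : ℝ} (ht : 0 ≤ t)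
    (hf : ∀ s, HasDerivAt f (Complex.I • (h * f s - f s * h) + r s) s)
    (hρ : ∀ s, HasDerivAt ρ (ρ' s) s) (hr : ∀ s ∈ Set.Ico 0 t, ‖r s‖ ≤ ρ' s) :
    ‖f t‖ ≤ ‖f 0‖ + (ρ t - ρ 0) := by
  -- Interaction picture: conjugation by `e^{-ish}` is isometric and cancels the commutator, leaving
  -- only the source `r`.
  have hg : ∀ s, HasDerivAt (fun s => evol (-h) s (f s)) (evol (-h) s (r s)) s := by
    intro s
    have h1 := hasDerivAt_exp_I_smul (-h) s
    have h2 := hasDerivAt_exp_I_smul' h s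
    have e : ∀ s : ℝ, (Complex.I * s) • h = -((Complex.I * s) • (-h)) := fun s => by simp
    simp only [e] at h2
    refine ((h1.mul (hf s)).mul h2).congr_deriv ?_
    simp only [evol, Pi.mul_apply]
    generalize NormedSpace.exp ((Complex.I * s) • -h) = U
    generalize NormedSpace.exp (-((Complex.I * s) • -h)) = W
    simp only [mul_assoc, smul_mul_assoc, mul_smul_comm, mul_neg, smul_sub, smul_neg, add_mul,
      mul_add, mul_sub, sub_mul, neg_mul]
    abel
  have key := image_norm_le_of_norm_deriv_right_le_deriv_boundary
    (f := fun s => evol (-h) s (f s)) (a := 0) (b := t)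
    (B := fun s => ‖f 0‖ + (ρ s - ρ 0)) (B' := ρ')
    (fun s _ => (hg s).continuousAt.continuousWithinAt)
    (fun s _ => (hg s).hasDerivWithinAt) (by simp)
    (fun s => by simpa using ((hρ s).sub_const (ρ 0)).const_add ‖f 0‖)
    (fun s hs => by
      rw [norm_evol hh.neg]
      exact hr s hs) (Set.right_mem_Icc.mpr ht)
  rwa [norm_evol hh.neg] at key

/-- The partial sums of the exponential series. -/
def expSum (c : ℝ) (n : ℕ) (s : ℝ) : ℝ := ∑ k ∈ range n, (c * s) ^ k / k.factorial

theorem hasDerivAt_pow_div_factorial (c : ℝ) (n : ℕ) (s : ℝ) :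
    HasDerivAt (fun s => (c * s) ^ (n + 1) / (n + 1).factorial)
      (c * ((c * s) ^ n / n.factorial)) s := by
  have h := ((((hasDerivAt_id s).const_mul c).pow (n + 1)).div_const ((n + 1).factorial : ℝ))
  refine h.congr_deriv ?_
  rw [Nat.factorial_succ]
  push_cast
  have : (n.factorial : ℝ) ≠ 0 := by exact_mod_cast n.factorial_ne_zero
  have : (n : ℝ) + 1 ≠ 0 := by positivity
  simp only [id]
  field_simp

/-- Differentiation removes one term, so integrating a bound in each Picard step adds one. -/
theorem hasDerivAt_expSum (c : ℝ) (n : ℕ) (s : ℝ) :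
    HasDerivAt (expSum c (n + 1)) (c * expSum c n s) s := by
  induction n with
  | zero =>
    have : expSum c (0 + 1) = fun _ => 1 := by
      funext s
      simp [expSum]
    rw [this]
    simpa [expSum] using hasDerivAt_const s (1 : ℝ)
  | succ n ih =>
    have e : expSum c (n + 1 + 1) =
        fun s => expSum c (n + 1) s + (c * s) ^ (n + 1) / (n + 1).factorial := by
      funext s
      exact sum_range_succ _ _
    rw [e]
    refine (ih.add (hasDerivAt_pow_div_factorial c n s)).congr_deriv ?_
    rw [← mul_add]
    congr 1
    exact (sum_range_succ _ _).symm

theorem expSum_zero (c : ℝ) (n : ℕ) : expSum c (n + 1) 0 = 1 := by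
  simp [expSum, sum_range_succ']

theorem expSum_nonneg {c s : ℝ} (hc : 0 ≤ c) (hs : 0 ≤ s) (n : ℕ) : 0 ≤ expSum c n s :=
  sum_nonneg fun k _ => by positivity

theorem expSum_le_exp {c s : ℝ} (hc : 0 ≤ c) (hs : 0 ≤ s) (n : ℕ) :
    expSum c n s ≤ Real.exp (c * s) :=
  Real.sum_le_exp_of_nonneg (by positivity) n

end Evolution

/-! ### Lieb-Robinson bounds for finite families of terms. -/

section LiebRobinson

open scoped Classical

variable {V : Type*} {dim : V → ℕ}

/-- A family of self-adjoint local terms `h X ∈ 𝒜_X`. -/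
structure IsLocalFamily (h : Finset V → ConfigSpace dim →L[ℂ] ConfigSpace dim) : Prop where
  mem : ∀ X, h X ∈ localAlgebra dim X
  isSelfAdjoint : ∀ X, IsSelfAdjoint (h X)

theorem IsLocalFamily.neg {h : Finset V → ConfigSpace dim →L[ℂ] ConfigSpace dim}
    (hh : IsLocalFamily h) : IsLocalFamily (-h) :=
  ⟨fun X => neg_mem (hh.mem X), fun X => (hh.isSelfAdjoint X).neg⟩

theorem IsLocalFamily.isSelfAdjoint_sum {h : Finset V → ConfigSpace dim →L[ℂ] ConfigSpace dim}
    (hh : IsLocalFamily h) (S : Finset (Finset V)) : IsSelfAdjoint (∑ X ∈ S, h X) :=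
  _root_.isSelfAdjoint_sum S fun X _ => hh.isSelfAdjoint X

/-- The weight `‖h X‖ N^(2|X|)`. -/
def weight (N : ℕ) (h : Finset V → ConfigSpace dim →L[ℂ] ConfigSpace dim) (X : Finset V) : ℝ :=
  ‖h X‖ * (N : ℝ) ^ (2 * X.card)

theorem weight_nonneg (N : ℕ) (h : Finset V → ConfigSpace dim →L[ℂ] ConfigSpace dim)
    (X : Finset V) : 0 ≤ weight N h X := by
  unfold weight
  positivity

/-- `v` is a positive weight on the vertices, at least `1` on `Y`, on which the interaction terms
in the finite family `S` act with norm at most `κ`; on constants they act with norm at most `K`. -/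
structure IsControlled (N : ℕ) (h : Finset V → ConfigSpace dim →L[ℂ] ConfigSpace dim)
    (S : Finset (Finset V)) (Y : Finset V) (v : V → ℝ) (κ K : ℝ) : Prop where
  nonneg : ∀ x, 0 ≤ v x
  one_le : ∀ x ∈ Y, 1 ≤ v x
  kappa_nonneg : 0 ≤ κ
  sum_le : ∀ x, ∑ X ∈ S with x ∈ X, weight N h X * ∑ y ∈ X, v y ≤ κ * v x
  bound_nonneg : 0 ≤ K
  sum_card_le : ∀ x, ∑ X ∈ S with x ∈ X, weight N h X * X.card ≤ K

theorem IsControlled.neg {N : ℕ} {h : Finset V → ConfigSpace dim →L[ℂ] ConfigSpace dim}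
    {S : Finset (Finset V)} {Y : Finset V} {v : V → ℝ} {κ K : ℝ}
    (hc : IsControlled N h S Y v κ K) : IsControlled N (-h) S Y v κ K := by
  have e : ∀ X, weight N (-h) X = weight N h X := fun X => by simp [weight]
  exact ⟨hc.nonneg, hc.one_le, hc.kappa_nonneg, by simpa only [e] using hc.sum_le,
    hc.bound_nonneg, by simpa only [e] using hc.sum_card_le⟩

section Picard

variable {N : ℕ} (hpos : ∀ x, 0 < dim x) (hdim : ∀ x, dim x ≤ N)
  {h : Finset V → ConfigSpace dim →L[ℂ] ConfigSpace dim} (hh : IsLocalFamily h)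
  {S : Finset (Finset V)} {Y : Finset V} {v : V → ℝ} {κ K : ℝ}
  (hc : IsControlled N h S Y v κ K)
  {B : ConfigSpace dim →L[ℂ] ConfigSpace dim} (hB : B ∈ localAlgebra dim Y)

include hpos hdim hh hc

/-- One Picard step. Terms whose support misses `x` commute with `A`, so they act on `[A, τ_s(B)]`
only as a generator, which preserves the norm. The source `[A, [Hx, τ_s(B)]]` has norm at most `2‖A‖
‖[Hx, τ_s(B)]‖`, and `norm_commutator_le` reduces this to the single-site bounds `ih`. This `2` is
the one in `2κ` and `2K`. The term in `K` carries the remainder of the trivial bound, which has no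
decay in space. -/
theorem norm_commutator_evol_le_expSum_succ {n : ℕ}
    (ih : ∀ x, ∀ A ∈ localAlgebra dim {x}, ∀ t : ℝ, 0 ≤ t →
      ‖A * evol (∑ X ∈ S, h X) t B - evol (∑ X ∈ S, h X) t B * A‖ ≤
        ‖A‖ * (2 * ‖B‖ * (v x * expSum (2 * κ) n t + (2 * K * t) ^ n / n.factorial)))
    {x : V} {A : ConfigSpace dim →L[ℂ] ConfigSpace dim} (hA : A ∈ localAlgebra dim {x}) {t : ℝ}
    (ht : 0 ≤ t) :
    ‖A * evol (∑ X ∈ S, h X) t B - evol (∑ X ∈ S, h X) t B * A‖ ≤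
      ‖A * B - B * A‖ + ‖A‖ * (2 * ‖B‖ * (v x * (expSum (2 * κ) (n + 1) t - 1) +
        (2 * K * t) ^ (n + 1) / (n + 1).factorial)) := by
  set Hx := ∑ X ∈ S with x ∈ X, h X with hHx
  set H' := ∑ X ∈ S with x ∉ X, h X with hH'
  have hsum : ∑ X ∈ S, h X = Hx + H' := (Finset.sum_filter_add_sum_filter_not S _ _).symm
  have hcomm : A * H' = H' * A := by
    rw [hH', Finset.mul_sum, Finset.sum_mul]
    refine Finset.sum_congr rfl fun X hX => localAlgebra_commute ?_ hA (hh.mem X)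
    simpa using (Finset.mem_filter.mp hX).2
  set τ : ℝ → ConfigSpace dim →L[ℂ] ConfigSpace dim := fun s => evol (∑ X ∈ S, h X) s B with hτ
  have key := norm_le_of_hasDerivAt_commutator (h := H') (hh.isSelfAdjoint_sum _)
    (f := fun s => A * τ s - τ s * A)
    (r := fun s => Complex.I • (A * (Hx * τ s - τ s * Hx) - (Hx * τ s - τ s * Hx) * A))
    (ρ := fun s => ‖A‖ * (2 * ‖B‖ * (v x * expSum (2 * κ) (n + 1) s +
      (2 * K * s) ^ (n + 1) / (n + 1).factorial)))
    (ρ' := fun s => ‖A‖ * (2 * ‖B‖ * (v x * (2 * κ * expSum (2 * κ) n s) +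
      2 * K * ((2 * K * s) ^ n / n.factorial)))) ht ?_ ?_ ?_
  · simp only [hτ, evol_zero, expSum_zero, mul_zero, ne_eq, Nat.add_eq_zero_iff, one_ne_zero,
      and_false, not_false_eq_true, zero_pow, zero_div, add_zero, mul_one] at key
    refine key.trans (le_of_eq ?_)
    ring
  · intro s
    have hd : HasDerivAt τ _ s := hasDerivAt_evol (∑ X ∈ S, h X) B s
    refine ((hd.const_mul A).sub (hd.mul_const A)).congr_deriv ?_
    change _ = Complex.I • (H' * (A * τ s - τ s * A) - (A * τ s - τ s * A) * H') + _
    have e : evol (∑ X ∈ S, h X) s B = τ s := rfl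
    rw [e, hsum, mul_smul_comm, smul_mul_assoc, ← smul_sub, ← smul_add]
    congr 1
    have e1 : A * (H' * τ s) = H' * (A * τ s) := by rw [← mul_assoc, hcomm, mul_assoc]
    have e2 : τ s * H' * A = τ s * A * H' := by rw [mul_assoc, ← hcomm, mul_assoc]
    simp only [add_mul, mul_add, mul_sub, sub_mul, e1, e2]
    simp only [mul_assoc]
    abel
  · intro s
    exact (((hasDerivAt_expSum _ _ _).const_mul _).add
      (hasDerivAt_pow_div_factorial _ _ _)).const_mul _ |>.const_mul _
  · intro s hs
    have hs0 : 0 ≤ s := hs.1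
    set P : V → ℝ := fun y => 2 * ‖B‖ * (v y * expSum (2 * κ) n s + (2 * K * s) ^ n / n.factorial)
      with hP
    have hK := hc.bound_nonneg
    have hE := expSum_nonneg (mul_nonneg zero_le_two hc.kappa_nonneg) hs0 n
    have hP0 : ∀ y, 0 ≤ P y := fun y => by
      have := hc.nonneg y
      positivity
    have h1 : ‖Hx * τ s - τ s * Hx‖ ≤
        2 * ‖B‖ * (κ * v x * expSum (2 * κ) n s + K * ((2 * K * s) ^ n / n.factorial)) := by
      have e : Hx * τ s - τ s * Hx = ∑ X ∈ S with x ∈ X, (h X * τ s - τ s * h X) := by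
        rw [hHx, Finset.sum_mul, Finset.mul_sum, Finset.sum_sub_distrib]
      rw [e]
      calc _ ≤ ∑ X ∈ S with x ∈ X, weight N h X * ∑ y ∈ X, P y :=
            norm_sum_le_of_le _ fun X _ => norm_commutator_le hpos hdim (hh.mem X) _ P
              (fun y _ => hP0 y) fun y _ C hC => ih y C hC s hs0
        _ = 2 * ‖B‖ * ((∑ X ∈ S with x ∈ X, weight N h X * ∑ y ∈ X, v y) * expSum (2 * κ) n s +
              (∑ X ∈ S with x ∈ X, weight N h X * X.card) * ((2 * K * s) ^ n / n.factorial)) := by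
            simp only [hP, ← Finset.mul_sum, Finset.sum_add_distrib, ← Finset.sum_mul,
              Finset.sum_const, nsmul_eq_mul]
            rw [Finset.sum_mul, Finset.sum_mul, ← Finset.sum_add_distrib, Finset.mul_sum]
            refine Finset.sum_congr rfl fun X _ => ?_
            ring
        _ ≤ _ := by
            have := hc.sum_le x
            have := hc.sum_card_le x
            gcongr
    rw [norm_smul, Complex.norm_I, one_mul]
    refine (norm_sub_le _ _).trans ?_
    have h2 := norm_mul_le A (Hx * τ s - τ s * Hx)
    have h3 := norm_mul_le (Hx * τ s - τ s * Hx) A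
    have h4 := mul_le_mul_of_nonneg_left h1 (norm_nonneg A)
    linarith

include hB

omit hpos hdim hh in
theorem norm_commutator_le_weight {x : V} {A : ConfigSpace dim →L[ℂ] ConfigSpace dim}
    (hA : A ∈ localAlgebra dim {x}) : ‖A * B - B * A‖ ≤ ‖A‖ * (2 * ‖B‖ * v x) := by
  by_cases hx : x ∈ Y
  · refine (norm_sub_le _ _).trans ?_
    have h1 := norm_mul_le A B
    have h2 := norm_mul_le B A
    have h3 := mul_le_mul_of_nonneg_left (hc.one_le x hx) (by positivity : 0 ≤ ‖A‖ * (2 * ‖B‖))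
    linarith
  · rw [localAlgebra_commute (by simpa using hx) hA hB, sub_self, norm_zero]
    have := hc.nonneg x
    positivity

/-- The iteration starts at `n = 0` with the trivial bound `2‖A‖‖B‖`: the exponential sum is empty
and the remainder is `1`. -/
theorem norm_commutator_evol_le_expSum (n : ℕ) : ∀ x, ∀ A ∈ localAlgebra dim {x}, ∀ t : ℝ, 0 ≤ t →
    ‖A * evol (∑ X ∈ S, h X) t B - evol (∑ X ∈ S, h X) t B * A‖ ≤
      ‖A‖ * (2 * ‖B‖ * (v x * expSum (2 * κ) n t + (2 * K * t) ^ n / n.factorial)) := by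
  induction n with
  | zero =>
    intro x A hA t ht
    have h1 := norm_mul_le A (evol (∑ X ∈ S, h X) t B)
    have h2 := norm_mul_le (evol (∑ X ∈ S, h X) t B) A
    rw [norm_evol (hh.isSelfAdjoint_sum S)] at h1 h2
    refine (norm_sub_le _ _).trans ?_
    simp only [expSum, Finset.range_zero, Finset.sum_empty, mul_zero, pow_zero,
      Nat.factorial_zero, Nat.cast_one, div_one, zero_add, mul_one]
    linarith
  | succ n ih =>
    intro x A hA t ht
    have h1 := norm_commutator_evol_le_expSum_succ hpos hdim hh hc ih hA ht
    have h2 := norm_commutator_le_weight hc hB hA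
    linarith

/-- The Lieb-Robinson bound, for positive times. -/
theorem norm_commutator_evol_le_of_nonneg {x : V} {A : ConfigSpace dim →L[ℂ] ConfigSpace dim}
    (hA : A ∈ localAlgebra dim {x}) {t : ℝ} (ht : 0 ≤ t) :
    ‖A * evol (∑ X ∈ S, h X) t B - evol (∑ X ∈ S, h X) t B * A‖ ≤
      ‖A * B - B * A‖ + ‖A‖ * (2 * ‖B‖ * (v x * (Real.exp (2 * κ * t) - 1))) := by
  -- The last step is not merged with the bound on `[A, B]`: that commutator vanishes for `x ∉ Y`,
  -- and then the `-1` survives. It makes the bound vanish at `t = 0`, where the filter is nearly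
  -- singular. The remainder disappears as `n → ∞`.
  have h1 : ∀ n : ℕ, ‖A * evol (∑ X ∈ S, h X) t B - evol (∑ X ∈ S, h X) t B * A‖ ≤
      ‖A * B - B * A‖ + ‖A‖ * (2 * ‖B‖ * (v x * (Real.exp (2 * κ * t) - 1) +
        (2 * K * t) ^ (n + 1) / (n + 1).factorial)) := by
    intro n
    refine (norm_commutator_evol_le_expSum_succ hpos hdim hh hc
      (norm_commutator_evol_le_expSum hpos hdim hh hc hB n) hA ht).trans ?_
    have := expSum_le_exp (mul_nonneg zero_le_two hc.kappa_nonneg) ht (n + 1)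
    have := hc.nonneg x
    gcongr
  have h2 := ((FloorSemiring.tendsto_pow_div_factorial_atTop (2 * K * t)).comp
    (Filter.tendsto_add_atTop_nat 1))
  have h3 := (((h2.const_add (v x * (Real.exp (2 * κ * t) - 1))).const_mul (2 * ‖B‖)).const_mul
    ‖A‖).const_add ‖A * B - B * A‖
  rw [add_zero] at h3
  exact ge_of_tendsto' h3 h1

/-- The Lieb-Robinson bound. -/
theorem norm_commutator_evol_le {x : V} {A : ConfigSpace dim →L[ℂ] ConfigSpace dim}
    (hA : A ∈ localAlgebra dim {x}) (t : ℝ) :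
    ‖A * evol (∑ X ∈ S, h X) t B - evol (∑ X ∈ S, h X) t B * A‖ ≤
      ‖A * B - B * A‖ + ‖A‖ * (2 * ‖B‖ * (v x * (Real.exp (2 * κ * |t|) - 1))) := by
  rcases le_total 0 t with ht | ht
  · rw [abs_of_nonneg ht]
    exact norm_commutator_evol_le_of_nonneg hpos hdim hh hc hB hA ht
  -- Reversing time amounts to changing the sign of the interaction, which leaves the weights alone.
  · rw [abs_of_nonpos ht, ← evol_neg, ← Finset.sum_neg_distrib]
    exact norm_commutator_evol_le_of_nonneg hpos hdim hh.neg hc.neg hB hA (neg_nonneg.mpr ht)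

/-- Enlarging the volume from `S` to `S'` changes the evolution little. -/
theorem norm_evol_sub_evol_le_of_nonneg {S' : Finset (Finset V)} (hS : S ⊆ S') {t : ℝ}
    (ht : 0 ≤ t) :
    ‖evol (∑ X ∈ S', h X) t B - evol (∑ X ∈ S, h X) t B‖ ≤
      t * (2 * ‖B‖ * Real.exp (2 * κ * t) * ∑ X ∈ S' \ S, weight N h X * ∑ y ∈ X, v y) := by
  set D := ∑ X ∈ S' \ S, h X with hD
  have hsum : ∑ X ∈ S', h X = D + ∑ X ∈ S, h X := (Finset.sum_sdiff hS).symm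
  set τ : ℝ → ConfigSpace dim →L[ℂ] ConfigSpace dim := fun s => evol (∑ X ∈ S, h X) s B with hτ
  set τ' : ℝ → ConfigSpace dim →L[ℂ] ConfigSpace dim := fun s => evol (∑ X ∈ S', h X) s B with hτ'
  set W := 2 * ‖B‖ * Real.exp (2 * κ * t) * ∑ X ∈ S' \ S, weight N h X * ∑ y ∈ X, v y with hW
  -- The difference of the two evolutions is driven by `[D, τ_s(B)]`, where `D` collects the added
  -- terms; the Lieb-Robinson bound for the smaller family estimates it.
  have key := norm_le_of_hasDerivAt_commutator (h := ∑ X ∈ S', h X) (hh.isSelfAdjoint_sum _)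
    (f := fun s => τ' s - τ s) (r := fun s => Complex.I • (D * τ s - τ s * D))
    (ρ := fun s => s * W) (ρ' := fun _ => W) ht ?_ ?_ ?_
  · simpa [hτ, hτ'] using key
  · intro s
    have hd : HasDerivAt τ _ s := hasDerivAt_evol (∑ X ∈ S, h X) B s
    have hd' : HasDerivAt τ' _ s := hasDerivAt_evol (∑ X ∈ S', h X) B s
    refine (hd'.sub hd).congr_deriv ?_
    rw [← smul_sub, ← smul_add]
    congr 1
    change (∑ X ∈ S', h X) * τ' s - τ' s * (∑ X ∈ S', h X) -
      ((∑ X ∈ S, h X) * τ s - τ s * (∑ X ∈ S, h X)) = _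
    rw [hsum]
    noncomm_ring
  · intro s
    simpa using (hasDerivAt_id s).mul_const W
  · intro s hs
    have hs0 : 0 ≤ s := hs.1
    have e : D * τ s - τ s * D = ∑ X ∈ S' \ S, (h X * τ s - τ s * h X) := by
      rw [hD, Finset.sum_mul, Finset.mul_sum, Finset.sum_sub_distrib]
    rw [norm_smul, Complex.norm_I, one_mul, e]
    set P : V → ℝ := fun y => 2 * ‖B‖ * Real.exp (2 * κ * t) * v y with hP
    have hP0 : ∀ y, 0 ≤ P y := fun y => by
      have := hc.nonneg y
      positivity
    have hκ := hc.kappa_nonneg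
    calc _ ≤ ∑ X ∈ S' \ S, weight N h X * ∑ y ∈ X, P y := by
          refine norm_sum_le_of_le _ fun X _ => norm_commutator_le hpos hdim (hh.mem X) _ P
              (fun y _ => hP0 y) fun y _ C hC => ?_
          have h1 := norm_commutator_evol_le_of_nonneg hpos hdim hh hc hB hC hs0
          have h2 := norm_commutator_le_weight hc hB hC
          refine (h1.trans (add_le_add_left h2 _)).trans ?_
          have h3 : Real.exp (2 * κ * s) ≤ Real.exp (2 * κ * t) := by
            have := hs.2.le
            gcongr
          have h4 := hc.nonneg y
          calc _ = ‖C‖ * (2 * ‖B‖ * (v y * Real.exp (2 * κ * s))) := by ring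
            _ ≤ ‖C‖ * (2 * ‖B‖ * (v y * Real.exp (2 * κ * t))) := by gcongr
            _ = _ := by
              rw [hP]
              ring
      _ = W := by
          simp only [hP, hW, ← Finset.mul_sum]
          rw [Finset.mul_sum]
          refine Finset.sum_congr rfl fun X _ => ?_
          ring

theorem norm_evol_sub_evol_le {S' : Finset (Finset V)} (hS : S ⊆ S') (t : ℝ) :
    ‖evol (∑ X ∈ S', h X) t B - evol (∑ X ∈ S, h X) t B‖ ≤
      |t| * (2 * ‖B‖ * Real.exp (2 * κ * |t|) *
        ∑ X ∈ S' \ S, weight N h X * ∑ y ∈ X, v y) := by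
  rcases le_total 0 t with ht | ht
  · rw [abs_of_nonneg ht]
    exact norm_evol_sub_evol_le_of_nonneg hpos hdim hh hc hB hS ht
  · rw [abs_of_nonpos ht, ← evol_neg, ← evol_neg (∑ X ∈ S, h X), ← Finset.sum_neg_distrib,
      ← Finset.sum_neg_distrib]
    have := norm_evol_sub_evol_le_of_nonneg hpos hdim hh.neg hc.neg hB hS (neg_nonneg.mpr ht)
    have e : ∀ X, weight N (-h) X = weight N h X := fun X => by simp [weight]
    simp only [e] at this
    exact this

end Picard

end LiebRobinson

/-! ### A summable weight adapted to the interaction. -/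

section SummableWeight

open scoped Classical

variable {V : Type*}

/-- The action of the interaction terms on a weight `u`. -/
def weightOp (W : Finset V → ℝ≥0∞) (u : V → ℝ≥0∞) (x : V) : ℝ≥0∞ :=
  ∑' X : Finset V, if x ∈ X then W X * ∑ y ∈ X, u y else 0

theorem tsum_mem_eq_sum (X : Finset V) (u : V → ℝ≥0∞) :
    (∑' y, if y ∈ X then u y else 0) = ∑ y ∈ X, u y := by
  rw [tsum_eq_sum (s := X) fun y hy => if_neg hy]
  exact Finset.sum_congr rfl fun y hy => if_pos hy

theorem tsum_weightOp (W : Finset V → ℝ≥0∞) (u : V → ℝ≥0∞) :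
    ∑' x, weightOp W u x = ∑' X : Finset V, X.card * (W X * ∑ y ∈ X, u y) := by
  unfold weightOp
  rw [ENNReal.tsum_comm]
  refine tsum_congr fun X => ?_
  rw [tsum_mem_eq_sum X fun _ => W X * ∑ y ∈ X, u y, Finset.sum_const, nsmul_eq_mul]

/-- The operator is symmetric in `x` and `y`, so by Tonelli the bound on its row sums is also a
bound on its column sums, hence on `ℓ¹`. -/
theorem tsum_weightOp_le {W : Finset V → ℝ≥0∞} {c : ℝ≥0∞}
    (hW : ∀ x, (∑' X : Finset V, if x ∈ X then W X * X.card else 0) ≤ c) (u : V → ℝ≥0∞) :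
    ∑' x, weightOp W u x ≤ c * ∑' x, u x := by
  have e : ∑' x, weightOp W u x =
      ∑' y, (∑' X : Finset V, if y ∈ X then W X * X.card else 0) * u y := by
    rw [tsum_weightOp]
    simp only [← ENNReal.tsum_mul_right]
    rw [ENNReal.tsum_comm]
    refine tsum_congr fun X => ?_
    rw [← tsum_mem_eq_sum, ← mul_assoc, mul_comm (X.card : ℝ≥0∞), ← ENNReal.tsum_mul_left]
    refine tsum_congr fun y => ?_
    split_ifs <;> simp
  rw [e, ← ENNReal.tsum_mul_left]
  exact ENNReal.tsum_le_tsum fun y => mul_le_mul_left (hW y) _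

theorem weightOp_tsum (W : Finset V → ℝ≥0∞) (u : ℕ → V → ℝ≥0∞) (x : V) :
    weightOp W (fun y => ∑' k, u k y) x = ∑' k, weightOp W (u k) x := by
  unfold weightOp
  rw [ENNReal.tsum_comm]
  refine tsum_congr fun X => ?_
  split_ifs
  · rw [ENNReal.tsum_mul_left, ← Summable.tsum_finsetSum fun _ _ => ENNReal.summable]
  · simp

/-- A summable weight on the vertices, at least `1` on `Y`, on which the interaction acts with
norm at most `2c`: the resolvent series applied to the indicator function of `Y`. -/
theorem exists_summable_weight {W : Finset V → ℝ≥0∞} {c : ℝ≥0∞} (hc0 : c ≠ 0) (hc : c ≠ ⊤)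
    (hW : ∀ x, (∑' X : Finset V, if x ∈ X then W X * X.card else 0) ≤ c) (Y : Finset V) :
    ∃ v : V → ℝ≥0∞, (∀ y ∈ Y, 1 ≤ v y) ∧ (∀ x, weightOp W v x ≤ 2 * c * v x) ∧
      ∑' x, v x ≠ ⊤ := by
  have h2c0 : 2 * c ≠ 0 := mul_ne_zero two_ne_zero hc0
  have h2c : 2 * c ≠ ⊤ := ENNReal.mul_ne_top ENNReal.ofNat_ne_top hc
  -- `u k` is the `k`-th power of `(2c)⁻¹ weightOp W` on the indicator of `Y`. Each power halves the
  -- `ℓ¹` bound, and applying `weightOp W` to the sum shifts the series and multiplies it by `2c`.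
  let u : ℕ → V → ℝ≥0∞ := fun k =>
    Nat.rec (fun x => if x ∈ Y then 1 else 0) (fun _ w x => (2 * c)⁻¹ * weightOp W w x) k
  have u0 : ∀ x, u 0 x = if x ∈ Y then 1 else 0 := fun x => rfl
  have us : ∀ k x, u (k + 1) x = (2 * c)⁻¹ * weightOp W (u k) x := fun k x => rfl
  have hsum : ∀ k, ∑' x, u k x ≤ Y.card * 2⁻¹ ^ k := by
    intro k
    induction k with
    | zero =>
      simp only [u0, tsum_mem_eq_sum Y fun _ => 1]
      simp
    | succ k ih =>
      simp only [us, ENNReal.tsum_mul_left]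
      calc _ ≤ (2 * c)⁻¹ * (c * (Y.card * 2⁻¹ ^ k)) := by
            gcongr
            exact (tsum_weightOp_le hW _).trans (by gcongr)
        _ = (2⁻¹ * (c⁻¹ * c)) * (Y.card * 2⁻¹ ^ k) := by
            rw [ENNReal.mul_inv (Or.inl two_ne_zero) (Or.inl ENNReal.ofNat_ne_top)]
            ring
        _ = _ := by
            rw [ENNReal.inv_mul_cancel hc0 hc]
            ring
  refine ⟨fun x => ∑' k, u k x, fun y hy => ?_, fun x => ?_, ?_⟩
  · refine le_trans ?_ (ENNReal.le_tsum 0)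
    rw [u0, if_pos hy]
  · rw [weightOp_tsum]
    calc _ = ∑' k, 2 * c * u (k + 1) x := by
          refine tsum_congr fun k => ?_
          rw [us, ← mul_assoc, ENNReal.mul_inv_cancel h2c0 h2c, one_mul]
      _ = 2 * c * ∑' k, u (k + 1) x := ENNReal.tsum_mul_left
      _ ≤ _ := by
          gcongr
          exact ENNReal.tsum_comp_le_tsum_of_injective (add_left_injective 1) _
  · rw [ENNReal.tsum_comm]
    refine ne_top_of_le_ne_top ?_ (ENNReal.tsum_le_tsum hsum)
    rw [ENNReal.tsum_mul_left, ENNReal.tsum_geometric]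
    refine ENNReal.mul_ne_top (by simp) ?_
    rw [ENNReal.one_sub_inv_two, inv_inv]
    simp

end SummableWeight

/-! ### The infinite-volume dynamics and its Lieb-Robinson bound. -/

section Dynamics

open scoped Classical
open Filter

variable {V : Type*} {dim : V → ℕ}

theorem observables_isClosed :
    IsClosed (observables dim : Set (ConfigSpace dim →L[ℂ] ConfigSpace dim)) :=
  StarSubalgebra.isClosed_topologicalClosure _

theorem observables_completeSpace : CompleteSpace (observables dim) :=
  observables_isClosed.completeSpace_coe

attribute [local instance] observables_completeSpace

/-- The interaction terms as operators. -/
def Interaction.op (Φ : Interaction dim) (X : Finset V) : ConfigSpace dim →L[ℂ] ConfigSpace dim :=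
  (Φ.term X : ConfigSpace dim →L[ℂ] ConfigSpace dim)

theorem Interaction.isLocalFamily (Φ : Interaction dim) : IsLocalFamily Φ.op :=
  ⟨Φ.isLocalIn, fun X => congrArg Subtype.val (Φ.star_eq X)⟩

theorem Interaction.coe_localDynamics (Φ : Interaction dim) (Λ : Finset V) (t : ℝ)
    (A : observables dim) :
    (Φ.localDynamics Λ t A : ConfigSpace dim →L[ℂ] ConfigSpace dim) =
      evol (∑ X ∈ Λ.powerset, Φ.op X) t A := by
  let : NormedAlgebra ℚ (observables dim) := NormedAlgebra.restrictScalars ℚ ℂ _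
  have hexp : ∀ a : observables dim, ((NormedSpace.exp a : observables dim) :
      ConfigSpace dim →L[ℂ] ConfigSpace dim) = NormedSpace.exp (a : ConfigSpace dim →L[ℂ] _) :=
    fun a => NormedSpace.map_exp (observables dim).subtype continuous_subtype_val a
  have hsum : ((Φ.hamiltonian Λ : observables dim) : ConfigSpace dim →L[ℂ] ConfigSpace dim) =
      ∑ X ∈ Λ.powerset, Φ.op X :=
    map_sum (observables dim).subtype _ _
  rw [Interaction.localDynamics, evol, ← hsum]
  simp only [MulMemClass.coe_mul, hexp]
  rfl

variable [MetricSpace V] {N : ℕ} {lam : ℝ} {Φ : Interaction dim}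

theorem Interaction.enorm_term (X : Finset V) :
    (X.card : ℝ≥0∞) * ‖Φ.term X‖ₑ * (N : ℝ≥0∞) ^ (2 * X.card) *
      ENNReal.ofReal (Real.exp (lam * Metric.diam (X : Set V))) =
    ENNReal.ofReal (weight N Φ.op X * X.card * Real.exp (lam * Metric.diam (X : Set V))) := by
  have h1 : ‖Φ.term X‖ₑ = ENNReal.ofReal ‖Φ.op X‖ := (ofReal_norm (Φ.term X)).symm
  have h2 := weight_nonneg N Φ.op X
  rw [ENNReal.ofReal_mul (by positivity), ENNReal.ofReal_mul h2, weight,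
    ENNReal.ofReal_mul (norm_nonneg _), ENNReal.ofReal_pow (by positivity), ENNReal.ofReal_natCast,
    ENNReal.ofReal_natCast, h1]
  ring

theorem Interaction.tsum_le_enorm (x : V) :
    (∑' X : Finset V, if x ∈ X then ENNReal.ofReal
      (weight N Φ.op X * X.card * Real.exp (lam * Metric.diam (X : Set V))) else 0) ≤
      Φ.enorm N lam := by
  refine le_trans (le_of_eq ?_) (le_iSup _ x)
  simp only [Interaction.enorm_term]
  have h := tsum_subtype {X : Finset V | x ∈ X} fun X => ENNReal.ofReal
    (weight N Φ.op X * X.card * Real.exp (lam * Metric.diam (X : Set V)))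
  simp only [Set.indicator_apply, Set.mem_ofPred_eq] at h
  exact h.symm

theorem Interaction.sum_le_enorm (hΦ : Φ.enorm N lam ≠ ⊤) (S : Finset (Finset V)) (x : V) :
    ∑ X ∈ S with x ∈ X, weight N Φ.op X * X.card * Real.exp (lam * Metric.diam (X : Set V)) ≤
      (Φ.enorm N lam).toReal := by
  have h1 : ∀ X : Finset V,
      0 ≤ weight N Φ.op X * X.card * Real.exp (lam * Metric.diam (X : Set V)) := fun X => by
    have := weight_nonneg N Φ.op X
    positivity
  rw [← ENNReal.ofReal_le_iff_le_toReal hΦ, ENNReal.ofReal_sum_of_nonneg fun X _ => h1 X,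
    Finset.sum_filter]
  exact (ENNReal.sum_le_tsum S).trans (Interaction.tsum_le_enorm x)

theorem Interaction.weight_card_le (hlam : 0 ≤ lam) (X : Finset V) :
    weight N Φ.op X * X.card ≤
      weight N Φ.op X * X.card * Real.exp (lam * Metric.diam (X : Set V)) := by
  have := weight_nonneg N Φ.op X
  refine le_mul_of_one_le_right (by positivity) ?_
  rw [Real.one_le_exp_iff]
  exact mul_nonneg hlam Metric.diam_nonneg

theorem Interaction.sum_card_le_enorm (hlam : 0 ≤ lam) (hΦ : Φ.enorm N lam ≠ ⊤)
    (S : Finset (Finset V)) (x : V) :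
    ∑ X ∈ S with x ∈ X, weight N Φ.op X * X.card ≤ (Φ.enorm N lam).toReal :=
  (Finset.sum_le_sum fun X _ => Interaction.weight_card_le hlam X).trans
    (Interaction.sum_le_enorm hΦ S x)

/-- The distance to `Y` is `1`-Lipschitz, so `v y ≤ e^{λ D(X)} v x` for `x, y ∈ X`; summing over `y`
gives the factor `|X|`. These are the remaining factors in the norm of `Φ`. -/
theorem Interaction.isControlled_exp (hlam : 0 ≤ lam) (hΦ : Φ.enorm N lam ≠ ⊤)
    (S : Finset (Finset V)) (Y : Finset V) :
    IsControlled N Φ.op S Y (fun x => Real.exp (-lam * Metric.infDist x (Y : Set V)))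
      (Φ.enorm N lam).toReal (Φ.enorm N lam).toReal where
  nonneg x := (Real.exp_pos _).le
  one_le x hx := by
    rw [Metric.infDist_zero_of_mem (by simpa using hx)]
    simp
  kappa_nonneg := ENNReal.toReal_nonneg
  bound_nonneg := ENNReal.toReal_nonneg
  sum_card_le := Interaction.sum_card_le_enorm hlam hΦ S
  sum_le x := by
    refine le_trans ?_ (mul_le_mul_of_nonneg_right (Interaction.sum_le_enorm hΦ S x)
      (Real.exp_pos _).le)
    rw [Finset.sum_mul]
    refine Finset.sum_le_sum fun X hX => ?_
    have hx : x ∈ X := (Finset.mem_filter.mp hX).2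
    have hy : ∀ y ∈ X, Real.exp (-lam * Metric.infDist y (Y : Set V)) ≤
        Real.exp (lam * Metric.diam (X : Set V)) *
          Real.exp (-lam * Metric.infDist x (Y : Set V)) := by
      intro y hy
      rw [← Real.exp_add, Real.exp_le_exp]
      have h1 : Metric.infDist x (Y : Set V) ≤ Metric.infDist y (Y : Set V) + dist x y :=
        Metric.infDist_le_infDist_add_dist
      have h2 : dist x y ≤ Metric.diam (X : Set V) :=
        Metric.dist_le_diam_of_mem X.finite_toSet.isBounded hx hy
      nlinarith
    calc _ ≤ weight N Φ.op X * ∑ y ∈ X, (Real.exp (lam * Metric.diam (X : Set V)) *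
          Real.exp (-lam * Metric.infDist x (Y : Set V))) :=
          mul_le_mul_of_nonneg_left (Finset.sum_le_sum hy) (weight_nonneg _ _ _)
      _ = _ := by
          rw [Finset.sum_const, nsmul_eq_mul]
          ring

/-- No growth condition is imposed on `V`, so the exponential weight need not be summable. This
weight makes the total influence of all interaction terms on `Y` finite, which convergence of the
dynamics requires. -/
theorem Interaction.exists_isControlled_summable (hlam : 0 ≤ lam) (hΦ : Φ.enorm N lam ≠ ⊤)
    (Y : Finset V) :
    ∃ (v : V → ℝ) (κ K : ℝ), (∀ S, IsControlled N Φ.op S Y v κ K) ∧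
      Summable fun X : Finset V => weight N Φ.op X * ∑ y ∈ X, v y := by
  set W : Finset V → ℝ≥0∞ := fun X => ENNReal.ofReal (weight N Φ.op X) with hWdef
  -- The `1` makes `c` nonzero, also for the zero interaction.
  set c : ℝ≥0∞ := Φ.enorm N lam + 1 with hc
  have hctop : c ≠ ⊤ := by simpa [hc] using hΦ
  have hc0 : c ≠ 0 := by simp [hc]
  have hW : ∀ x, (∑' X : Finset V, if x ∈ X then W X * X.card else 0) ≤ c := by
    intro x
    refine le_trans (ENNReal.tsum_le_tsum fun X => ?_)
      ((Interaction.tsum_le_enorm (N := N) (lam := lam) (Φ := Φ) x).trans le_self_add)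
    split_ifs
    · rw [hWdef, ← ENNReal.ofReal_natCast, ← ENNReal.ofReal_mul (weight_nonneg _ _ _)]
      exact ENNReal.ofReal_le_ofReal (Interaction.weight_card_le hlam X)
    · exact le_rfl
  obtain ⟨v, hv1, hv2, hv3⟩ := exists_summable_weight hc0 hctop hW Y
  have hvt : ∀ x, v x ≠ ⊤ := fun x => ENNReal.ne_top_of_tsum_ne_top hv3 x
  have hterm : ∀ X : Finset V, W X * ∑ y ∈ X, v y =
      ENNReal.ofReal (weight N Φ.op X * ∑ y ∈ X, (v y).toReal) := by
    intro X
    rw [ENNReal.ofReal_mul (weight_nonneg _ _ _),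
      ENNReal.ofReal_sum_of_nonneg fun _ _ => ENNReal.toReal_nonneg]
    simp only [hWdef, ENNReal.ofReal_toReal (hvt _)]
  have hn : ∀ X : Finset V, 0 ≤ weight N Φ.op X * ∑ y ∈ X, (v y).toReal := fun X =>
    mul_nonneg (weight_nonneg _ _ _) (Finset.sum_nonneg fun _ _ => ENNReal.toReal_nonneg)
  refine ⟨fun x => (v x).toReal, (2 * c).toReal, (Φ.enorm N lam).toReal, fun S => ?_, ?_⟩
  · refine ⟨fun x => ENNReal.toReal_nonneg, fun x hx => ?_, ENNReal.toReal_nonneg, fun x => ?_,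
      ENNReal.toReal_nonneg, Interaction.sum_card_le_enorm hlam hΦ S⟩
    · rw [← ENNReal.toReal_one]
      exact ENNReal.toReal_mono (hvt x) (hv1 x hx)
    · rw [← ENNReal.toReal_mul, ← ENNReal.ofReal_le_iff_le_toReal
        (ENNReal.mul_ne_top (ENNReal.mul_ne_top ENNReal.ofNat_ne_top hctop) (hvt x)),
        ENNReal.ofReal_sum_of_nonneg fun X _ => hn X, Finset.sum_filter]
      refine le_trans ?_ (hv2 x)
      unfold weightOp
      simp only [hterm]
      exact ENNReal.sum_le_tsum S
  · have hfin : ∑' X : Finset V, W X * ∑ y ∈ X, v y ≠ ⊤ := by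
      refine ne_top_of_le_ne_top (ENNReal.mul_ne_top hctop hv3) (le_trans ?_ (tsum_weightOp_le hW v))
      rw [tsum_weightOp]
      refine ENNReal.tsum_le_tsum fun X => ?_
      rcases X.eq_empty_or_nonempty with rfl | hX
      · simp
      · refine le_mul_of_one_le_left (by positivity) ?_
        exact_mod_cast hX.card_pos
    simp only [hterm] at hfin
    have := ENNReal.summable_toReal hfin
    simpa only [ENNReal.toReal_ofReal (hn _)] using this

variable (hpos : ∀ x, 0 < dim x) (hdim : ∀ x, dim x ≤ N) (hlam : 0 ≤ lam)
  (hΦ : Φ.enorm N lam ≠ ⊤)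

include hpos hdim hlam hΦ

theorem Interaction.tendsto_localDynamics {Y : Finset V} {B : observables dim}
    (hB : IsLocalIn Y B) (t : ℝ) :
    Tendsto (fun Λ : Finset V => Φ.localDynamics Λ t B) atTop (nhds (Φ.dynamics t B)) := by
  obtain ⟨v, κ, K, hc, hs⟩ := Interaction.exists_isControlled_summable hlam hΦ Y
  refine CauchySeq.tendsto_limUnder ?_
  rw [Metric.cauchySeq_iff']
  intro ε hε
  set q : ℝ := |t| * (2 * ‖B‖ * Real.exp (2 * κ * |t|)) with hq
  have hq0 : 0 ≤ q := by positivity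
  obtain ⟨S, hS⟩ := summable_iff_vanishing_norm.mp hs (ε / (q + 1)) (by positivity)
  -- This volume contains every set of `S`, so enlarging it adds only terms in the tail of the
  -- convergent series.
  refine ⟨S.biUnion id, fun Λ hΛ => ?_⟩
  have hpow : (S.biUnion id).powerset ⊆ Λ.powerset := Finset.powerset_mono.mpr hΛ
  rw [dist_eq_norm]
  have e : ‖Φ.localDynamics Λ t B - Φ.localDynamics (S.biUnion id) t B‖ =
      ‖evol (∑ X ∈ Λ.powerset, Φ.op X) t B -
        evol (∑ X ∈ (S.biUnion id).powerset, Φ.op X) t B‖ := by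
    rw [← Interaction.coe_localDynamics, ← Interaction.coe_localDynamics]
    rfl
  rw [e]
  refine lt_of_le_of_lt (norm_evol_sub_evol_le hpos hdim Φ.isLocalFamily (hc _) hB hpow t) ?_
  have hdisj : Disjoint (Λ.powerset \ (S.biUnion id).powerset) S := by
    rw [Finset.disjoint_right]
    intro X hX hX'
    refine (Finset.mem_sdiff.mp hX').2 (Finset.mem_powerset.mpr ?_)
    exact Finset.subset_biUnion_of_mem id hX
  have h1 := (le_abs_self _).trans_lt (hS _ hdisj)
  rw [lt_div_iff₀ (by positivity)] at h1
  have h2 : 0 ≤ ∑ X ∈ Λ.powerset \ (S.biUnion id).powerset, weight N Φ.op X * ∑ y ∈ X, v y :=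
    Finset.sum_nonneg fun X _ => mul_nonneg (weight_nonneg _ _ _)
      (Finset.sum_nonneg fun y _ => (hc ∅).nonneg y)
  have e3 : ‖(B : ConfigSpace dim →L[ℂ] ConfigSpace dim)‖ = ‖B‖ := rfl
  rw [e3, ← mul_assoc, ← hq]
  nlinarith

/-- The Lieb-Robinson bound for the infinite-volume dynamics. -/
theorem Interaction.norm_commutator_dynamics_le {x : V} {Y : Finset V} (hx : x ∉ Y)
    {A B : observables dim} (hA : IsLocalIn {x} A) (hB : IsLocalIn Y B) (t : ℝ) :
    ‖A * Φ.dynamics t B - Φ.dynamics t B * A‖ ≤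
      ‖A‖ * (2 * ‖B‖ * (Real.exp (-lam * Metric.infDist x (Y : Set V)) *
        (Real.exp (2 * (Φ.enorm N lam).toReal * |t|) - 1))) := by
  have hlim := Interaction.tendsto_localDynamics hpos hdim hlam hΦ hB t
  have h1 := ((hlim.const_mul A).sub (hlim.mul_const A)).norm
  refine le_of_tendsto' h1 fun Λ => ?_
  have key := norm_commutator_evol_le hpos hdim Φ.isLocalFamily
    (Interaction.isControlled_exp hlam hΦ Λ.powerset Y) hB hA t
  rw [localAlgebra_commute (by simpa using hx) hA hB, sub_self, norm_zero, zero_add,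
    ← Interaction.coe_localDynamics] at key
  exact key

end Dynamics

/-! ### Uniqueness of the continuation from a real interval. -/

section Continuation

/-- The open triangle with base `(-ρ, ρ)` and apex `iρ`. -/
def triangle (ρ : ℝ) : Set ℂ := {z | 0 < z.im ∧ |z.re| < ρ - z.im}

theorem isOpen_triangle (ρ : ℝ) : IsOpen (triangle ρ) :=
  (isOpen_lt continuous_const Complex.continuous_im).inter
    (isOpen_lt (f := fun z : ℂ => |z.re|) (g := fun z : ℂ => ρ - z.im)
      (by fun_prop) (by fun_prop))

theorem closure_triangle_subset (ρ : ℝ) :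
    closure (triangle ρ) ⊆ {z | 0 ≤ z.im ∧ |z.re| ≤ ρ - z.im} := by
  refine closure_minimal (fun z hz => ⟨hz.1.le, hz.2.le⟩) ?_
  exact (isClosed_le continuous_const Complex.continuous_im).inter
    (isClosed_le (f := fun z : ℂ => |z.re|) (g := fun z : ℂ => ρ - z.im)
      (by fun_prop) (by fun_prop))

theorem norm_le_of_mem_closure_triangle {ρ : ℝ} {z : ℂ} (hz : z ∈ closure (triangle ρ)) :
    ‖z‖ ≤ ρ := by
  obtain ⟨h1, h2⟩ := closure_triangle_subset ρ hz
  have h3 := Complex.norm_le_abs_re_add_abs_im z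
  rw [abs_of_nonneg h1] at h3
  linarith

/-- A function on the closed upper half plane that is analytic inside and agrees on a real interval
with a function analytic in a disk agrees with it on the upper half of the disk. -/
theorem eq_of_eq_on_real {f g : ℂ → ℂ} {r : ℝ} (hf : ContinuousOn f {z | 0 ≤ z.im})
    (hf' : DifferentiableOn ℂ f {z | 0 < z.im}) (hg : DifferentiableOn ℂ g (Metric.ball 0 r))
    (heq : ∀ t : ℝ, |t| < r → f t = g t) {b : ℝ} (hb : 0 < b) (hbr : b < r) :
    f (Complex.I * b) = g (Complex.I * b) := by
  -- Between `b` and `r`: the triangle contains `ib`, and its closure stays in the disk.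
  set ρ := (b + r) / 2 with hρ
  have hbρ : b < ρ := by rw [hρ]; linarith
  have hρr : ρ < r := by rw [hρ]; linarith
  set T := triangle ρ with hT
  have hcl : ∀ z ∈ closure T, z ∈ Metric.ball (0 : ℂ) r := fun z hz => by
    rw [mem_ball_zero_iff]
    exact (norm_le_of_mem_closure_triangle hz).trans_lt hρr
  have hcl' : ∀ z ∈ closure T, z ∈ {z : ℂ | 0 ≤ z.im} := fun z hz =>
    (closure_triangle_subset ρ hz).1
  have hbdd : Bornology.IsBounded T :=
    (Metric.isBounded_closedBall (x := (0 : ℂ)) (r := ρ)).subset fun z hz => by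
      rw [mem_closedBall_zero_iff]
      exact norm_le_of_mem_closure_triangle (subset_closure hz)
  have hcont : ContinuousOn (fun z => f z - g z) (closure T) :=
    (hf.mono hcl').sub (hg.continuousOn.mono hcl)
  obtain ⟨M, hM⟩ := (hbdd.isCompact_closure).exists_bound_of_continuousOn hcont
  have hmem : Complex.I * b ∈ T := by
    refine ⟨by simpa using hb, ?_⟩
    simpa using hbρ
  have hM0 : 0 ≤ M := (norm_nonneg _).trans (hM _ (subset_closure hmem))
  -- Maximum principle for `(f - g) e^{n(ρ + iz)²}`. The exponential has modulus `e^{n((ρ - Im z)² -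
  -- (Re z)²)}`, which is `1` on the slanted sides; on the base `f - g = 0`. At `ib` it is `e^{n(ρ -
  -- b)²}`, unbounded in `n`.
  have key : ∀ n : ℕ, ‖f (Complex.I * b) - g (Complex.I * b)‖ * Real.exp (n * (ρ - b) ^ 2) ≤ M := by
    intro n
    have hexp : ∀ z : ℂ, ‖Complex.exp (n * (ρ + Complex.I * z) ^ 2)‖ =
        Real.exp (n * ((ρ - z.im) ^ 2 - z.re ^ 2)) := by
      intro z
      rw [Complex.norm_exp]
      congr 1
      simp [pow_two, Complex.mul_re, Complex.mul_im, ← sub_eq_add_neg]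
    have hd : DiffContOnCl ℂ
        (fun z => (f z - g z) * Complex.exp (n * (ρ + Complex.I * z) ^ 2)) T := by
      refine ⟨?_, hcont.mul (by fun_prop)⟩
      refine DifferentiableOn.mul ?_ (by fun_prop)
      exact (hf'.mono fun z hz => hz.1).sub (hg.mono fun z hz => hcl z (subset_closure hz))
    have := Complex.norm_le_of_forall_mem_frontier_norm_le hbdd hd (C := M) ?_
      (subset_closure hmem)
    · rw [norm_mul, hexp] at this
      simpa using this
    · intro z hz
      rw [(isOpen_triangle ρ).frontier_eq] at hz
      obtain ⟨h1, h2⟩ := closure_triangle_subset ρ hz.1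
      rw [norm_mul, hexp]
      by_cases him : z.im = 0
      · have hzr : z = (z.re : ℂ) := Complex.ext (by simp) (by simp [him])
        have : f z - g z = 0 := by
          rw [hzr, sub_eq_zero]
          refine heq _ ?_
          rw [him, sub_zero] at h2
          exact h2.trans_lt hρr
        rw [this, norm_zero, zero_mul]
        exact hM0
      · have h3 : |z.re| = ρ - z.im := by
          refine le_antisymm h2 (not_lt.mp fun hlt => hz.2 ⟨lt_of_le_of_ne h1 (Ne.symm him), hlt⟩)
        rw [← h3, sq_abs, sub_self, mul_zero, Real.exp_zero, mul_one]
        exact hM z hz.1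
  by_contra hne
  have hpos : 0 < ‖f (Complex.I * b) - g (Complex.I * b)‖ := norm_pos_iff.mpr (sub_ne_zero.mpr hne)
  have hc : 0 < (ρ - b) ^ 2 := by
    have : 0 < ρ - b := sub_pos.mpr hbρ
    positivity
  obtain ⟨n, hn⟩ := exists_nat_gt (M / ‖f (Complex.I * b) - g (Complex.I * b)‖ / (ρ - b) ^ 2)
  rw [div_lt_iff₀ hc, div_lt_iff₀ hpos] at hn
  have h1 := Real.add_one_le_exp ((n : ℝ) * (ρ - b) ^ 2)
  have h2 := mul_le_mul_of_nonneg_left h1 hpos.le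
  linarith [key n]

end Continuation

/-! ### The filter integrated against the commutator. -/

section CommutatorIntegral

open MeasureTheory

theorem exp_sub_one_le_mul_exp (x : ℝ) : Real.exp x - 1 ≤ x * Real.exp x := by
  have h1 := Real.add_one_le_exp (-x)
  have h2 := mul_le_mul_of_nonneg_right h1 (Real.exp_pos x).le
  rw [← Real.exp_add, neg_add_cancel, Real.exp_zero] at h2
  linarith

theorem integral_Ioi_gaussian_le {α s : ℝ} (hα : 0 < α) (hs : 0 ≤ s) :
    ∫ t in Set.Ioi s, Real.exp (-α * t ^ 2) ≤ Real.exp (-α * s ^ 2) * (√(Real.pi / α) / 2) := by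
  have h1 := integral_gaussian_tail_le (α := (4 * α)⁻¹) (by positivity) hs
  have e0 : ∀ w : ℝ, -w ^ 2 / (4 * (4 * α)⁻¹) = -α * w ^ 2 := by
    intro w
    field_simp
  have h2 : ∫ w in Set.Ioi (0 : ℝ), Real.exp (-α * (w + s) ^ 2) =
      ∫ t in Set.Ioi s, Real.exp (-α * t ^ 2) := by
    have h3 := (measurePreserving_add_right volume s).setIntegral_preimage_emb
      (measurableEmbedding_addRight s) (fun t : ℝ => Real.exp (-α * t ^ 2)) (Set.Ioi s)
    rwa [Set.preimage_add_const_Ioi, sub_self] at h3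
  simp only [e0] at h1
  rw [h2] at h1
  refine h1.trans (le_of_eq ?_)
  congr 1
  rw [show Real.pi * (4 * α)⁻¹ = (Real.pi / α) / 2 ^ 2 by field_simp; norm_num,
    Real.sqrt_div (by positivity), Real.sqrt_sq (by norm_num)]

/-- The integral of the kernel against a function that is small near zero. -/
theorem norm_integral_gaussKernel_mul_le {α b s K M Q : ℝ} (hα : 0 < α) (hb : 0 < b) (hs : 0 < s)
    (hK : 0 ≤ K) (hM : 0 ≤ M) (hQ : 0 ≤ Q) {C : ℝ → ℂ} (h1 : ∀ t, ‖C t‖ ≤ M)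
    (h2 : ∀ t, ‖C t‖ ≤ M * (Q * (Real.exp (2 * K * |t|) - 1))) :
    ‖∫ t, gaussKernel α b t * C t‖ ≤
      M * ((2 * Real.pi)⁻¹ * Real.exp (-α * b ^ 2)) *
        (2 * (Q * (Real.exp (2 * K * s) - 1) +
          s⁻¹ * (Real.exp (-α * s ^ 2) * (√(Real.pi / α) / 2)))) := by
  -- For `|t| ≤ s` the bound `e^x - 1 ≤ x e^x` yields a factor `|t|`, which cancels `1/|t - ib|`
  -- uniformly in `b`; the rest integrates back to `e^{2Ks} - 1`. For `|t| > s` the Gaussian is kept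
  -- and `1/|t - ib| ≤ 1/s`.
  set φ : ℝ → ℝ := fun t =>
    if t ≤ s then Q * (2 * K * Real.exp (2 * K * t)) else s⁻¹ * Real.exp (-α * t ^ 2) with hφ
  set P : ℝ := M * ((2 * Real.pi)⁻¹ * Real.exp (-α * b ^ 2)) with hP
  have hP0 : 0 ≤ P := by positivity
  have hφm : Measurable φ :=
    Measurable.ite measurableSet_Iic (by fun_prop) (by fun_prop)
  have hφint : Integrable fun t => φ |t| := by
    have hg := (integrable_exp_neg_mul_sq hα).const_mul
      (Q * (2 * K * Real.exp (2 * K * s)) * Real.exp (α * s ^ 2) + s⁻¹)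
    refine hg.mono' (hφm.comp measurable_norm).aestronglyMeasurable
      (Filter.Eventually.of_forall fun t => ?_)
    have hE := Real.exp_pos (-α * t ^ 2)
    rw [add_mul]
    have n1 : 0 ≤ Q * (2 * K * Real.exp (2 * K * s)) * Real.exp (α * s ^ 2) *
      Real.exp (-α * t ^ 2) := by positivity
    have n2 : 0 ≤ s⁻¹ * Real.exp (-α * t ^ 2) := by positivity
    simp only [hφ]
    split_ifs with hts
    · rw [Real.norm_of_nonneg (by positivity)]
      have h3 : 1 ≤ Real.exp (α * s ^ 2) * Real.exp (-α * t ^ 2) := by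
        rw [← Real.exp_add, Real.one_le_exp_iff]
        have : t ^ 2 ≤ s ^ 2 := by
          rw [← sq_abs t]
          gcongr
        nlinarith
      have h4 : Q * (2 * K * Real.exp (2 * K * |t|)) ≤ Q * (2 * K * Real.exp (2 * K * s)) := by
        gcongr
      have h5 := mul_le_mul_of_nonneg_left h3
        (by positivity : 0 ≤ Q * (2 * K * Real.exp (2 * K * s)))
      nlinarith
    · rw [Real.norm_of_nonneg (by positivity), sq_abs]
      linarith
  have hbound : ∀ t, ‖gaussKernel α b t * C t‖ ≤ P * φ |t| := by
    intro t
    have hnorm : |t| ≤ ‖(t : ℂ) - Complex.I * b‖ := by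
      simpa using Complex.abs_re_le_norm ((t : ℂ) - Complex.I * b)
    have hnpos : 0 < ‖(t : ℂ) - Complex.I * b‖ := norm_pos_iff.mpr (sub_I_mul_ne_zero hb t)
    have he1 : Real.exp (-α * t ^ 2) ≤ 1 := by
      rw [Real.exp_le_one_iff]
      nlinarith [sq_nonneg t]
    rw [norm_mul, norm_gaussKernel]
    simp only [hφ]
    split_ifs with hts
    · have h3 : ‖C t‖ ≤ M * (Q * (‖(t : ℂ) - Complex.I * b‖ * (2 * K * Real.exp (2 * K * |t|)))) := by
        refine (h2 t).trans ?_
        gcongr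
        refine (exp_sub_one_le_mul_exp _).trans ?_
        have : 2 * K * |t| * Real.exp (2 * K * |t|) = |t| * (2 * K * Real.exp (2 * K * |t|)) := by
          ring
        rw [this]
        gcongr
      calc _ ≤ (2 * Real.pi)⁻¹ * Real.exp (-α * b ^ 2) * (1 * ‖(t : ℂ) - Complex.I * b‖⁻¹) *
            (M * (Q * (‖(t : ℂ) - Complex.I * b‖ * (2 * K * Real.exp (2 * K * |t|))))) := by
            gcongr
        _ = _ := by
            rw [hP]
            field_simp
    · push Not at hts
      have h3 : ‖(t : ℂ) - Complex.I * b‖⁻¹ ≤ s⁻¹ := by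
        gcongr
        exact hts.le.trans hnorm
      calc _ ≤ (2 * Real.pi)⁻¹ * Real.exp (-α * b ^ 2) * (Real.exp (-α * t ^ 2) * s⁻¹) * M := by
            have := h1 t
            gcongr
        _ = _ := by
            rw [hP, sq_abs]
            ring
  refine (norm_integral_le_of_norm_le (hφint.const_mul P)
    (Filter.Eventually.of_forall hbound)).trans ?_
  rw [integral_const_mul, integral_comp_abs]
  refine mul_le_mul_of_nonneg_left (mul_le_mul_of_nonneg_left ?_ zero_le_two) hP0
  have hIoi : Set.Ioi (0 : ℝ) = Set.Ioc 0 s ∪ Set.Ioi s := (Set.Ioc_union_Ioi_eq_Ioi hs.le).symm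
  have hc : Continuous fun t : ℝ => Q * (2 * K * Real.exp (2 * K * t)) := by fun_prop
  have e1 : Set.EqOn φ (fun t => Q * (2 * K * Real.exp (2 * K * t))) (Set.Ioc 0 s) :=
    fun t ht => if_pos ht.2
  have e2 : Set.EqOn φ (fun t => s⁻¹ * Real.exp (-α * t ^ 2)) (Set.Ioi s) :=
    fun t ht => if_neg (not_le.mpr ht)
  have i1 : IntegrableOn φ (Set.Ioc 0 s) :=
    ((hc.integrableOn_Icc).mono_set Set.Ioc_subset_Icc_self).congr_fun e1.symm measurableSet_Ioc
  have i2 : IntegrableOn φ (Set.Ioi s) :=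
    ((integrable_exp_neg_mul_sq hα).const_mul s⁻¹).integrableOn.congr_fun e2.symm measurableSet_Ioi
  rw [hIoi, setIntegral_union (Set.Ioc_disjoint_Ioi le_rfl) measurableSet_Ioi i1 i2,
    setIntegral_congr_fun measurableSet_Ioc e1, setIntegral_congr_fun measurableSet_Ioi e2,
    ← intervalIntegral.integral_of_le hs.le, intervalIntegral.integral_const_mul,
    integral_const_mul]
  have hder : ∀ t ∈ Set.uIcc 0 s, HasDerivAt (fun t => Real.exp (2 * K * t))
      (2 * K * Real.exp (2 * K * t)) t := by
    intro t _
    have := ((hasDerivAt_id t).const_mul (2 * K)).exp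
    simpa [mul_comm] using this
  rw [intervalIntegral.integral_eq_sub_of_hasDerivAt hder
    ((by fun_prop : Continuous fun t : ℝ => 2 * K * Real.exp (2 * K * t)).intervalIntegrable _ _)]
  rw [mul_zero, Real.exp_zero]
  have := integral_Ioi_gaussian_le hα hs.le
  gcongr

end CommutatorIntegral

/-! ### Exponential clustering at imaginary times `b > 0`. -/

section Clustering

open MeasureTheory

variable {𝓗 : Type*} [NormedAddCommGroup 𝓗] [InnerProductSpace ℂ 𝓗] [CompleteSpace 𝓗]
variable {H : 𝓗 →ₗ.[ℂ] 𝓗} {γ : ℝ}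

theorem eq_re_of_mem_gapSet {E : ℂ} (hE : E ∈ gapSet γ) : E = (E.re : ℂ) :=
  Complex.ext (by simp) (by simp [im_eq_zero_of_mem_gapSet hE])

theorem gap_le_re {E : ℂ} (hE : E ∈ gapSet γ) (h0 : E ≠ 0) : γ ≤ E.re := by
  rcases hE with h | ⟨-, h⟩
  · exact absurd h h0
  · exact h

theorem exp_gap_le {α b x : ℝ} (hα : 0 < α) (hγ : 0 < γ) (hx : γ ≤ x) :
    2⁻¹ * Real.exp (-α * b ^ 2 - x ^ 2 / (4 * α)) ≤
      2⁻¹ * Real.exp (-α * b ^ 2 - γ ^ 2 / (4 * α)) := by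
  gcongr

/-- The difference is a function of `H` applied to `v`, and orthogonality of `v` to `ker H`
restricts it to energies `E ≥ γ`. There `2αb ≤ γ` gives `2αb ≤ E`, as the filter estimate needs. -/
theorem IsGapped.norm_inner_expI_sub_le (hg : IsGapped H γ) {α b : ℝ} (hα : 0 < α) (hb : 0 < b)
    (hαb : 2 * α * b ≤ γ) (a : 𝓗) {v : 𝓗} (hv : kernelProj H v = 0) :
    ‖⟪a, expI H (Complex.I * b) v⟫_ℂ - ∫ t : ℝ, gaussKernel α b t * ⟪a, expI H t v⟫_ℂ‖ ≤
      ‖a‖ * (2⁻¹ * Real.exp (-α * b ^ 2 - γ ^ 2 / (4 * α)) * ‖v‖) := by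
  have hγ := hg.pos
  have hkc := continuous_gaussKernel α hb
  have hki := integrable_gaussKernel hα hb
  have h1 := admissible_exp hγ (z := Complex.I * b) (by simpa using hb.le)
  have h2 := continuousOn_integral_exp hγ hkc hki
  rw [← hg.inner_funCalc_integral hkc hki, ← inner_sub_right, expI, ← sub_apply,
    ← hg.funCalc_sub h1 h2]
  refine (norm_inner_le_norm _ _).trans (mul_le_mul_of_nonneg_left ?_ (norm_nonneg _))
  have h3 : Admissible γ (1 + ∫ t, ‖gaussKernel α b t‖) (fun E =>
      Complex.exp (Complex.I * (Complex.I * b) * E) -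
        ∫ t : ℝ, gaussKernel α b t * Complex.exp (Complex.I * t * E)) :=
    ⟨h1.continuousOn.sub h2.continuousOn, fun E hE =>
      (norm_sub_le _ _).trans (add_le_add (h1.norm_le E hE) (h2.norm_le E hE))⟩
  refine hg.norm_funCalc_apply_le h3 (by positivity) (fun E hE hE0 => ?_) hv
  have hre := gap_le_re hE hE0
  have key := norm_exp_sub_integral_gaussKernel_le hα hb (hαb.trans hre)
  rw [← eq_re_of_mem_gapSet hE] at key
  have e : Complex.I * (Complex.I * b) * E = ((-(b * E.re) : ℝ) : ℂ) := by
    rw [← mul_assoc, Complex.I_mul_I]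
    push_cast
    rw [← eq_re_of_mem_gapSet hE]
    ring
  rw [e, Complex.ofReal_neg]
  exact key.trans (exp_gap_le hα hγ hre)

/-- The filter acts here at the negative frequencies `-E`. It is moved by the adjoint to `v`, since
only `v`, and not `w`, is orthogonal to `ker H`. -/
theorem IsGapped.norm_integral_inner_expI_neg_le (hg : IsGapped H γ) {α b : ℝ} (hα : 0 < α)
    (hb : 0 < b) {v : 𝓗} (hv : kernelProj H v = 0) (w : 𝓗) :
    ‖∫ t : ℝ, gaussKernel α b t * ⟪v, expI H (-t) w⟫_ℂ‖ ≤
      2⁻¹ * Real.exp (-α * b ^ 2 - γ ^ 2 / (4 * α)) * ‖v‖ * ‖w‖ := by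
  have hγ := hg.pos
  have hkc : Continuous fun t => gaussKernel α b (-t) :=
    (continuous_gaussKernel α hb).comp continuous_neg
  have hki : Integrable fun t => gaussKernel α b (-t) := (integrable_gaussKernel hα hb).comp_neg
  have h1 := continuousOn_integral_exp hγ hkc hki
  have e1 : ∫ t : ℝ, gaussKernel α b t * ⟪v, expI H (-t) w⟫_ℂ =
      ∫ t : ℝ, gaussKernel α b (-t) * ⟪v, expI H t w⟫_ℂ := by
    rw [← integral_neg_eq_self]
    simp
  rw [e1, ← hg.inner_funCalc_integral hkc hki, ← ContinuousLinearMap.adjoint_inner_left,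
    ← ContinuousLinearMap.star_eq_adjoint, hg.star_funCalc h1]
  refine (norm_inner_le_norm _ _).trans (mul_le_mul_of_nonneg_right ?_ (norm_nonneg _))
  refine hg.norm_funCalc_apply_le h1.conj (by positivity) (fun E hE hE0 => ?_) hv
  have hre := gap_le_re hE hE0
  have key := norm_integral_gaussKernel_neg_le hα hb (hγ.le.trans hre)
  rw [RCLike.norm_conj, ← integral_neg_eq_self]
  refine le_trans (le_of_eq ?_) (key.trans (exp_gap_le hα hγ hre))
  congr 2
  funext t
  rw [neg_neg, Complex.ofReal_neg, Complex.ofReal_neg, ← eq_re_of_mem_gapSet hE]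
  congr 2
  ring

/-- The bound on `⟨a, e^{-bH} v⟩` by the Fourier transform of a function with small values near
zero. -/
theorem IsGapped.norm_inner_expI_le (hg : IsGapped H γ) {α b : ℝ} (hα : 0 < α) (hb : 0 < b)
    (hαb : 2 * α * b ≤ γ) (a w : 𝓗) {v v' : 𝓗} (hv : kernelProj H v = 0)
    (hv' : kernelProj H v' = 0) :
    ‖⟪a, expI H (Complex.I * b) v⟫_ℂ‖ ≤
      2⁻¹ * Real.exp (-α * b ^ 2 - γ ^ 2 / (4 * α)) * (‖a‖ * ‖v‖ + ‖v'‖ * ‖w‖) +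
      ‖∫ t : ℝ, gaussKernel α b t * (⟪a, expI H t v⟫_ℂ - ⟪v', expI H (-t) w⟫_ℂ)‖ := by
  have h1 := hg.norm_inner_expI_sub_le hα hb hαb a hv
  have h2 := hg.norm_integral_inner_expI_neg_le hα hb hv' w
  have hint : ∀ {C : ℝ → ℂ} {M : ℝ}, Continuous C → (∀ t, ‖C t‖ ≤ M) →
      Integrable fun t => gaussKernel α b t * C t := by
    intro C M hC hM
    exact (integrable_gaussKernel hα hb).mul_bdd hC.aestronglyMeasurable
      (Filter.Eventually.of_forall hM)
  have hb' : ∀ (x y : 𝓗) (t : ℝ), ‖⟪x, expI H t y⟫_ℂ‖ ≤ ‖x‖ * ‖y‖ := fun x y t =>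
    (norm_inner_le_norm _ _).trans
      (mul_le_mul_of_nonneg_left (hg.norm_expI_apply_le (by simp) _) (norm_nonneg _))
  have i1 := hint (hg.continuous_inner_expI a v) (hb' a v)
  have i2 := hint (C := fun t => ⟪v', expI H (-t) w⟫_ℂ)
    (by simpa [Function.comp_def] using (hg.continuous_inner_expI v' w).comp continuous_neg)
    (fun t => by simpa using hb' v' w (-t))
  have e : (∫ t : ℝ, gaussKernel α b t * (⟪a, expI H t v⟫_ℂ - ⟪v', expI H (-t) w⟫_ℂ)) =
      (∫ t : ℝ, gaussKernel α b t * ⟪a, expI H t v⟫_ℂ) -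
        ∫ t : ℝ, gaussKernel α b t * ⟪v', expI H (-t) w⟫_ℂ := by
    simp only [mul_sub]
    exact integral_sub i1 i2
  rw [e]
  set I1 := ∫ t : ℝ, gaussKernel α b t * ⟪a, expI H t v⟫_ℂ
  set I2 := ∫ t : ℝ, gaussKernel α b t * ⟪v', expI H (-t) w⟫_ℂ
  have e2 : ⟪a, expI H (Complex.I * b) v⟫_ℂ =
      (⟪a, expI H (Complex.I * b) v⟫_ℂ - I1) + I2 + (I1 - I2) := by ring
  rw [e2]
  refine (norm_add₃_le).trans ?_
  linarith

variable {V : Type*} {dim : V → ℕ} {Φ : Interaction dim}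
  {π : observables dim →⋆ₙₐ[ℂ] (𝓗 →L[ℂ] 𝓗)}

attribute [local instance] observables_isClosed in
theorem norm_rep_le (π : observables dim →⋆ₙₐ[ℂ] (𝓗 →L[ℂ] 𝓗)) (A : observables dim) :
    ‖π A‖ ≤ ‖A‖ :=
  NonUnitalStarAlgHom.norm_apply_le π A

theorem norm_rep_apply_le (π : observables dim →⋆ₙₐ[ℂ] (𝓗 →L[ℂ] 𝓗)) (A : observables dim)
    {Ω : 𝓗} (hΩ : ‖Ω‖ = 1) : ‖π A Ω‖ ≤ ‖A‖ := by
  simpa [hΩ] using ContinuousLinearMap.le_of_opNorm_le _ (norm_rep_le π A) Ω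

theorem inner_rep_apply (π : observables dim →⋆ₙₐ[ℂ] (𝓗 →L[ℂ] 𝓗)) (A : observables dim)
    (x y : 𝓗) : ⟪x, π A y⟫_ℂ = ⟪π (star A) x, y⟫_ℂ := by
  rw [map_star, ContinuousLinearMap.star_eq_adjoint, ContinuousLinearMap.adjoint_inner_left]

theorem correlation_eq (π : observables dim →⋆ₙₐ[ℂ] (𝓗 →L[ℂ] 𝓗)) (H : 𝓗 →ₗ.[ℂ] 𝓗) (Ω : 𝓗)
    (A B : observables dim) (z : ℂ) :
    correlation π H Ω A B z = ⟪π (star A) Ω, expI H z (π B Ω)⟫_ℂ :=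
  inner_rep_apply π A _ _

theorem IsGapped.expI_neg_apply (hg : IsGapped H γ) (t : ℝ) {Ω : 𝓗} (hHΩ : Ω ∈ kernel H) :
    expI H (-t) Ω = Ω :=
  hg.expI_apply_of_mem_kernel (by simp) hHΩ

theorem Represents.dynamics_apply (hH : Represents Φ π H) (hg : IsGapped H γ) {Ω : 𝓗}
    (hHΩ : Ω ∈ kernel H) (t : ℝ) (B : observables dim) :
    π (Φ.dynamics t B) Ω = expI H t (π B Ω) := by
  rw [hH.covariant]
  simp only [mul_apply_eq_comp, hg.expI_neg_apply t hHΩ]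

theorem Represents.inner_dynamics_apply (hH : Represents Φ π H) (hg : IsGapped H γ) {Ω : 𝓗}
    (hHΩ : Ω ∈ kernel H) (t : ℝ) (B : observables dim) (w : 𝓗) :
    ⟪Ω, π (Φ.dynamics t B) w⟫_ℂ = ⟪π (star B) Ω, expI H (-t) w⟫_ℂ := by
  rw [hH.covariant, ← inner_rep_apply]
  simp only [mul_apply_eq_comp]
  rw [← ContinuousLinearMap.adjoint_inner_left, ← ContinuousLinearMap.star_eq_adjoint,
    hg.star_expI, hg.expI_neg_apply t hHΩ]

/-- Both `e^{itH}` and `e^{-itH}` fix `Ω`, so the two orderings carry opposite signs of the time. -/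
theorem Represents.inner_commutator (hH : Represents Φ π H) (hg : IsGapped H γ) {Ω : 𝓗}
    (hHΩ : Ω ∈ kernel H) (t : ℝ) (A B : observables dim) :
    ⟪Ω, π (A * Φ.dynamics t B - Φ.dynamics t B * A) Ω⟫_ℂ =
      ⟪π (star A) Ω, expI H t (π B Ω)⟫_ℂ - ⟪π (star B) Ω, expI H (-t) (π A Ω)⟫_ℂ := by
  rw [map_sub, map_mul, map_mul, sub_apply, inner_sub_right]
  simp only [mul_apply_eq_comp]
  rw [hH.dynamics_apply hg hHΩ, hH.inner_dynamics_apply hg hHΩ, inner_rep_apply]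

variable [MetricSpace V] {N : ℕ} {lam : ℝ}

set_option maxHeartbeats 1000000 in
/-- Exponential clustering at imaginary times `b > 0`. -/
theorem norm_correlation_le_of_pos (hpos : ∀ x, 0 < dim x) (hdim : ∀ x, dim x ≤ N)
    (hlam : 0 < lam) (hΦ : Φ.enorm N lam ≠ ⊤) (hH : Represents Φ π H) (hg : IsGapped H γ) {Ω : 𝓗}
    (hΩ : ‖Ω‖ = 1) (hHΩ : Ω ∈ kernel H) {μ : ℝ}
    (hμ : μ = γ * lam / (4 * (Φ.enorm N lam).toReal + γ)) {x : V} {Y : Finset V}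
    {A B : observables dim} (hx : x ∉ Y) (hA : IsLocalIn {x} A) (hB : IsLocalIn Y B)
    (hPB : kernelProj H (π B Ω) = 0) (hPB' : kernelProj H (π (star B) Ω) = 0) {d : ℝ}
    (hd : d = Metric.infDist x (Y : Set V)) (hdpos : 0 < d) {b : ℝ} (hb : 0 < b)
    (hbd : γ * b ≤ 2 * μ * d) :
    ‖correlation π H Ω A B (Complex.I * b)‖ ≤
      ‖A‖ * ‖B‖ * (1 + 2 / Real.pi + 1 / √(Real.pi * μ * d)) *
        Real.exp (-μ * d * (1 + γ ^ 2 * b ^ 2 / (4 * μ ^ 2 * d ^ 2))) := by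
  have hγ := hg.pos
  set K := (Φ.enorm N lam).toReal with hKdef
  have hK : 0 ≤ K := ENNReal.toReal_nonneg
  have hμpos : 0 < μ := by
    rw [hμ]
    positivity
  -- With these `α` and `s` the spectral error `γ²/(4α)` and the Gaussian tail exponent `αs²` both
  -- equal `μd`. The condition `2αb ≤ γ` becomes `b ≤ s`, the range of `b` in the theorem.
  set α := γ ^ 2 / (4 * μ * d) with hα
  have hαpos : 0 < α := by positivity
  set s := 2 * μ * d / γ with hs
  have hspos : 0 < s := by positivity
  have hαb : 2 * α * b ≤ γ := by
    have : 2 * α * b = γ * (γ * b) / (2 * μ * d) := by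
      rw [hα]
      field_simp
      norm_num
    rw [this, div_le_iff₀ (by positivity)]
    gcongr
  have hgap : γ ^ 2 / (4 * α) = μ * d := by
    rw [hα]
    field_simp
  have hαs : α * s ^ 2 = μ * d := by
    rw [hα, hs]
    field_simp
    norm_num
  -- The Lieb-Robinson term decays at the same rate; this fixes `μ`.
  have hexp : -lam * d + 2 * K * s = -(μ * d) := by
    have : lam = μ * (4 * K + γ) / γ := by
      rw [hμ]
      field_simp
    rw [this, hs]
    field_simp
    ring
  have hsqrt : s⁻¹ * √(Real.pi / α) = Real.pi * (1 / √(Real.pi * μ * d)) := by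
    have h1 : α = μ * d / s ^ 2 := by
      rw [← hαs]
      field_simp
    rw [h1, mul_assoc, Real.sqrt_mul Real.pi_pos.le, div_div_eq_mul_div,
      Real.sqrt_div (by positivity), Real.sqrt_mul Real.pi_pos.le, Real.sqrt_sq hspos.le]
    have h2 : √(μ * d) ≠ 0 := (Real.sqrt_pos.mpr (by positivity)).ne'
    have h3 : √Real.pi ≠ 0 := (Real.sqrt_pos.mpr Real.pi_pos).ne'
    field_simp
    rw [Real.sq_sqrt Real.pi_pos.le]
  rw [correlation_eq]
  have hAs : ‖π (star A) Ω‖ ≤ ‖A‖ := (norm_rep_apply_le π (star A) hΩ).trans (norm_star A).le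
  have hBs : ‖π (star B) Ω‖ ≤ ‖B‖ := (norm_rep_apply_le π (star B) hΩ).trans (norm_star B).le
  have hAn := norm_rep_apply_le π A hΩ
  have hBn := norm_rep_apply_le π B hΩ
  have key := hg.norm_inner_expI_le hαpos hb hαb (π (star A) Ω) (π A Ω) hPB hPB'
  set C : ℝ → ℂ := fun t => ⟪π (star A) Ω, expI H t (π B Ω)⟫_ℂ -
    ⟪π (star B) Ω, expI H (-t) (π A Ω)⟫_ℂ with hC
  have hCle : ∀ t, ‖C t‖ ≤ ‖A * Φ.dynamics t B - Φ.dynamics t B * A‖ := by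
    intro t
    simp only [hC]
    rw [← hH.inner_commutator hg hHΩ]
    refine (norm_inner_le_norm _ _).trans ?_
    rw [hΩ, one_mul]
    exact norm_rep_apply_le π _ hΩ
  have hC2 : ∀ t, ‖C t‖ ≤ 2 * ‖A‖ * ‖B‖ * (Real.exp (-lam * d) * (Real.exp (2 * K * |t|) - 1)) := by
    intro t
    refine (hCle t).trans
      ((Interaction.norm_commutator_dynamics_le hpos hdim hlam.le hΦ hx hA hB t).trans
        (le_of_eq ?_))
    rw [hd]
    ring
  have hC1 : ∀ t, ‖C t‖ ≤ 2 * ‖A‖ * ‖B‖ := by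
    intro t
    have n1 : ‖⟪π (star A) Ω, expI H t (π B Ω)⟫_ℂ‖ ≤ ‖A‖ * ‖B‖ :=
      (norm_inner_le_norm _ _).trans (mul_le_mul hAs
        ((hg.norm_expI_apply_le (by simp) _).trans hBn) (norm_nonneg _) (norm_nonneg _))
    have n2 : ‖⟪π (star B) Ω, expI H (-t) (π A Ω)⟫_ℂ‖ ≤ ‖B‖ * ‖A‖ :=
      (norm_inner_le_norm _ _).trans (mul_le_mul hBs
        ((hg.norm_expI_apply_le (by simp) _).trans hAn) (norm_nonneg _) (norm_nonneg _))
    refine (norm_sub_le _ _).trans ?_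
    linarith
  have hint := norm_integral_gaussKernel_mul_le hαpos hb hspos hK
    (by positivity : 0 ≤ 2 * ‖A‖ * ‖B‖) (Real.exp_pos (-lam * d)).le hC1 hC2
  have hAB : ‖π (star A) Ω‖ * ‖π B Ω‖ + ‖π (star B) Ω‖ * ‖π A Ω‖ ≤ 2 * (‖A‖ * ‖B‖) := by
    have h1 := mul_le_mul hAs hBn (norm_nonneg _) (norm_nonneg _)
    have h2 := mul_le_mul hBs hAn (norm_nonneg _) (norm_nonneg _)
    linarith
  have hX : Real.exp (-μ * d * (1 + γ ^ 2 * b ^ 2 / (4 * μ ^ 2 * d ^ 2))) =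
      Real.exp (-α * b ^ 2) * Real.exp (-(μ * d)) := by
    rw [← Real.exp_add]
    congr 1
    rw [hα]
    field_simp
    ring
  have hX' : Real.exp (-α * b ^ 2 - γ ^ 2 / (4 * α)) =
      Real.exp (-α * b ^ 2) * Real.exp (-(μ * d)) := by
    rw [hgap, sub_eq_add_neg, Real.exp_add]
  have hE1 : Real.exp (-lam * d) * (Real.exp (2 * K * s) - 1) ≤ Real.exp (-(μ * d)) := by
    rw [mul_sub, ← Real.exp_add, hexp, mul_one]
    linarith [Real.exp_pos (-lam * d)]
  have hE2 : s⁻¹ * (Real.exp (-α * s ^ 2) * (√(Real.pi / α) / 2)) =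
      Real.exp (-(μ * d)) * (Real.pi * (1 / √(Real.pi * μ * d))) / 2 := by
    rw [neg_mul, hαs, ← hsqrt]
    ring
  rw [hE2] at hint
  -- The summand `1` of the constant is the spectral error, `2/π` comes from times `|t| ≤ s`, and
  -- `1/√(πμd)` from times `|t| > s`.
  refine key.trans ((add_le_add (mul_le_mul_of_nonneg_left hAB (by positivity)) (hint.trans
    (mul_le_mul_of_nonneg_left (mul_le_mul_of_nonneg_left (add_le_add_left hE1 _) zero_le_two)
      (by positivity)))).trans (le_of_eq ?_))
  rw [hX, hX']
  have hpi := Real.pi_ne_zero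
  generalize 1 / √(Real.pi * μ * d) = Z
  field_simp
  ring

end Clustering

/-! ### The correlation function and the end point `b = 0`. -/

section Correlation

variable {𝓗 : Type*} [NormedAddCommGroup 𝓗] [InnerProductSpace ℂ 𝓗] [CompleteSpace 𝓗]
variable {H : 𝓗 →ₗ.[ℂ] 𝓗} {γ : ℝ}
variable {V : Type*} {dim : V → ℕ} {Φ : Interaction dim}
  {π : observables dim →⋆ₙₐ[ℂ] (𝓗 →L[ℂ] 𝓗)}

theorem inner_eq_zero_of_kernelProj_eq_zero {Ω v : 𝓗} (hΩ : Ω ∈ kernel H)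
    (hv : kernelProj H v = 0) : ⟪Ω, v⟫_ℂ = 0 := by
  have hv' : v ∈ (kernel H).topologicalClosureᗮ :=
    (Submodule.starProjection_apply_eq_zero_iff _).1 hv
  exact hv' Ω ((kernel H).le_topologicalClosure hΩ)

theorem IsGapped.continuousOn_correlation (hg : IsGapped H γ) (Ω : 𝓗) (A B : observables dim) :
    ContinuousOn (correlation π H Ω A B) {z | 0 ≤ z.im} := by
  rw [funext (correlation_eq π H Ω A B)]
  exact hg.continuousOn_inner_expI _ _

theorem IsGapped.differentiableOn_correlation (hg : IsGapped H γ) (Ω : 𝓗)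
    (A B : observables dim) : DifferentiableOn ℂ (correlation π H Ω A B) {z | 0 < z.im} := by
  rw [funext (correlation_eq π H Ω A B)]
  exact hg.differentiableOn_inner_expI _ _

theorem Represents.correlation_ofReal (hH : Represents Φ π H) (hg : IsGapped H γ) {Ω : 𝓗}
    (hHΩ : Ω ∈ kernel H) (A B : observables dim) (t : ℝ) :
    correlation π H Ω A B t = ⟪Ω, π A (π (Φ.dynamics t B) Ω)⟫_ℂ := by
  rw [correlation, hH.dynamics_apply hg hHΩ]

theorem IsGapped.correlation_zero (hg : IsGapped H γ) (Ω : 𝓗) (A B : observables dim) :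
    correlation π H Ω A B 0 = ⟪Ω, π A (π B Ω)⟫_ℂ := by
  simp [correlation, hg.expI_zero]

/-- The bounded linear functional `B ↦ ⟨Ω, A B Ω⟩` on the observables. -/
def correlationFunctional (π : observables dim →⋆ₙₐ[ℂ] (𝓗 →L[ℂ] 𝓗)) (Ω : 𝓗)
    (A : observables dim) : observables dim →L[ℂ] ℂ :=
  innerSL ℂ Ω ∘L (π A) ∘L (ContinuousLinearMap.apply ℂ 𝓗 Ω) ∘L
    (LinearMap.mkContinuous
      { toFun := π
        map_add' := map_add π
        map_smul' := map_smul π } 1 fun B => by simpa using norm_rep_le π B)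

theorem correlationFunctional_apply (Ω : 𝓗) (A B : observables dim) :
    correlationFunctional π Ω A B = ⟪Ω, π A (π B Ω)⟫_ℂ := rfl

theorem Represents.correlation_eq_of_continuation (hH : Represents Φ π H) (hg : IsGapped H γ)
    {Ω : 𝓗} (hHΩ : Ω ∈ kernel H) (A B : observables dim) {r : ℝ} {T : ℂ → observables dim}
    (hT : DifferentiableOn ℂ T (Metric.ball 0 r))
    (hTB : ∀ t : ℝ, |t| < r → T t = Φ.dynamics t B) {b : ℝ} (hb : 0 ≤ b) (hbr : b < r) :
    correlation π H Ω A B (Complex.I * b) = ⟪Ω, π A (π (T (Complex.I * b)) Ω)⟫_ℂ := by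
  have heq : ∀ t : ℝ, |t| < r →
      correlation π H Ω A B t = correlationFunctional π Ω A (T t) := fun t ht => by
    rw [hH.correlation_ofReal hg hHΩ, hTB t ht, correlationFunctional_apply]
  rcases hb.eq_or_lt with rfl | hb
  · simpa [correlationFunctional_apply] using heq 0 (by simpa using hbr)
  · exact eq_of_eq_on_real (hg.continuousOn_correlation Ω A B)
      (hg.differentiableOn_correlation Ω A B)
      ((correlationFunctional π Ω A).differentiable.comp_differentiableOn hT) heq hb hbr

variable [MetricSpace V] {N : ℕ} {lam : ℝ}

/-- Exponential clustering at imaginary times `b ≥ 0`. -/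
theorem norm_correlation_le (hpos : ∀ x, 0 < dim x) (hdim : ∀ x, dim x ≤ N)
    (hlam : 0 < lam) (hΦ : Φ.enorm N lam ≠ ⊤) (hH : Represents Φ π H) (hg : IsGapped H γ) {Ω : 𝓗}
    (hΩ : ‖Ω‖ = 1) (hHΩ : Ω ∈ kernel H) {μ : ℝ}
    (hμ : μ = γ * lam / (4 * (Φ.enorm N lam).toReal + γ)) (hμpos : 0 < μ) {x : V} {Y : Finset V}
    {A B : observables dim} (hx : x ∉ Y) (hA : IsLocalIn {x} A) (hB : IsLocalIn Y B)
    (hPB : kernelProj H (π B Ω) = 0) (hPB' : kernelProj H (π (star B) Ω) = 0) {d : ℝ}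
    (hd : d = Metric.infDist x (Y : Set V)) {b : ℝ} (hb : 0 ≤ b) (hbd : γ * b ≤ 2 * μ * d) :
    ‖correlation π H Ω A B (Complex.I * b)‖ ≤
      ‖A‖ * ‖B‖ * (1 + 2 * (Y.card : ℝ) / Real.pi + 1 / √(Real.pi * μ * d)) *
        Real.exp (-μ * d * (1 + γ ^ 2 * b ^ 2 / (4 * μ ^ 2 * d ^ 2))) := by
  have hγ := hg.pos
  rcases Y.eq_empty_or_nonempty with rfl | hY
  -- `Metric.infDist` to the empty set is `0`, so `b = 0`; as `1/√0 = 0` in Lean, the claim is the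
  -- Cauchy-Schwarz bound by `‖A‖‖B‖`.
  · have hd0 : d = 0 := by simpa using hd
    have hb0 : b = 0 := by
      rw [hd0, mul_zero] at hbd
      exact le_antisymm (nonpos_of_mul_nonpos_right hbd hγ) hb
    subst hd0 hb0
    simp only [Finset.card_empty, Nat.cast_zero, mul_zero, zero_div, add_zero, Real.sqrt_zero,
      div_zero, mul_one, zero_mul, Real.exp_zero, Complex.ofReal_zero, correlation_eq,
      hg.expI_zero, one_apply_eq_self]
    refine (norm_inner_le_norm _ _).trans (mul_le_mul ?_ (norm_rep_apply_le π B hΩ)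
      (norm_nonneg _) (norm_nonneg _))
    exact (norm_rep_apply_le π (star A) hΩ).trans_eq (norm_star A)
  have hdpos : 0 < d := by
    rw [hd]
    exact (Y.finite_toSet.isClosed.notMem_iff_infDist_pos (by simpa using hY)).1 (by simpa using hx)
  have hcard : 2 / Real.pi ≤ 2 * (Y.card : ℝ) / Real.pi := by
    have : (1 : ℝ) ≤ Y.card := by exact_mod_cast hY.card_pos
    gcongr
    linarith
  have key : ∀ {b : ℝ}, 0 < b → γ * b ≤ 2 * μ * d → ‖correlation π H Ω A B (Complex.I * b)‖ ≤
      ‖A‖ * ‖B‖ * (1 + 2 * (Y.card : ℝ) / Real.pi + 1 / √(Real.pi * μ * d)) *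
        Real.exp (-μ * d * (1 + γ ^ 2 * b ^ 2 / (4 * μ ^ 2 * d ^ 2))) := fun hb hbd =>
    (norm_correlation_le_of_pos hpos hdim hlam hΦ hH hg hΩ hHΩ hμ hx hA hB hPB hPB' hd hdpos hb
      hbd).trans (by gcongr)
  rcases hb.eq_or_lt with rfl | hb
  -- The filter needs `b > 0`. Since `d > 0`, small positive `b` are in range, and the bound passes
  -- to the limit `b → 0`.
  · have hsmall : ∀ᶠ b : ℝ in nhdsWithin 0 (Set.Ioi 0), γ * b ≤ 2 * μ * d := by
      have hc : Filter.Tendsto (fun b : ℝ => γ * b) (nhds 0) (nhds (γ * 0)) :=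
        (continuous_const.mul continuous_id).tendsto 0
      refine nhdsWithin_le_nhds (hc.eventually_le_const ?_)
      rw [mul_zero]
      positivity
    refine le_of_tendsto_of_tendsto (b := nhdsWithin (0 : ℝ) (Set.Ioi 0)) ?_ ?_
      ((hsmall.and self_mem_nhdsWithin).mono fun b hb => key hb.2 hb.1)
    · have hc : ContinuousOn (fun b : ℝ => correlation π H Ω A B (Complex.I * b)) (Set.Ici 0) :=
        (hg.continuousOn_correlation Ω A B).comp (by fun_prop) fun b hb => by simpa using hb
      exact ((hc 0 Set.self_mem_Ici).mono Set.Ioi_subset_Ici_self).norm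
    · refine ((Continuous.tendsto ?_ (0 : ℝ)).mono_left nhdsWithin_le_nhds)
      fun_prop
  · exact key hb hbd

end Correlation

end SpinSystem

end

theorem theorem2 {V : Type*} [MetricSpace V]
    -- the dimensions of the single-site Hilbert spaces and a uniform bound on them
    (dim : V → ℕ) (N : ℕ) (hdim_pos : ∀ x, 0 < dim x) (hdim_le : ∀ x, dim x ≤ N)
    -- an interaction of finite norm
    (Φ : SpinSystem.Interaction dim) (lam : ℝ) (hlam : 0 < lam) (hΦ : Φ.enorm N lam ≠ ⊤)
    -- a representation of the system with a ground state and a spectral gap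
    {𝓗 : Type*} [NormedAddCommGroup 𝓗] [InnerProductSpace ℂ 𝓗] [CompleteSpace 𝓗]
    (π : SpinSystem.observables dim →⋆ₙₐ[ℂ] (𝓗 →L[ℂ] 𝓗)) (H : 𝓗 →ₗ.[ℂ] 𝓗)
    (hH : SpinSystem.Represents Φ π H) (hH_nonneg : SpinSystem.IsNonneg H)
    (Ω : 𝓗) (hΩ : ‖Ω‖ = 1) (hHΩ : Ω ∈ SpinSystem.kernel H)
    (γ : ℝ) (hγ : SpinSystem.IsSpectralGap H γ) :
    ∃ μ : ℝ, 0 < μ ∧ μ = γ * lam / (4 * (Φ.enorm N lam).toReal + γ) ∧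
      ∀ (x : V) (Y : Finset V) (A B : SpinSystem.observables dim), x ∉ Y →
        SpinSystem.IsLocalIn {x} A → SpinSystem.IsLocalIn Y B →
        SpinSystem.kernelProj H (π B Ω) = 0 → SpinSystem.kernelProj H (π (star B) Ω) = 0 →
        ∃ (d c : ℝ) (f : ℂ → ℂ),
          d = Metric.infDist x (Y : Set V) ∧
          c = ‖A‖ * ‖B‖ * (1 + 2 * (Y.card : ℝ) / Real.pi + 1 / √(Real.pi * μ * d)) ∧
          f = SpinSystem.correlation π H Ω A B ∧
          -- `f z = ⟨Ω, A τ_z(B) Ω⟩`: the right values for real `z`, analytic for `Im z > 0`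
          -- and continuous up to the real axis
          (∀ t : ℝ, f t = inner ℂ Ω (π A (π (Φ.dynamics t B) Ω))) ∧
          ContinuousOn f {z : ℂ | 0 ≤ z.im} ∧
          DifferentiableOn ℂ f {z : ℂ | 0 < z.im} ∧
          -- the right values for imaginary `z = i b`, wherever `τ_z(B)` is an observable, defined
          -- by analytic continuation on a disk of radius `r > b`
          (∀ (r : ℝ) (T : ℂ → SpinSystem.observables dim),
            DifferentiableOn ℂ T (Metric.ball 0 r) →
            (∀ t : ℝ, |t| < r → T t = Φ.dynamics t B) →
            ∀ b : ℝ, 0 ≤ b → b < r →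
              f (Complex.I * b) = inner ℂ Ω (π A (π (T (Complex.I * b)) Ω))) ∧
          -- the bound on `⟨Ω, A τ_{ib}(B) Ω⟩`
          (∀ b : ℝ, 0 ≤ γ * b → γ * b ≤ 2 * μ * d →
            ‖f (Complex.I * b)‖ ≤
              c * Real.exp (-μ * d * (1 + γ ^ 2 * b ^ 2 / (4 * μ ^ 2 * d ^ 2)))) ∧
          -- the connected equal-time correlations
          ‖inner ℂ Ω (π A (π B Ω)) - inner ℂ Ω (π A Ω) * inner ℂ Ω (π B Ω)‖ ≤
            c * Real.exp (-μ * d) := by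
  have hg : SpinSystem.IsGapped H γ := ⟨hH.isSelfAdjoint, hH_nonneg, hγ⟩
  have hγpos := hg.pos
  have hK : 0 ≤ (Φ.enorm N lam).toReal := ENNReal.toReal_nonneg
  obtain ⟨μ, hμ⟩ : ∃ μ, μ = γ * lam / (4 * (Φ.enorm N lam).toReal + γ) := ⟨_, rfl⟩
  have hμpos : 0 < μ := by
    rw [hμ]
    positivity
  refine ⟨μ, hμpos, hμ, fun x Y A B hx hA hB hPB hPB' => ⟨_, _, _, rfl, rfl, rfl,
    hH.correlation_ofReal hg hHΩ A B, hg.continuousOn_correlation Ω A B,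
    hg.differentiableOn_correlation Ω A B, fun r T hT hTB b hb hbr =>
      hH.correlation_eq_of_continuation hg hHΩ A B hT hTB hb hbr, fun b hb hbd =>
      SpinSystem.norm_correlation_le hdim_pos hdim_le hlam hΦ hH hg hΩ hHΩ hμ hμpos hx hA hB hPB
        hPB' rfl (nonneg_of_mul_nonneg_right hb hγpos) hbd, ?_⟩⟩
  -- The equal-time bound is the case `b = 0`; the product of expectations vanishes because `⟨Ω, BΩ⟩
  -- = 0`.
  have h := SpinSystem.norm_correlation_le hdim_pos hdim_le hlam hΦ hH hg hΩ hHΩ hμ hμpos hx hA hB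
    hPB hPB' rfl le_rfl
    (by simpa using mul_nonneg (mul_nonneg zero_le_two hμpos.le) Metric.infDist_nonneg)
  simpa [SpinSystem.inner_eq_zero_of_kernelProj_eq_zero hHΩ hPB, hg.correlation_zero] using h
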